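/- For integers $n, d \ge 1$ and $p \in (0,1]$, let $\mathsf{RGG}(n,\mathbb{S}^{d-1},p)$ be the law of the random graph on $\{1,\dots,n\}$ obtained by drawing $V_1,\dots,V_n$ independently and uniformly from the unit sphere $\mathbb{S}^{d-1} \subset \mathbb{R}^d$ and joining $i \ne j$ if and only if $\langle V_i, V_j\rangle \ge \tau$, where $\tau = \tau_d^p$ is such that $\Pr[\langle U, V\rangle \ge \tau] = p$ for independent uniform $U, V \in \mathbb{S}^{d-1}$. Let $\mathsf{G}(n,q)$ be the Erdős–Rényi law in which each edge appears independently with probability $q$; a value $q<0$ is read as $0$ and a value $q>1$ as $1$. Let $a, b > 0$. There is a constant $c > 0$, depending only on $a$ and $b$, such that for every $\varepsilon > 0$ there is $N$ such that the following holds for all $n \ge N$, all $d$ and all $p$ with $$d \ge a\max\big(np(\log n)^4, (\log n)^5\big), \qquad \frac{b}{n} \le p \le 1.$$ A threshold $\tau_d^p$ exists, and, with $$\delta = \frac{c\,\max\big(\sqrt{np}, \sqrt{\log n}\big)(\log n)^2}{\sqrt d},$$ there is, for any such threshold, a coupling of $H_- \sim \mathsf{G}(n,p(1-\delta))$, $G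 \sim \mathsf{RGG}(n,\mathbb{S}^{d-1},p)$ and $H_+ \sim \mathsf{G}(n,p(1+\delta))$ such that $$\Pr[H_- \subseteq G \subseteq H_+] \ge 1 - \varepsilon,$$ where inclusion is inclusion of edge sets. -/

import Mathlib

open MeasureTheory

/-- The uniform probability measure on the unit sphere `𝕊^{d-1}` of `ℝ^d`:
the normalized surface measure. -/
noncomputable def sphereUniform (d : ℕ) :
    Measure (Metric.sphere (0 : EuclideanSpace ℝ (Fin d)) 1) :=
  ((volume : Measure (EuclideanSpace ℝ (Fin d))).toSphere Set.univ)⁻¹ •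
    (volume : Measure (EuclideanSpace ℝ (Fin d))).toSphere

/-- `τ` is a threshold for edge density `p` in dimension `d`: two independent uniform vectors
`U, V` on `𝕊^{d-1}` satisfy `⟪U, V⟫ ≥ τ` with probability exactly `p`. -/
def IsThreshold (d : ℕ) (p τ : ℝ) : Prop :=
  ((sphereUniform d).prod (sphereUniform d))
    {x | τ ≤ inner ℝ (x.1 : EuclideanSpace ℝ (Fin d)) (x.2 : EuclideanSpace ℝ (Fin d))}
    = ENNReal.ofReal p

/-- The geometric graph of unit vectors `v 0, …, v (n-1)`: distinct `i`, `j` are adjacent if and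
only if `⟪v i, v j⟫ ≥ τ`. -/
def sphericalGraph {n d : ℕ} (τ : ℝ)
    (v : Fin n → Metric.sphere (0 : EuclideanSpace ℝ (Fin d)) 1) : SimpleGraph (Fin n) where
  Adj i j := i ≠ j ∧
    τ ≤ inner ℝ (v i : EuclideanSpace ℝ (Fin d)) (v j : EuclideanSpace ℝ (Fin d))
  symm := ⟨fun i j h => ⟨h.1.symm, by rw [real_inner_comm]; exact h.2⟩⟩
  loopless := ⟨fun _ h => h.1 rfl⟩

theorem measurable_sphericalGraph {n d : ℕ} (τ : ℝ) :
    Measurable (sphericalGraph (n := n) (d := d) τ) := by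
  rw [SimpleGraph.measurable_iff_adj]
  intro i j
  have h : MeasurableSet {v : Fin n → Metric.sphere (0 : EuclideanSpace ℝ (Fin d)) 1 |
      τ ≤ inner ℝ (v i : EuclideanSpace ℝ (Fin d)) (v j : EuclideanSpace ℝ (Fin d))} :=
    measurableSet_le measurable_const (by fun_prop)
  exact (MeasurableSet.const (i ≠ j)).inter h |>.mem

/-- The law of the spherical random geometric graph on `n` vertices in dimension `d` with
threshold `τ`, that is, of the geometric graph of `n` independent uniform vectors on `𝕊^{d-1}`. -/
noncomputable def sphericalRGG (n d : ℕ) (τ : ℝ) : Measure (SimpleGraph (Fin n)) :=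
  (Measure.pi fun _ : Fin n => sphereUniform d).map (sphericalGraph τ)

/-- The Erdős–Rényi law `G(n, q)`; a parameter outside `[0, 1]` is replaced by the nearest
point of `[0, 1]`. -/
noncomputable def erdosRenyi (n : ℕ) (q : ℝ) : Measure (SimpleGraph (Fin n)) :=
  SimpleGraph.binomialRandom (Fin n) (Set.projIcc (0 : ℝ) 1 zero_le_one q)

/-- `γ` is a coupling of the three laws `μ₁`, `μ₂`, `μ₃`. -/
def IsTripleCoupling {α : Type*} [MeasurableSpace α] (μ₁ μ₂ μ₃ : Measure α)
    (γ : Measure (α × α × α)) : Prop :=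
  γ.map (fun x => x.1) = μ₁ ∧ γ.map (fun x => x.2.1) = μ₂ ∧ γ.map (fun x => x.2.2) = μ₃

/-- The relative error `δ = c · max(√(np), √(log n)) · (log n)² / √d`. -/
noncomputable def sandwichError (c : ℝ) (n d : ℕ) (p : ℝ) : ℝ :=
  c * max (√(n * p)) (√(Real.log n)) * Real.log n ^ 2 / √d

/-! ### Standard Gaussian vectors: radial density, direction, norm concentration. -/

section GaussianSphere

open ProbabilityTheory Metric
open scoped ENNReal RealInnerProductSpace

/-! Edges are revealed in lexicographic order, each vertex `i` querying its predecessors one after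
another. For the edge from `i` to `k < i`, fix all vectors except `V_i` and the adjacency of `V_i`
to the vectors before `V_k`. Then `V_i` is uniform on a cell `C`, an intersection of caps and
complements of caps, and the edge appears with probability `ν(cap(V_k))`, where `ν` is the uniform
law on `C`; this number is `edgeProb`. A bit-by-bit coupling with independent coins
(`exists_bernoulli_coupling`) violates the order with probability at most the sum over edges of the
expected excess of `|edgeProb - p|` over `p δ`. The lower and the upper coupling share the geometric
graph and are glued along it (`exists_tripleCoupling_of_kernels`). It remains to bound each expected
excess by `O(n⁻³)`. The expectation is under the unconditional law, so `V_k` is uniform and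
independent of `C`.

Write `L = log n`, `Z = max(np, L)`. Cells of mass below `exp(-12 L Z)` have probability at most
`exp(-4 Z)` (`HasCapMass.measure_edgeCell_lt_le_exp`). Otherwise `ν` has density at most `exp m`
with `m = 12 L Z`, and the question becomes one about a fixed measure: for uniform `v`, is
`ν(cap(v))` close to `p` (`lintegral_capMass_excess_le`)?

Put `v = g/‖g‖` with `g` Gaussian, and smooth the cap at scale `w`. This gives an average over `ν`
of ridge functions of `g`, whose Gaussian mean does not depend on `ν`. By an entropy inequality its
gradient is at most of order `w⁻¹ √((m + log(4/η))/d) (Q(g) + η)`, where `Q(g)` is the `ν`-mass near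
the boundary of the cap (`norm_ridgeGradient_le`). The factor `Q` is what produces an error relative
to `p`. With a hyperbolic-secant profile, `log(Q + η)` is Lipschitz, so the Maurey–Pisier inequality
bounds the moments of `Q + η` by powers of its mean, which is of order `w φ(c) + η` for the Gaussian
density `φ` (`lintegral_ridgeAverage_pow_le`). A second use of Maurey–Pisier, at power `2r` with `r`
about `2L`, bounds the deviation by `O(w φ(c) + η)` with the required probability.

Since `φ(τ√d)` is at most of order `√L p` up to a negligible term, the relative error is of order `w
√L` with `w` of order `L √(Z/d)`. This is smaller than `δ` by a factor of order `√L`, and so `c = 1`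
suffices for large `n`. Two ranges are treated apart: if `|τ| √d > 30 √L`, tail bounds contradict
the lower bound on `p` or make the claim trivial; if `d > exp(40 L)`, a first-moment bound suffices.
-/

theorem stdGaussian_eq_withDensity (d : ℕ) :
    stdGaussian (EuclideanSpace ℝ (Fin d)) = volume.withDensity
      (fun x => ENNReal.ofReal ((2 * Real.pi) ^ (-(d : ℝ) / 2) * Real.exp (-(1 / 2) * ‖x‖ ^ 2))) := by
  have hπ : (0 : ℝ) < 2 * Real.pi := by positivity
  have hI : Integrable (fun x : EuclideanSpace ℝ (Fin d) =>
      (2 * Real.pi) ^ (-(d : ℝ) / 2) * Real.exp (-(1 / 2) * ‖x‖ ^ 2)) := by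
    refine Integrable.const_mul ?_ _
    have h := GaussianFourier.integrable_cexp_neg_mul_sq_norm_add
      (V := EuclideanSpace ℝ (Fin d)) (b := 1 / 2) (by norm_num) 0 0
    have h2 := h.re
    refine h2.congr (Filter.Eventually.of_forall fun x => ?_)
    simp only [zero_mul, add_zero]
    have : (-(1 / 2 : ℂ) * (‖x‖ : ℂ) ^ 2) = ((-(1 / 2) * ‖x‖ ^ 2 : ℝ) : ℂ) := by push_cast; ring
    rw [this, ← Complex.ofReal_exp]; rfl
  have : IsFiniteMeasure ((volume : Measure (EuclideanSpace ℝ (Fin d))).withDensity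
      (fun x => ENNReal.ofReal ((2 * Real.pi) ^ (-(d : ℝ) / 2) *
        Real.exp (-(1 / 2) * ‖x‖ ^ 2)))) :=
    isFiniteMeasure_withDensity_ofReal hI.2
  refine Measure.ext_of_charFun ?_
  ext t
  rw [charFun_stdGaussian, charFun_apply, integral_withDensity_eq_integral_toReal_smul
    (by fun_prop) (Filter.Eventually.of_forall fun x => ENNReal.ofReal_lt_top)]
  have h1 : ∀ x : EuclideanSpace ℝ (Fin d),
      (ENNReal.ofReal ((2 * Real.pi) ^ (-(d : ℝ) / 2) *
        Real.exp (-(1 / 2) * ‖x‖ ^ 2))).toReal • Complex.exp (⟪x, t⟫ * Complex.I) =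
      (((2 * Real.pi) ^ (-(d : ℝ) / 2) : ℝ) : ℂ) *
        Complex.exp (-(1 / 2) * ‖x‖ ^ 2 + Complex.I * ⟪t, x⟫) := by
    intro x
    rw [ENNReal.toReal_ofReal (by positivity), Complex.real_smul, Complex.exp_add,
      real_inner_comm t x]
    push_cast
    ring_nf
  simp_rw [h1]
  rw [integral_const_mul, GaussianFourier.integral_cexp_neg_mul_sq_norm_add (by norm_num)]
  rw [finrank_euclideanSpace_fin]
  have h2 : ((Real.pi : ℂ) / (1 / 2)) ^ ((d : ℂ) / 2) =
      (((2 * Real.pi) ^ ((d : ℝ) / 2) : ℝ) : ℂ) := by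
    rw [Complex.ofReal_cpow hπ.le]
    push_cast
    congr 1
    ring
  rw [h2, ← mul_assoc, ← Complex.ofReal_mul, ← Real.rpow_add hπ]
  have : -(d : ℝ) / 2 + d / 2 = 0 := by ring
  rw [this, Real.rpow_zero, Complex.ofReal_one, one_mul, Complex.I_sq]
  congr 1
  ring

/-- The density is radial, so in polar coordinates the integral factors into a spherical and a
radial part. The case `f = 1` identifies the radial factor with the inverse of the total surface
measure, which is the normalization in `sphereUniform`. -/
theorem lintegral_stdGaussian_direction {d : ℕ} (hd : d ≠ 0)
    {f : EuclideanSpace ℝ (Fin d) → ℝ≥0∞} (hf : Measurable f) :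
    ∫⁻ g, f (‖g‖⁻¹ • g) ∂(stdGaussian (EuclideanSpace ℝ (Fin d))) =
      ∫⁻ v, f v ∂(sphereUniform d) := by
  have : Nonempty (Fin d) := ⟨⟨0, Nat.pos_of_ne_zero hd⟩⟩
  set E := EuclideanSpace ℝ (Fin d)
  set ρ : ℝ → ℝ≥0∞ := fun r => ENNReal.ofReal ((2 * Real.pi) ^ (-(d : ℝ) / 2) *
    Real.exp (-(1 / 2) * r ^ 2)) with hρ
  have hρm : Measurable ρ := by fun_prop
  have key : ∀ {f : E → ℝ≥0∞}, Measurable f → ∫⁻ g, f (‖g‖⁻¹ • g) ∂(stdGaussian E) =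
      (∫⁻ v : sphere (0 : E) 1, f v ∂(volume : Measure E).toSphere) *
        ∫⁻ r, ρ r.1 ∂(Measure.volumeIoiPow (Module.finrank ℝ E - 1)) := by
    intro f hf
    rw [stdGaussian_eq_withDensity, lintegral_withDensity_eq_lintegral_mul _ (by fun_prop)
      (by fun_prop)]
    rw [← lintegral_prod_mul (by fun_prop) (by fun_prop)]
    rw [← (Measure.measurePreserving_homeomorphUnitSphereProd (volume : Measure E)).lintegral_comp
      (by fun_prop)]
    have h0 : (volume : Measure E) = volume.restrict ({0}ᶜ : Set E) := by
      symm
      apply Measure.restrict_eq_self_of_ae_mem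
      simp [ae_iff]
    conv_lhs => rw [h0]
    rw [← lintegral_subtype_comap (measurableSet_singleton _).compl]
    refine lintegral_congr fun x => ?_
    simp [homeomorphUnitSphereProd_apply_fst_coe, hρ, mul_comm]
  have h1 := key (f := fun _ => 1) measurable_const
  simp only [lintegral_const, measure_univ, one_mul, mul_one] at h1
  rw [key hf, sphereUniform, lintegral_smul_measure, smul_eq_mul, mul_comm]
  congr 1
  refine ENNReal.eq_inv_of_mul_eq_one_left ?_
  rw [mul_comm]; exact h1.symm

theorem isProbabilityMeasure_sphereUniform {d : ℕ} (hd : d ≠ 0) :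
    IsProbabilityMeasure (sphereUniform d) := by
  constructor
  have h := lintegral_stdGaussian_direction hd (f := fun _ => 1) measurable_const
  simpa using h.symm

theorem lintegral_sphereUniform_isometry {d : ℕ} (hd : d ≠ 0)
    (T : EuclideanSpace ℝ (Fin d) ≃ₗᵢ[ℝ] EuclideanSpace ℝ (Fin d))
    {f : EuclideanSpace ℝ (Fin d) → ℝ≥0∞} (hf : Measurable f) :
    ∫⁻ v, f (T v) ∂(sphereUniform d) = ∫⁻ v, f v ∂(sphereUniform d) := by
  rw [← lintegral_stdGaussian_direction hd hf,
    ← lintegral_stdGaussian_direction hd (f := fun v => f (T v)) (by fun_prop)]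
  conv_rhs => rw [← stdGaussian_map T]
  rw [lintegral_map (by fun_prop) (by fun_prop)]
  simp

theorem exists_isometry_apply_eq {d : ℕ} {u v : EuclideanSpace ℝ (Fin d)} (h : ‖u‖ = ‖v‖) :
    ∃ T : EuclideanSpace ℝ (Fin d) ≃ₗᵢ[ℝ] EuclideanSpace ℝ (Fin d), T u = v :=
  ⟨(ℝ ∙ (u - v))ᗮ.reflection, Submodule.reflection_sub h⟩

/-- The distribution of `⟪x, u⟫` for uniform `x` depends only on `‖u‖`. -/
theorem lintegral_sphereUniform_inner_congr {d : ℕ} (hd : d ≠ 0)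
    {u v : EuclideanSpace ℝ (Fin d)} (h : ‖u‖ = ‖v‖) {f : ℝ → ℝ≥0∞} (hf : Measurable f) :
    ∫⁻ x : sphere (0 : EuclideanSpace ℝ (Fin d)) 1,
        f ⟪(x : EuclideanSpace ℝ (Fin d)), u⟫ ∂(sphereUniform d) =
      ∫⁻ x : sphere (0 : EuclideanSpace ℝ (Fin d)) 1,
        f ⟪(x : EuclideanSpace ℝ (Fin d)), v⟫ ∂(sphereUniform d) := by
  obtain ⟨T, rfl⟩ := exists_isometry_apply_eq h
  rw [← lintegral_sphereUniform_isometry hd T (f := fun x => f ⟪x, T u⟫) (by fun_prop)]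
  simp

theorem stdGaussian_map_inner {d : ℕ} (u : EuclideanSpace ℝ (Fin d)) :
    (stdGaussian (EuclideanSpace ℝ (Fin d))).map (fun g => ⟪u, g⟫) =
      gaussianReal 0 (‖u‖₊ ^ 2) := by
  have h := IsGaussian.map_eq_gaussianReal (μ := stdGaussian (EuclideanSpace ℝ (Fin d)))
    (innerSL ℝ u)
  rw [integral_strongDual_stdGaussian, variance_dual_stdGaussian] at h
  simp only [innerSL_apply_norm] at h
  have e : ‖u‖₊ ^ 2 = (‖u‖ ^ 2).toNNReal := NNReal.eq (by simp)
  rw [e]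
  exact h

/-- The weight merges with the density into an unnormalized Gaussian of variance `(1 - 2l)⁻¹` in
each coordinate. -/
theorem lintegral_exp_mul_sq_norm_stdGaussian {d : ℕ} {l : ℝ} (hl : l < 1 / 2) :
    ∫⁻ g, ENNReal.ofReal (Real.exp (l * ‖g‖ ^ 2)) ∂(stdGaussian (EuclideanSpace ℝ (Fin d))) =
      ENNReal.ofReal ((1 - 2 * l) ^ (-(d : ℝ) / 2)) := by
  have hπ : (0 : ℝ) < 2 * Real.pi := by positivity
  have hb : 0 < 1 / 2 - l := by linarith
  rw [stdGaussian_eq_withDensity, lintegral_withDensity_eq_lintegral_mul _ (by fun_prop)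
      (by fun_prop)]
  have h1 : ∀ x : EuclideanSpace ℝ (Fin d),
      ENNReal.ofReal ((2 * Real.pi) ^ (-(d : ℝ) / 2) *
        Real.exp (-(1 / 2) * ‖x‖ ^ 2)) * ENNReal.ofReal (Real.exp (l * ‖x‖ ^ 2)) =
      ENNReal.ofReal ((2 * Real.pi) ^ (-(d : ℝ) / 2)) *
        ENNReal.ofReal (Real.exp (-(1 / 2 - l) * ‖x‖ ^ 2)) := by
    intro x
    rw [ENNReal.ofReal_mul (by positivity), mul_assoc, ← ENNReal.ofReal_mul (by positivity),
      ← Real.exp_add]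
    congr 4
    ring
  simp_rw [Pi.mul_apply, h1]
  have hval := GaussianFourier.integral_rexp_neg_mul_sq_norm (V := EuclideanSpace ℝ (Fin d)) hb
  have hne : ∫ v : EuclideanSpace ℝ (Fin d), Real.exp (-(1 / 2 - l) * ‖v‖ ^ 2) ≠ 0 := by
    rw [hval]; positivity
  have hint : Integrable fun v : EuclideanSpace ℝ (Fin d) => Real.exp (-(1 / 2 - l) * ‖v‖ ^ 2) := by
    by_contra hc; exact hne (integral_undef hc)
  rw [lintegral_const_mul _ (by fun_prop), ← ofReal_integral_eq_lintegral_ofReal hint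
    (Filter.Eventually.of_forall fun x => by positivity), hval, ← ENNReal.ofReal_mul (by positivity),
    finrank_euclideanSpace_fin]
  congr 1
  have : Real.pi / (1 / 2 - l) = (2 * Real.pi) * (1 - 2 * l)⁻¹ := by field_simp
  rw [this, Real.mul_rpow hπ.le (by rw [inv_nonneg]; linarith), ← mul_assoc, ← Real.rpow_add hπ,
    Real.inv_rpow (by linarith), neg_div, Real.rpow_neg (by linarith)]
  simp

/-- First-order Taylor expansion of `log (1 - 2l)` with remainder at most `8 l²`, which turns the
moment generating function of `‖g‖²` into a sub-Gaussian form. -/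
theorem rpow_neg_half_le_exp {l : ℝ} (hl : |l| ≤ 1 / 4) (d : ℕ) :
    (1 - 2 * l) ^ (-(d : ℝ) / 2) ≤ Real.exp (d * (l + 4 * l ^ 2)) := by
  have hl' := abs_le.1 hl
  have h := Real.abs_log_sub_add_sum_range_le (x := 2 * l) (by
    rw [abs_mul, abs_of_pos (by norm_num : (0 : ℝ) < 2)]; linarith) 1
  simp only [Finset.sum_range_one, zero_add, pow_one, Nat.cast_zero, div_one] at h
  have h2 : |2 * l| ^ (1 + 1) / (1 - |2 * l|) ≤ 8 * l ^ 2 := by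
    rw [abs_mul, abs_of_pos (by norm_num : (0 : ℝ) < 2), div_le_iff₀ (by linarith)]
    have := sq_abs l
    have h0 : 0 ≤ l ^ 2 * (1 / 4 - |l|) := mul_nonneg (sq_nonneg l) (by linarith)
    have : (2 * |l|) ^ (1 + 1) = 4 * l ^ 2 := by rw [← sq_abs l]; ring
    rw [this]
    linarith
  rw [Real.rpow_def_of_pos (by linarith)]
  apply Real.exp_le_exp.2
  have h3 := (abs_le.1 (h.trans h2)).1
  have hd : (0 : ℝ) ≤ d := Nat.cast_nonneg d
  nlinarith

theorem stdGaussian_sq_norm_tail {d : ℕ} {y : ℝ} (hy0 : 0 ≤ y) (hyd : y ≤ d) :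
    stdGaussian (EuclideanSpace ℝ (Fin d)) {g | y < |‖g‖ ^ 2 - d|} ≤
      ENNReal.ofReal (2 * Real.exp (-y ^ 2 / (16 * d))) := by
  rcases hy0.eq_or_lt with rfl | hy
  · refine prob_le_one.trans ?_
    simp
  have hd : (0 : ℝ) < d := hy.trans_le hyd
  have tail : ∀ l : ℝ, |l| ≤ 1 / 4 → stdGaussian (EuclideanSpace ℝ (Fin d))
      {g | |l| * y ≤ l * (‖g‖ ^ 2 - d)} ≤ ENNReal.ofReal (Real.exp (-|l| * y + 4 * l ^ 2 * d)) := by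
    intro l hl
    have h1 := mul_meas_ge_le_lintegral₀ (μ := stdGaussian (EuclideanSpace ℝ (Fin d)))
      (f := fun g => ENNReal.ofReal (Real.exp (l * ‖g‖ ^ 2))) (by fun_prop)
      (ENNReal.ofReal (Real.exp (|l| * y + l * d)))
    rw [lintegral_exp_mul_sq_norm_stdGaussian (by linarith [(abs_le.1 hl).2])] at h1
    have h2 : {g : EuclideanSpace ℝ (Fin d) | |l| * y ≤ l * (‖g‖ ^ 2 - d)} =
        {g | ENNReal.ofReal (Real.exp (|l| * y + l * d)) ≤
          ENNReal.ofReal (Real.exp (l * ‖g‖ ^ 2))} := by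
      ext g
      simp only [Set.mem_ofPred_eq]
      rw [ENNReal.ofReal_le_ofReal_iff (by positivity), Real.exp_le_exp]
      constructor <;> intro h <;> linarith
    rw [h2]
    have h3 := h1.trans (ENNReal.ofReal_le_ofReal (rpow_neg_half_le_exp hl d))
    have h4 : ENNReal.ofReal (Real.exp (d * (l + 4 * l ^ 2))) =
        ENNReal.ofReal (Real.exp (|l| * y + l * d)) *
          ENNReal.ofReal (Real.exp (-|l| * y + 4 * l ^ 2 * d)) := by
      rw [← ENNReal.ofReal_mul (by positivity), ← Real.exp_add]
      congr 2; ring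
    rw [h4] at h3
    exact (ENNReal.mul_le_mul_iff_right (by simp [Real.exp_pos]) ENNReal.ofReal_ne_top).1 h3
  -- The Chernoff exponent `-l y + 4 l² d` is minimized at `l = y / (8d)`; the hypothesis `y ≤ d`
  -- keeps this `l` within the range of the expansion.
  have hl0 : 0 < y / (8 * d) := by positivity
  have hl1 : y / (8 * d) ≤ 1 / 4 := by rw [div_le_iff₀ (by positivity)]; linarith
  have e1 : -(y / (8 * d)) * y + 4 * (y / (8 * d)) ^ 2 * d = -y ^ 2 / (16 * d) := by
    field_simp; ring
  have t1 := tail (y / (8 * d)) (by rw [abs_of_pos hl0]; exact hl1)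
  have t2 := tail (-(y / (8 * d))) (by rw [abs_neg, abs_of_pos hl0]; exact hl1)
  rw [abs_of_pos hl0, e1] at t1
  rw [abs_neg, abs_of_pos hl0, neg_sq, e1] at t2
  calc _ ≤ stdGaussian (EuclideanSpace ℝ (Fin d))
        ({g | y / (8 * d) * y ≤ y / (8 * d) * (‖g‖ ^ 2 - d)} ∪
          {g | y / (8 * d) * y ≤ -(y / (8 * d)) * (‖g‖ ^ 2 - d)}) := by
        refine measure_mono fun g hg => ?_
        rcases lt_abs.1 (show y < |‖g‖ ^ 2 - d| from hg) with h | h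
        · left; exact mul_le_mul_of_nonneg_left h.le hl0.le
        · right
          simp only [Set.mem_ofPred_eq]
          nlinarith
    _ ≤ _ := (measure_union_le _ _).trans (add_le_add t1 t2)
    _ = _ := by
        rw [← ENNReal.ofReal_add (by positivity) (by positivity)]
        congr 1; ring

/-- Factoring `‖g‖² - d = (‖g‖ - √d)(‖g‖ + √d)` shows that a norm deviation of `s` forces a
squared-norm deviation of `s √d`. -/
theorem stdGaussian_norm_tail {d : ℕ} {s : ℝ} (hs0 : 0 ≤ s) (hsd : s ≤ √d) :
    stdGaussian (EuclideanSpace ℝ (Fin d)) {g | s < |‖g‖ - √d|} ≤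
      ENNReal.ofReal (2 * Real.exp (-s ^ 2 / 16)) := by
  rcases Nat.eq_zero_or_pos d with rfl | hd
  · have : s = 0 := le_antisymm (by simpa using hsd) hs0
    subst this
    exact prob_le_one.trans (by simp)
  have hd' : (0 : ℝ) < d := by exact_mod_cast hd
  have hsq : √(d : ℝ) ^ 2 = d := Real.sq_sqrt hd'.le
  have hpos : 0 < √(d : ℝ) := Real.sqrt_pos.2 hd'
  have h := stdGaussian_sq_norm_tail (d := d) (y := s * √d) (by positivity) (by nlinarith)
  have e : -(s * √d) ^ 2 / (16 * d) = -s ^ 2 / 16 := by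
    rw [mul_pow, hsq]; field_simp
  rw [e] at h
  refine (measure_mono fun g hg => ?_).trans h
  simp only [Set.mem_ofPred_eq] at hg ⊢
  have : ‖g‖ ^ 2 - d = (‖g‖ - √d) * (‖g‖ + √d) := by nlinarith
  rw [this, abs_mul, abs_of_nonneg (by positivity : 0 ≤ ‖g‖ + √d)]
  nlinarith [norm_nonneg g, abs_nonneg (‖g‖ - √d)]

theorem lintegral_exp_mul_gaussianReal (v : NNReal) (q : ℝ) :
    ∫⁻ y, ENNReal.ofReal (Real.exp (q * y)) ∂(gaussianReal 0 v) =
      ENNReal.ofReal (Real.exp (v * q ^ 2 / 2)) := by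
  rw [← ofReal_integral_eq_lintegral_ofReal (integrable_exp_mul_gaussianReal q)
    (Filter.Eventually.of_forall fun x => by positivity)]
  have h := congrFun (mgf_id_gaussianReal (μ := 0) (v := v)) q
  simp only [mgf, id] at h
  rw [h]; simp

theorem lintegral_exp_inner_stdGaussian {d : ℕ} (u : EuclideanSpace ℝ (Fin d)) :
    ∫⁻ g, ENNReal.ofReal (Real.exp ⟪u, g⟫) ∂(stdGaussian (EuclideanSpace ℝ (Fin d))) =
      ENNReal.ofReal (Real.exp (‖u‖ ^ 2 / 2)) := by
  have h := lintegral_exp_mul_gaussianReal (‖u‖₊ ^ 2) 1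
  rw [← stdGaussian_map_inner, lintegral_map (by fun_prop) (by fun_prop)] at h
  simpa using h

end GaussianSphere

/-! ### Exponential moments on the sphere and the entropy inequality. -/

section SphereMgf

open ProbabilityTheory Metric
open scoped ENNReal RealInnerProductSpace

theorem lintegral_cosh_mul_gaussianReal (v : NNReal) (q : ℝ) :
    ∫⁻ y, ENNReal.ofReal (Real.cosh (q * y)) ∂(gaussianReal 0 v) =
      ENNReal.ofReal (Real.exp (v * q ^ 2 / 2)) := by
  have h : ∀ y : ℝ, ENNReal.ofReal (Real.cosh (q * y)) = ENNReal.ofReal (1 / 2) *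
      (ENNReal.ofReal (Real.exp (q * y)) + ENNReal.ofReal (Real.exp (-q * y))) := by
    intro y
    rw [← ENNReal.ofReal_add (by positivity) (by positivity), ← ENNReal.ofReal_mul (by norm_num),
      Real.cosh_eq]
    congr 1; ring_nf
  simp_rw [h]
  rw [lintegral_const_mul _ (by fun_prop), lintegral_add_left (by fun_prop),
    lintegral_exp_mul_gaussianReal, lintegral_exp_mul_gaussianReal,
    ← ENNReal.ofReal_add (by positivity) (by positivity), ← ENNReal.ofReal_mul (by norm_num)]
  congr 1; ring_nf

theorem half_le_stdGaussian_norm {d : ℕ} (hd : 100 ≤ d) :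
    ENNReal.ofReal (1 / 2) ≤ stdGaussian (EuclideanSpace ℝ (Fin d)) {g | √d / 2 ≤ ‖g‖} := by
  have hd' : (100 : ℝ) ≤ d := by exact_mod_cast hd
  have h := stdGaussian_norm_tail (d := d) (s := √d / 2) (by positivity)
    (by linarith [Real.sqrt_nonneg (d : ℝ)])
  have hsq : √(d : ℝ) ^ 2 = d := Real.sq_sqrt (by linarith)
  -- This amounts to `d ≥ 64 log 4`, which `d ≥ 100` guarantees.
  have h1 : 2 * Real.exp (-(√d / 2) ^ 2 / 16) ≤ 1 / 2 := by
    have : -(√(d : ℝ) / 2) ^ 2 / 16 ≤ -(100 / 64) := by rw [div_pow, hsq]; linarith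
    have h2 := Real.exp_le_exp.2 this
    have h3 : Real.exp (-(100 / 64)) ≤ 1 / 4 := by
      rw [Real.exp_neg]
      have h10 : (4 : ℝ) ≤ Real.exp (100 / 64) := by
        have := Real.exp_one_gt_d9
        have h11 : Real.exp 1 * Real.exp (36 / 64) = Real.exp (100 / 64) := by
          rw [← Real.exp_add]; norm_num
        have := Real.add_one_le_exp (36 / 64 : ℝ)
        rw [← h11]
        nlinarith
      rw [inv_le_comm₀ (by positivity) (by norm_num)]
      linarith
    linarith
  have hc : {g : EuclideanSpace ℝ (Fin d) | √d / 2 ≤ ‖g‖}ᶜ ⊆ {g | √d / 2 < |‖g‖ - √d|} := by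
    intro g hg
    simp only [Set.mem_compl_iff, Set.mem_ofPred_eq, not_le] at hg ⊢
    rw [lt_abs]; right; linarith
  have hm : MeasurableSet {g : EuclideanSpace ℝ (Fin d) | √d / 2 ≤ ‖g‖} :=
    measurableSet_le measurable_const measurable_norm
  have h2 := (measure_mono hc).trans (h.trans (ENNReal.ofReal_le_ofReal h1))
  rw [prob_compl_eq_one_sub hm, tsub_le_iff_left] at h2
  have h3 : (1 : ℝ≥0∞) = ENNReal.ofReal (1 / 2) + ENNReal.ofReal (1 / 2) := by
    rw [← ENNReal.ofReal_add] <;> norm_num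
  rw [h3] at h2
  exact (ENNReal.add_le_add_iff_right ENNReal.ofReal_ne_top).1 h2

/-- By rotation invariance the left side is an increasing function of `‖u‖` alone. Replace `u` by a
random vector `l g` with `g` Gaussian: the average is an explicit Gaussian integral, and with
probability at least `1/2` the norm of `l g` is at least `‖u‖`. This event costs the factor `2`. -/
theorem lintegral_cosh_inner_sphereUniform_le {d : ℕ} (hd : 100 ≤ d)
    (u : EuclideanSpace ℝ (Fin d)) :
    ∫⁻ x : sphere (0 : EuclideanSpace ℝ (Fin d)) 1,
        ENNReal.ofReal (Real.cosh ⟪(x : EuclideanSpace ℝ (Fin d)), u⟫) ∂(sphereUniform d) ≤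
      ENNReal.ofReal (2 * Real.exp (2 * ‖u‖ ^ 2 / d)) := by
  have hd0 : d ≠ 0 := by omega
  have hd' : (100 : ℝ) ≤ d := by exact_mod_cast hd
  have := isProbabilityMeasure_sphereUniform hd0
  have hsq : √(d : ℝ) ^ 2 = d := Real.sq_sqrt (by linarith)
  have hsp : 0 < √(d : ℝ) := Real.sqrt_pos.2 (by linarith)
  set l : ℝ := 2 * ‖u‖ / √d with hl
  have hl0 : 0 ≤ l := by positivity
  set Φ : EuclideanSpace ℝ (Fin d) → ℝ≥0∞ := fun w =>
    ∫⁻ x : sphere (0 : EuclideanSpace ℝ (Fin d)) 1,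
      ENNReal.ofReal (Real.cosh ⟪(x : EuclideanSpace ℝ (Fin d)), w⟫) ∂(sphereUniform d) with hΦ
  have hmono : ∀ w : EuclideanSpace ℝ (Fin d), ‖u‖ ≤ ‖w‖ → Φ u ≤ Φ w := by
    intro w hw
    have h0 : ∃ c : ℝ, 0 ≤ c ∧ c ≤ 1 ∧ c * ‖w‖ = ‖u‖ := by
      rcases (norm_nonneg w).eq_or_lt with h | h
      · exact ⟨0, le_rfl, zero_le_one, by rw [← h] at hw ⊢; linarith [norm_nonneg u]⟩
      · exact ⟨‖u‖ / ‖w‖, by positivity, (div_le_one h).2 hw, by field_simp⟩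
    obtain ⟨c, hc0, hc1, hc⟩ := h0
    have h1 := lintegral_sphereUniform_inner_congr hd0 (u := u) (v := c • w)
      (by rw [norm_smul, Real.norm_of_nonneg hc0, hc])
      (f := fun y => ENNReal.ofReal (Real.cosh y)) (by fun_prop)
    simp only [hΦ]
    rw [h1]
    refine lintegral_mono fun x => ENNReal.ofReal_le_ofReal (Real.cosh_le_cosh.2 ?_)
    rw [inner_smul_right, abs_mul, abs_of_nonneg hc0]
    exact mul_le_of_le_one_left (abs_nonneg _) hc1
  have hF : ∫⁻ w, Φ (l • w) ∂(stdGaussian (EuclideanSpace ℝ (Fin d))) =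
      ENNReal.ofReal (Real.exp (2 * ‖u‖ ^ 2 / d)) := by
    simp only [hΦ]
    rw [lintegral_lintegral_swap (by fun_prop)]
    have : ∀ x : sphere (0 : EuclideanSpace ℝ (Fin d)) 1,
        ∫⁻ w, ENNReal.ofReal (Real.cosh ⟪(x : EuclideanSpace ℝ (Fin d)), l • w⟫)
          ∂(stdGaussian (EuclideanSpace ℝ (Fin d))) =
            ENNReal.ofReal (Real.exp (2 * ‖u‖ ^ 2 / d)) := by
      intro x
      have h := lintegral_cosh_mul_gaussianReal (‖(x : EuclideanSpace ℝ (Fin d))‖₊ ^ 2) l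
      rw [← stdGaussian_map_inner, lintegral_map (by fun_prop) (by fun_prop)] at h
      simp_rw [inner_smul_right]
      rw [h]
      have hx : ‖(x : EuclideanSpace ℝ (Fin d))‖ = 1 := by simp
      congr 2
      simp only [NNReal.coe_pow, coe_nnnorm, hx, hl]
      rw [div_pow, hsq]; ring
    simp_rw [this]
    simp
  have hlow : Φ u * ENNReal.ofReal (1 / 2) ≤ ENNReal.ofReal (Real.exp (2 * ‖u‖ ^ 2 / d)) := by
    rw [← hF]
    calc Φ u * ENNReal.ofReal (1 / 2)
        ≤ Φ u * stdGaussian (EuclideanSpace ℝ (Fin d)) {g | √d / 2 ≤ ‖g‖} := by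
          gcongr; exact half_le_stdGaussian_norm hd
      _ = ∫⁻ w in {g | √d / 2 ≤ ‖g‖}, Φ u ∂(stdGaussian (EuclideanSpace ℝ (Fin d))) := by
          rw [setLIntegral_const]
      _ ≤ ∫⁻ w in {g | √d / 2 ≤ ‖g‖}, Φ (l • w) ∂(stdGaussian (EuclideanSpace ℝ (Fin d))) := by
          refine setLIntegral_mono' (measurableSet_le measurable_const measurable_norm) ?_
          intro w hw
          apply hmono
          rw [norm_smul, Real.norm_of_nonneg hl0, hl]
          have hw' : √d / 2 ≤ ‖w‖ := hw
          calc ‖u‖ = 2 * ‖u‖ / √d * (√d / 2) := by field_simp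
            _ ≤ _ := by gcongr
      _ ≤ _ := setLIntegral_le_lintegral _ _
  calc Φ u = Φ u * ENNReal.ofReal (1 / 2) * ENNReal.ofReal 2 := by
        rw [mul_assoc, ← ENNReal.ofReal_mul (by norm_num)]; norm_num
    _ ≤ ENNReal.ofReal (Real.exp (2 * ‖u‖ ^ 2 / d)) * ENNReal.ofReal 2 := by gcongr
    _ = _ := by rw [← ENNReal.ofReal_mul (by positivity), mul_comm]

theorem sphereUniform_inner_tail {d : ℕ} (hd : 100 ≤ d) {u : EuclideanSpace ℝ (Fin d)}
    (hu : ‖u‖ = 1) {s : ℝ} (hs : 0 ≤ s) :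
    sphereUniform d {x | s ≤ ⟪(x : EuclideanSpace ℝ (Fin d)), u⟫} ≤
      ENNReal.ofReal (4 * Real.exp (-(d * s ^ 2) / 8)) := by
  have hd' : (100 : ℝ) ≤ d := by exact_mod_cast hd
  -- Minimizer of the Chernoff exponent `2 l² / d - l s`.
  set l : ℝ := d * s / 4 with hl
  have hl0 : 0 ≤ l := by positivity
  have h1 := mul_meas_ge_le_lintegral₀ (μ := sphereUniform d)
    (f := fun x : sphere (0 : EuclideanSpace ℝ (Fin d)) 1 =>
      ENNReal.ofReal (Real.cosh ⟪(x : EuclideanSpace ℝ (Fin d)), l • u⟫)) (by fun_prop)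
      (ENNReal.ofReal (Real.exp (l * s) / 2))
  have h2 := h1.trans (lintegral_cosh_inner_sphereUniform_le hd (l • u))
  have h3 : ENNReal.ofReal (2 * Real.exp (2 * ‖l • u‖ ^ 2 / d)) =
      ENNReal.ofReal (Real.exp (l * s) / 2) *
        ENNReal.ofReal (4 * Real.exp (-(d * s ^ 2) / 8)) := by
    rw [← ENNReal.ofReal_mul (by positivity)]
    congr 1
    have : Real.exp (2 * ‖l • u‖ ^ 2 / d) = Real.exp (l * s) * Real.exp (-(d * s ^ 2) / 8) := by
      rw [← Real.exp_add, norm_smul, hu, Real.norm_of_nonneg hl0, hl]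
      congr 1; field_simp; ring
    rw [this]; ring
  rw [h3] at h2
  refine le_trans (measure_mono fun x hx => ?_)
    ((ENNReal.mul_le_mul_iff_right (by simp [Real.exp_pos]) ENNReal.ofReal_ne_top).1 h2)
  simp only [Set.mem_ofPred_eq] at hx ⊢
  apply ENNReal.ofReal_le_ofReal
  rw [inner_smul_right, Real.cosh_eq]
  have h4 : Real.exp (l * s) ≤ Real.exp (l * ⟪(x : EuclideanSpace ℝ (Fin d)), u⟫) := by gcongr
  have h5 := Real.exp_pos (-(l * ⟪(x : EuclideanSpace ℝ (Fin d)), u⟫))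
  linarith

/-- Young's inequality for the pair entropy and exponential, with the nonpositive terms `h log h`
and `-h` discarded. It trades an exponential moment of `z` for a bound on the `h`-weighted mean of
`z`. -/
theorem mul_le_mul_log_add_exp {h z k : ℝ} (h0 : 0 ≤ h) (h1 : h ≤ 1) (hk : 0 < k) :
    h * z ≤ h * Real.log (1 / k) + k * Real.exp z := by
  rcases h0.eq_or_lt with rfl | h0
  · simp; positivity
  have h2 := Real.add_one_le_exp (z + Real.log (k / h))
  have h3 : h * Real.exp (z + Real.log (k / h)) = k * Real.exp z := by
    rw [Real.exp_add, Real.exp_log (by positivity)]; field_simp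
  have h4 : Real.log (k / h) = -Real.log (1 / k) - Real.log h := by
    rw [Real.log_div hk.ne' h0.ne', one_div, Real.log_inv]; ring
  have h5 : Real.log h ≤ 0 := Real.log_nonpos h0.le h1
  rw [← h3]
  have h6 := mul_le_mul_of_nonneg_left h2 h0.le
  rw [h4] at h6 ⊢
  nlinarith [mul_nonneg h0.le (neg_nonneg.2 h5)]

/-- Weighted first-moment bound for a probability measure `ν` on the sphere whose density with
respect to the uniform measure is at most `exp m`. -/
theorem integral_mul_abs_inner_le {d : ℕ} (hd : 100 ≤ d) {m η : ℝ} (hm : 0 ≤ m) (hη : 0 < η)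
    (hη1 : η ≤ 1) {ν : Measure (sphere (0 : EuclideanSpace ℝ (Fin d)) 1)} [IsProbabilityMeasure ν]
    (hν : ν ≤ ENNReal.ofReal (Real.exp m) • sphereUniform d)
    {h : sphere (0 : EuclideanSpace ℝ (Fin d)) 1 → ℝ} (hh : Measurable h) (h0 : ∀ x, 0 ≤ h x)
    (h1 : ∀ x, h x ≤ 1) (u : EuclideanSpace ℝ (Fin d)) :
    ∫ x, h x * |⟪(x : EuclideanSpace ℝ (Fin d)), u⟫| ∂ν ≤
      (∫ x, h x ∂ν + η) * ‖u‖ * √(8 * (m + Real.log (4 / η)) / d) := by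
  have hd' : (100 : ℝ) ≤ d := by exact_mod_cast hd
  have hx1 : ∀ x : sphere (0 : EuclideanSpace ℝ (Fin d)) 1,
      ‖(x : EuclideanSpace ℝ (Fin d))‖ = 1 := fun x => by simp
  set M := m + Real.log (4 / η) with hM
  have hlog : 0 < Real.log (4 / η) := Real.log_pos (by rw [lt_div_iff₀ hη]; linarith)
  have hM0 : 0 < M := by linarith
  have bdd : ∀ {f : sphere (0 : EuclideanSpace ℝ (Fin d)) 1 → ℝ} (C : ℝ), Measurable f →
      (∀ x, |f x| ≤ C) → Integrable f ν := fun C hf hC =>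
    Integrable.of_bound hf.aestronglyMeasurable C (Filter.Eventually.of_forall hC)
  have hin : ∀ (x : sphere (0 : EuclideanSpace ℝ (Fin d)) 1) (w : EuclideanSpace ℝ (Fin d)),
      |⟪(x : EuclideanSpace ℝ (Fin d)), w⟫| ≤ ‖w‖ := by
    intro x w
    have := abs_real_inner_le_norm (x : EuclideanSpace ℝ (Fin d)) w
    rwa [hx1, one_mul] at this
  have hint : Integrable h ν := bdd 1 hh fun x => by rw [abs_of_nonneg (h0 x)]; exact h1 x
  have hA0 : 0 ≤ ∫ x, h x ∂ν := integral_nonneg h0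
  have hexp : ∀ w : EuclideanSpace ℝ (Fin d),
      ∫ x, Real.exp |⟪(x : EuclideanSpace ℝ (Fin d)), w⟫| ∂ν ≤
        Real.exp m * (4 * Real.exp (2 * ‖w‖ ^ 2 / d)) := by
    intro w
    rw [integral_eq_lintegral_of_nonneg_ae (Filter.Eventually.of_forall fun x => by positivity)
      (by fun_prop)]
    refine ENNReal.toReal_le_of_le_ofReal (by positivity) ?_
    calc ∫⁻ x, ENNReal.ofReal (Real.exp |⟪(x : EuclideanSpace ℝ (Fin d)), w⟫|) ∂ν
        ≤ ∫⁻ x, ENNReal.ofReal (Real.exp |⟪(x : EuclideanSpace ℝ (Fin d)), w⟫|)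
            ∂(ENNReal.ofReal (Real.exp m) • sphereUniform d) := lintegral_mono' hν le_rfl
      _ = ENNReal.ofReal (Real.exp m) *
          ∫⁻ x, ENNReal.ofReal (Real.exp |⟪(x : EuclideanSpace ℝ (Fin d)), w⟫|)
            ∂(sphereUniform d) := by rw [lintegral_smul_measure, smul_eq_mul]
      _ ≤ ENNReal.ofReal (Real.exp m) *
          ∫⁻ x, ENNReal.ofReal 2 * ENNReal.ofReal
            (Real.cosh ⟪(x : EuclideanSpace ℝ (Fin d)), w⟫) ∂(sphereUniform d) := by
          gcongr with x
          rw [← ENNReal.ofReal_mul (by norm_num)]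
          apply ENNReal.ofReal_le_ofReal
          rw [← Real.cosh_abs, Real.cosh_eq]
          have := Real.exp_pos (-|⟪(x : EuclideanSpace ℝ (Fin d)), w⟫|)
          linarith
      _ ≤ ENNReal.ofReal (Real.exp m) *
          (ENNReal.ofReal 2 * ENNReal.ofReal (2 * Real.exp (2 * ‖w‖ ^ 2 / d))) := by
          rw [lintegral_const_mul _ (by fun_prop)]
          gcongr
          exact lintegral_cosh_inner_sphereUniform_le hd w
      _ = _ := by
          rw [← ENNReal.ofReal_mul (by positivity), ← ENNReal.ofReal_mul (by positivity)]
          congr 1; ring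
  rcases (norm_nonneg u).eq_or_lt with hu | hu
  · have hu0 : u = 0 := norm_eq_zero.1 hu.symm
    simp [hu0]
  -- The scale balances both sides of the entropy inequality: it makes the spherical exponential
  -- moment at `l • u` equal to `exp M`.
  set l : ℝ := √(M * d / 2) / ‖u‖ with hl
  have hl0 : 0 < l := by positivity
  have hlu : ‖l • u‖ = √(M * d / 2) := by
    rw [norm_smul, Real.norm_of_nonneg hl0.le, hl]; field_simp
  have hw := hexp (l • u)
  have e1 : 2 * ‖l • u‖ ^ 2 / d = M := by
    rw [hlu, Real.sq_sqrt (by positivity)]; field_simp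
  rw [e1] at hw
  -- Chosen so that the exponential term contributes at most `η` in total, while `log (1 / k)` is
  -- only `2 * M`.
  set k : ℝ := η / (Real.exp m * (4 * Real.exp M)) with hk
  have hk0 : 0 < k := by positivity
  have hlogk : Real.log (1 / k) = 2 * M := by
    have : 1 / k = Real.exp m * ((4 / η) * Real.exp M) := by rw [hk]; field_simp
    rw [this, Real.log_mul (by positivity) (by positivity), Real.log_mul (by positivity)
      (by positivity), Real.log_exp, Real.log_exp]
    ring
  have hY : ∀ x, l * (h x * |⟪(x : EuclideanSpace ℝ (Fin d)), u⟫|) ≤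
      h x * (2 * M) + k * Real.exp |⟪(x : EuclideanSpace ℝ (Fin d)), l • u⟫| := by
    intro x
    have := mul_le_mul_log_add_exp (z := |⟪(x : EuclideanSpace ℝ (Fin d)), l • u⟫|)
      (h0 x) (h1 x) hk0
    rw [hlogk] at this
    refine le_trans (le_of_eq ?_) this
    rw [inner_smul_right, abs_mul, abs_of_pos hl0]; ring
  have hI := integral_mono (μ := ν) (Integrable.const_mul (bdd ‖u‖ (by fun_prop) fun x => by
      rw [abs_mul, abs_of_nonneg (h0 x), abs_abs]
      calc _ ≤ 1 * ‖u‖ := mul_le_mul (h1 x) (hin x u) (abs_nonneg _) zero_le_one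
        _ = _ := one_mul _) l)
    ((hint.mul_const (2 * M)).add (Integrable.const_mul (bdd (Real.exp ‖l • u‖) (by fun_prop)
      fun x => by rw [abs_of_pos (Real.exp_pos _)]; exact Real.exp_le_exp.2 (hin x _)) k)) hY
  simp only [Pi.add_apply] at hI
  rw [integral_const_mul, integral_add (hint.mul_const _) (Integrable.const_mul (bdd
    (Real.exp ‖l • u‖) (by fun_prop) fun x => by
      rw [abs_of_pos (Real.exp_pos _)]; exact Real.exp_le_exp.2 (hin x _)) k),
    integral_mul_const, integral_const_mul] at hI
  have hkw : k * ∫ x, Real.exp |⟪(x : EuclideanSpace ℝ (Fin d)), l • u⟫| ∂ν ≤ η := by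
    calc _ ≤ k * (Real.exp m * (4 * Real.exp M)) := by gcongr
      _ = η := by rw [hk]; field_simp
  have hM1 : 1 ≤ 2 * M := by
    have : Real.log 4 ≤ Real.log (4 / η) := Real.log_le_log (by norm_num) (by
      rw [le_div_iff₀ hη]; linarith)
    have h4 : Real.log 4 = 2 * Real.log 2 := by
      rw [show (4 : ℝ) = 2 ^ 2 by norm_num, Real.log_pow]; norm_num
    have := Real.log_two_gt_d9
    linarith
  have hfin : l * ∫ x, h x * |⟪(x : EuclideanSpace ℝ (Fin d)), u⟫| ∂ν ≤
      (∫ x, h x ∂ν + η) * (2 * M) := by nlinarith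
  have hB : √(8 * M / d) * √(M * d / 2) = 2 * M := by
    rw [← Real.sqrt_mul (by positivity)]
    have : 8 * M / d * (M * d / 2) = (2 * M) ^ 2 := by field_simp; ring
    rw [this, Real.sqrt_sq (by positivity)]
  have : l * ((∫ x, h x ∂ν + η) * ‖u‖ * √(8 * M / d)) = (∫ x, h x ∂ν + η) * (2 * M) := by
    rw [hl, ← hB]; field_simp
  rw [← this] at hfin
  exact le_of_mul_le_mul_left hfin hl0

end SphereMgf

/-! ### The Maurey–Pisier inequality and moments of Gaussian increments. -/

section MaureyPisier

open ProbabilityTheory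
open scoped ENNReal RealInnerProductSpace

variable {d : ℕ}

/-- The Maurey–Pisier inequality for the standard Gaussian measure. -/
theorem lintegral_convex_sub_le {F : EuclideanSpace ℝ (Fin d) → ℝ}
    {F' : EuclideanSpace ℝ (Fin d) → EuclideanSpace ℝ (Fin d)}
    (hF : ∀ x, HasFDerivAt F (innerSL ℝ (F' x)) x) (hF' : Continuous F')
    {Φ : ℝ → ℝ} (hΦ : ConvexOn ℝ Set.univ Φ) (hΦc : Continuous Φ) (hΦ0 : ∀ y, 0 ≤ Φ y) :
    ∫⁻ z, ENNReal.ofReal (Φ (F z.2 - F z.1))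
        ∂((stdGaussian (EuclideanSpace ℝ (Fin d))).prod
          (stdGaussian (EuclideanSpace ℝ (Fin d)))) ≤
      ∫⁻ z, ENNReal.ofReal (Φ (Real.pi / 2 * ⟪F' z.1, z.2⟫))
        ∂((stdGaussian (EuclideanSpace ℝ (Fin d))).prod
          (stdGaussian (EuclideanSpace ℝ (Fin d)))) := by
  set γ := (stdGaussian (EuclideanSpace ℝ (Fin d))).prod (stdGaussian (EuclideanSpace ℝ (Fin d)))
    with hγ
  have hπ := Real.pi_pos
  have hFc : Continuous F := continuous_iff_continuousAt.2 fun x => (hF x).continuousAt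
  set P : Measure ℝ := ENNReal.ofReal (2 / Real.pi) • volume.restrict (Set.Ioc 0 (Real.pi / 2))
    with hP
  have hPp : IsProbabilityMeasure P := by
    constructor
    rw [hP, Measure.smul_apply, Measure.restrict_apply_univ, Real.volume_Ioc, smul_eq_mul,
      ← ENNReal.ofReal_mul (by positivity)]
    have : 2 / Real.pi * (Real.pi / 2 - 0) = 1 := by field_simp; ring
    rw [this, ENNReal.ofReal_one]
  set D : ℝ → EuclideanSpace ℝ (Fin d) × EuclideanSpace ℝ (Fin d) → ℝ := fun θ z =>
    ⟪F' (ContinuousLinearMap.rotation θ z).1, (ContinuousLinearMap.rotation θ z).2⟫ with hD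
  have hDc : Continuous fun q : ℝ × (EuclideanSpace ℝ (Fin d) × EuclideanSpace ℝ (Fin d)) =>
      D q.1 q.2 := by
    simp only [hD, ContinuousLinearMap.rotation_apply]
    fun_prop
  have hint : ∀ {f : ℝ → ℝ}, Continuous f → Integrable f P := fun hf => by
    refine Integrable.smul_measure ?_ ENNReal.ofReal_ne_top
    exact (hf.integrableOn_Icc (a := 0) (b := Real.pi / 2)).mono_set Set.Ioc_subset_Icc_self
  -- The two points are joined by the arc `cos θ • z.1 + sin θ • z.2`, whose velocity is the second
  -- component of the rotated pair. Along this path the increment is an average over a uniform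
  -- angle, to which Jensen applies.
  have hpath : ∀ z, F z.2 - F z.1 = ∫ θ, Real.pi / 2 * D θ z ∂P := by
    intro z
    have hder : ∀ θ ∈ Set.uIcc 0 (Real.pi / 2),
        HasDerivAt (fun θ : ℝ => F (ContinuousLinearMap.rotation θ z).1) (D θ z) θ := by
      intro θ _
      have h1 : HasDerivAt (fun θ : ℝ => (ContinuousLinearMap.rotation θ z).1)
          ((ContinuousLinearMap.rotation θ z).2) θ := by
        simp only [ContinuousLinearMap.rotation_apply]
        exact ((Real.hasDerivAt_cos θ).smul_const z.1).add ((Real.hasDerivAt_sin θ).smul_const z.2)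
      exact (hF _).comp_hasDerivAt θ h1
    have h2 := intervalIntegral.integral_eq_sub_of_hasDerivAt hder
      (Continuous.intervalIntegrable (by fun_prop) _ _)
    have h3 : ∫ θ, Real.pi / 2 * D θ z ∂P = ∫ θ in (0 : ℝ)..(Real.pi / 2), D θ z := by
      rw [hP, integral_smul_measure, integral_const_mul,
        intervalIntegral.integral_of_le (by positivity), ENNReal.toReal_ofReal (by positivity),
        smul_eq_mul, ← mul_assoc]
      have : 2 / Real.pi * (Real.pi / 2) = 1 := by field_simp
      rw [this, one_mul]
    rw [h3, h2]
    simp [ContinuousLinearMap.rotation_apply]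
  -- A point on the arc and its velocity are again independent standard Gaussians, so the angle
  -- drops out.
  have hrot : ∀ θ, ∫⁻ z, ENNReal.ofReal (Φ (Real.pi / 2 * D θ z)) ∂γ =
      ∫⁻ z, ENNReal.ofReal (Φ (Real.pi / 2 * ⟪F' z.1, z.2⟫)) ∂γ := by
    intro θ
    have h := IsGaussian.map_rotation_eq_self_of_forall_strongDual_eq_zero
      (μ := stdGaussian (EuclideanSpace ℝ (Fin d))) integral_strongDual_stdGaussian θ
    rw [← hγ] at h
    conv_rhs => rw [← h]
    rw [lintegral_map (by fun_prop) (by fun_prop)]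
  calc ∫⁻ z, ENNReal.ofReal (Φ (F z.2 - F z.1)) ∂γ
      ≤ ∫⁻ z, ∫⁻ θ, ENNReal.ofReal (Φ (Real.pi / 2 * D θ z)) ∂P ∂γ := by
        refine lintegral_mono fun z => ?_
        have hc : Continuous fun θ => Φ (Real.pi / 2 * D θ z) := by fun_prop
        rw [hpath z, ← ofReal_integral_eq_lintegral_ofReal (hint hc)
          (Filter.Eventually.of_forall fun θ => hΦ0 _)]
        apply ENNReal.ofReal_le_ofReal
        exact hΦ.map_integral_le hΦc.continuousOn isClosed_univ
          (Filter.Eventually.of_forall fun _ => Set.mem_univ _) (hint (by fun_prop)) (hint hc)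
    _ = ∫⁻ θ, ∫⁻ z, ENNReal.ofReal (Φ (Real.pi / 2 * D θ z)) ∂γ ∂P := by
        rw [lintegral_lintegral_swap]
        have : Continuous fun q : (EuclideanSpace ℝ (Fin d) × EuclideanSpace ℝ (Fin d)) × ℝ =>
          ENNReal.ofReal (Φ (Real.pi / 2 * D q.2 q.1)) :=
          ENNReal.continuous_ofReal.comp (by fun_prop)
        exact this.measurable.aemeasurable
    _ = _ := by simp_rw [hrot]; simp

/-- Given the first copy, the inner product in the Maurey–Pisier bound is a centred Gaussian of
variance at most `(π L / 2)²`. -/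
theorem lintegral_exp_sub_le {F : EuclideanSpace ℝ (Fin d) → ℝ}
    {F' : EuclideanSpace ℝ (Fin d) → EuclideanSpace ℝ (Fin d)}
    (hF : ∀ x, HasFDerivAt F (innerSL ℝ (F' x)) x) (hF' : Continuous F') {L : ℝ}
    (hL : ∀ x, ‖F' x‖ ≤ L) :
    ∫⁻ z, ENNReal.ofReal (Real.exp (F z.2 - F z.1))
        ∂((stdGaussian (EuclideanSpace ℝ (Fin d))).prod
          (stdGaussian (EuclideanSpace ℝ (Fin d)))) ≤
      ENNReal.ofReal (Real.exp (Real.pi ^ 2 * L ^ 2 / 8)) := by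
  refine (lintegral_convex_sub_le hF hF' convexOn_exp Real.continuous_exp
    fun y => (Real.exp_pos y).le).trans ?_
  rw [lintegral_prod _ (by fun_prop)]
  calc _ ≤ ∫⁻ _ : EuclideanSpace ℝ (Fin d), ENNReal.ofReal (Real.exp (Real.pi ^ 2 * L ^ 2 / 8))
        ∂(stdGaussian (EuclideanSpace ℝ (Fin d))) := by
        refine lintegral_mono fun x => ?_
        have h := lintegral_exp_inner_stdGaussian ((Real.pi / 2) • F' x)
        simp_rw [inner_smul_left] at h
        simp only [conj_trivial] at h
        rw [h]
        apply ENNReal.ofReal_le_ofReal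
        apply Real.exp_le_exp.2
        rw [norm_smul, mul_pow, Real.norm_of_nonneg (by positivity)]
        have := pow_le_pow_left₀ (norm_nonneg _) (hL x) 2
        nlinarith [Real.pi_pos, sq_nonneg Real.pi]
    _ = _ := by simp

theorem even_pow_le_factorial_mul_exp (r : ℕ) (y : ℝ) :
    y ^ (2 * r) ≤ ((2 * r).factorial : ℝ) * (Real.exp y + Real.exp (-y)) := by
  have h := Real.pow_div_factorial_le_exp |y| (abs_nonneg y) (2 * r)
  rw [div_le_iff₀ (by positivity), (even_two_mul r).pow_abs] at h
  have h2 : Real.exp |y| ≤ Real.exp y + Real.exp (-y) := by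
    rcases abs_cases y with ⟨h, _⟩ | ⟨h, _⟩ <;> rw [h] <;>
      linarith [Real.exp_pos y, Real.exp_pos (-y)]
  nlinarith [Nat.cast_nonneg (α := ℝ) (2 * r).factorial]

theorem lintegral_inner_pow_le {r : ℕ} (hr : r ≠ 0) (v : EuclideanSpace ℝ (Fin d)) :
    ∫⁻ g, ENNReal.ofReal (⟪v, g⟫ ^ (2 * r)) ∂(stdGaussian (EuclideanSpace ℝ (Fin d))) ≤
      ENNReal.ofReal (2 * (2 * Real.exp 1 * r) ^ r * ‖v‖ ^ (2 * r)) := by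
  rcases eq_or_ne v 0 with rfl | hv
  · simp [hr]
  have hr0 : (0 : ℝ) < r := by exact_mod_cast Nat.pos_of_ne_zero hr
  have hv0 : 0 < ‖v‖ := norm_pos_iff.2 hv
  -- With this scale the exponential moment is `exp r` and the factorial, bounded by `(2r)^(2r)`, is
  -- half absorbed, leaving growth of order `r ^ r`.
  set s : ℝ := √(2 * r) / ‖v‖ with hs
  have hs0 : 0 < s := by positivity
  have hsq : √(2 * (r : ℝ)) ^ 2 = 2 * r := Real.sq_sqrt (by positivity)
  have hpt : ∀ g : EuclideanSpace ℝ (Fin d), ENNReal.ofReal (⟪v, g⟫ ^ (2 * r)) ≤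
      ENNReal.ofReal ((2 * r).factorial * s⁻¹ ^ (2 * r)) *
        (ENNReal.ofReal (Real.exp ⟪s • v, g⟫) + ENNReal.ofReal (Real.exp ⟪-(s • v), g⟫)) := by
    intro g
    rw [← ENNReal.ofReal_add (by positivity) (by positivity), ← ENNReal.ofReal_mul (by positivity)]
    apply ENNReal.ofReal_le_ofReal
    have h := even_pow_le_factorial_mul_exp r (s * ⟪v, g⟫)
    rw [inner_neg_left, inner_smul_left]
    simp only [conj_trivial]
    rw [mul_pow] at h
    calc ⟪v, g⟫ ^ (2 * r) = s⁻¹ ^ (2 * r) * (s ^ (2 * r) * ⟪v, g⟫ ^ (2 * r)) := by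
          rw [← mul_assoc, ← mul_pow, inv_mul_cancel₀ hs0.ne', one_pow, one_mul]
      _ ≤ s⁻¹ ^ (2 * r) * _ := mul_le_mul_of_nonneg_left h (by positivity)
      _ = _ := by ring
  refine (lintegral_mono hpt).trans ?_
  rw [lintegral_const_mul _ (by fun_prop), lintegral_add_left (by fun_prop),
    lintegral_exp_inner_stdGaussian, lintegral_exp_inner_stdGaussian, norm_neg,
    ← ENNReal.ofReal_add (by positivity) (by positivity), ← ENNReal.ofReal_mul (by positivity)]
  apply ENNReal.ofReal_le_ofReal
  have e1 : ‖s • v‖ ^ 2 / 2 = r := by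
    rw [norm_smul, Real.norm_of_nonneg hs0.le, hs, div_mul_cancel₀ _ hv0.ne', hsq]; ring
  rw [e1]
  have e2 : s⁻¹ ^ (2 * r) = ‖v‖ ^ (2 * r) / (2 * r) ^ r := by
    rw [hs, inv_div, div_pow, pow_mul (√(2 * (r : ℝ))), hsq]
  have e3 : Real.exp (r : ℝ) = Real.exp 1 ^ r := by rw [← Real.exp_nat_mul]; simp
  have e4 : ((2 * r).factorial : ℝ) ≤ (2 * r) ^ r * (2 * r) ^ r := by
    rw [← pow_add, ← two_mul]
    exact_mod_cast Nat.factorial_le_pow (2 * r)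
  rw [e2, e3]
  calc _ ≤ (2 * r) ^ r * (2 * r) ^ r * (‖v‖ ^ (2 * r) / (2 * r) ^ r) *
        (Real.exp 1 ^ r + Real.exp 1 ^ r) := by gcongr
    _ = _ := by
        simp only [mul_pow]
        field_simp; ring

/-- Moments of the increments of `F` are controlled by moments of its gradient. -/
theorem lintegral_sub_pow_le {F : EuclideanSpace ℝ (Fin d) → ℝ}
    {F' : EuclideanSpace ℝ (Fin d) → EuclideanSpace ℝ (Fin d)}
    (hF : ∀ x, HasFDerivAt F (innerSL ℝ (F' x)) x) (hF' : Continuous F') {r : ℕ} (hr : r ≠ 0) :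
    ∫⁻ z, ENNReal.ofReal ((F z.2 - F z.1) ^ (2 * r))
        ∂((stdGaussian (EuclideanSpace ℝ (Fin d))).prod
          (stdGaussian (EuclideanSpace ℝ (Fin d)))) ≤
      ENNReal.ofReal (2 * (Real.pi ^ 2 / 2 * Real.exp 1 * r) ^ r) *
        ∫⁻ x, ENNReal.ofReal (‖F' x‖ ^ (2 * r)) ∂(stdGaussian (EuclideanSpace ℝ (Fin d))) := by
  refine (lintegral_convex_sub_le hF hF' (even_two_mul r).convexOn_pow (by fun_prop)
    fun y => (even_two_mul r).pow_nonneg y).trans ?_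
  rw [lintegral_prod _ (by fun_prop), ← lintegral_const_mul _ (by fun_prop)]
  refine lintegral_mono fun x => ?_
  have h := lintegral_inner_pow_le hr ((Real.pi / 2) • F' x)
  simp_rw [inner_smul_left] at h
  simp only [conj_trivial] at h
  refine h.trans (le_of_eq ?_)
  rw [← ENNReal.ofReal_mul (by positivity), norm_smul, Real.norm_of_nonneg (by positivity)]
  congr 1
  rw [mul_pow (Real.pi / 2), pow_mul (Real.pi / 2)]
  have : (Real.pi ^ 2 / 2 * Real.exp 1 * r) ^ r =
      (2 * Real.exp 1 * r) ^ r * ((Real.pi / 2) ^ 2) ^ r := by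
    rw [← mul_pow]; congr 1; ring
  rw [this]; ring

end MaureyPisier

/-! ### Averages of ridge functions: gradient bounds and reverse-Jensen moments. -/

section RidgeAverages

open ProbabilityTheory Metric
open scoped ENNReal RealInnerProductSpace

variable {d : ℕ} {ν : Measure (sphere (0 : EuclideanSpace ℝ (Fin d)) 1)}

/-- The average of the ridge functions `g ↦ φ ⟪x, g⟫` over directions `x` distributed as `ν`. -/
noncomputable def ridgeAverage (ν : Measure (sphere (0 : EuclideanSpace ℝ (Fin d)) 1))
    (φ : ℝ → ℝ) (g : EuclideanSpace ℝ (Fin d)) : ℝ :=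
  ∫ x, φ ⟪(x : EuclideanSpace ℝ (Fin d)), g⟫ ∂ν

/-- The gradient of `ridgeAverage ν φ` when `φ'` is the derivative of `φ`. -/
noncomputable def ridgeGradient (ν : Measure (sphere (0 : EuclideanSpace ℝ (Fin d)) 1))
    (φ' : ℝ → ℝ) (g : EuclideanSpace ℝ (Fin d)) : EuclideanSpace ℝ (Fin d) :=
  ∫ x, φ' ⟪(x : EuclideanSpace ℝ (Fin d)), g⟫ • (x : EuclideanSpace ℝ (Fin d)) ∂ν

variable [IsProbabilityMeasure ν]

theorem integrable_ridge {φ : ℝ → ℝ} (hφ : Measurable φ) {C : ℝ} (hC : ∀ s, |φ s| ≤ C)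
    (g : EuclideanSpace ℝ (Fin d)) :
    Integrable (fun x : sphere (0 : EuclideanSpace ℝ (Fin d)) 1 =>
      φ ⟪(x : EuclideanSpace ℝ (Fin d)), g⟫) ν :=
  Integrable.of_bound (hφ.comp (by fun_prop)).aestronglyMeasurable C
    (Filter.Eventually.of_forall fun _ => hC _)

theorem integrable_ridgeGradient {φ' : ℝ → ℝ} (hφ : Continuous φ') {C : ℝ}
    (hC : ∀ s, |φ' s| ≤ C) (g : EuclideanSpace ℝ (Fin d)) :
    Integrable (fun x : sphere (0 : EuclideanSpace ℝ (Fin d)) 1 =>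
      φ' ⟪(x : EuclideanSpace ℝ (Fin d)), g⟫ • (x : EuclideanSpace ℝ (Fin d))) ν := by
  refine Integrable.of_bound (Continuous.aestronglyMeasurable (by fun_prop)) C
    (Filter.Eventually.of_forall fun x => ?_)
  rw [norm_smul]
  simpa using hC _

theorem continuous_ridgeAverage {φ : ℝ → ℝ} (hφ : Continuous φ) {C : ℝ}
    (hC : ∀ s, |φ s| ≤ C) : Continuous (ridgeAverage ν φ) :=
  continuous_of_dominated (bound := fun _ => C)
    (fun _ => Continuous.aestronglyMeasurable (by fun_prop))
    (fun _ => Filter.Eventually.of_forall fun _ => hC _) (integrable_const _)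
    (Filter.Eventually.of_forall fun _ => by fun_prop)

theorem continuous_ridgeGradient {φ' : ℝ → ℝ} (hφ : Continuous φ') {C : ℝ}
    (hC : ∀ s, |φ' s| ≤ C) : Continuous (ridgeGradient ν φ') :=
  continuous_of_dominated (bound := fun _ => C)
    (fun _ => Continuous.aestronglyMeasurable (by fun_prop))
    (fun _ => Filter.Eventually.of_forall fun x => by rw [norm_smul]; simpa using hC _)
    (integrable_const _)
    (Filter.Eventually.of_forall fun _ => by fun_prop)

theorem hasFDerivAt_ridgeAverage {φ φ' : ℝ → ℝ} (hφ : ∀ s, HasDerivAt φ (φ' s) s)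
    (hφ' : Continuous φ') {C C' : ℝ} (hC : ∀ s, |φ s| ≤ C) (hC' : ∀ s, |φ' s| ≤ C')
    (g : EuclideanSpace ℝ (Fin d)) :
    HasFDerivAt (ridgeAverage ν φ) (innerSL ℝ (ridgeGradient ν φ' g)) g := by
  have hc : Continuous φ := continuous_iff_continuousAt.2 fun s => (hφ s).continuousAt
  have h := hasFDerivAt_integral_of_dominated_of_fderiv_le (𝕜 := ℝ) (μ := ν)
    (F := fun g (x : sphere (0 : EuclideanSpace ℝ (Fin d)) 1) =>
      φ ⟪(x : EuclideanSpace ℝ (Fin d)), g⟫)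
    (F' := fun g x => innerSL ℝ (φ' ⟪(x : EuclideanSpace ℝ (Fin d)), g⟫ •
      (x : EuclideanSpace ℝ (Fin d)))) (x₀ := g) (bound := fun _ => C') (s := Set.univ)
    Filter.univ_mem
    (Filter.Eventually.of_forall fun g => Continuous.aestronglyMeasurable (by fun_prop))
    (integrable_ridge hc.measurable hC g)
    (Continuous.aestronglyMeasurable (by fun_prop))
    (Filter.Eventually.of_forall fun x g _ => by
      rw [innerSL_apply_norm, norm_smul]; simpa using hC' _)
    (integrable_const _)
    (Filter.Eventually.of_forall fun x g _ => by
      have h1 : HasFDerivAt (fun g => ⟪(x : EuclideanSpace ℝ (Fin d)), g⟫)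
          (innerSL ℝ (x : EuclideanSpace ℝ (Fin d))) g := (innerSL ℝ _).hasFDerivAt
      have h2 := (hφ _).comp_hasFDerivAt g h1
      rw [map_smul]
      exact h2)
  have e : ∫ x, innerSL ℝ (φ' ⟪(x : EuclideanSpace ℝ (Fin d)), g⟫ •
      (x : EuclideanSpace ℝ (Fin d))) ∂ν = innerSL ℝ (ridgeGradient ν φ' g) :=
    (innerSL ℝ).integral_comp_comm (integrable_ridgeGradient hφ' hC' g)
  rw [e] at h
  exact h

/-- Duality: pairing the gradient `v` with itself gives `‖v‖²` as a `ν`-average of `φ'` times `⟪x,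
v⟫`. The weighted first-moment bound applied in the direction `v` returns a factor `‖v‖`, which
cancels. The average of the dominating profile `h` stays in the bound, so a gradient concentrated on
a small part of `ν` is small. -/
theorem norm_ridgeGradient_le (hd : 100 ≤ d) {m η : ℝ} (hm : 0 ≤ m) (hη : 0 < η)
    (hη1 : η ≤ 1) (hν : ν ≤ ENNReal.ofReal (Real.exp m) • sphereUniform d)
    {φ' h : ℝ → ℝ} (hφ' : Continuous φ') {C : ℝ} (hC : 0 ≤ C) (hle : ∀ s, |φ' s| ≤ C * h s)
    (hh : Measurable h) (h0 : ∀ s, 0 ≤ h s) (h1 : ∀ s, h s ≤ 1)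
    (g : EuclideanSpace ℝ (Fin d)) :
    ‖ridgeGradient ν φ' g‖ ≤
      C * (ridgeAverage ν h g + η) * √(8 * (m + Real.log (4 / η)) / d) := by
  set v := ridgeGradient ν φ' g with hv
  have hC' : ∀ s, |φ' s| ≤ C := fun s => (hle s).trans (mul_le_of_le_one_right hC (h1 s))
  have hA : 0 ≤ ridgeAverage ν h g := integral_nonneg fun _ => h0 _
  have key : ‖v‖ * ‖v‖ ≤ ‖v‖ *
      (C * (ridgeAverage ν h g + η) * √(8 * (m + Real.log (4 / η)) / d)) := by
    have e1 : ‖v‖ * ‖v‖ = ∫ x, φ' ⟪(x : EuclideanSpace ℝ (Fin d)), g⟫ *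
        ⟪(x : EuclideanSpace ℝ (Fin d)), v⟫ ∂ν := by
      rw [← real_inner_self_eq_norm_mul_norm]
      conv_lhs => rw [show ⟪v, v⟫ = ⟪v, ridgeGradient ν φ' g⟫ from rfl, ridgeGradient]
      rw [← integral_inner (integrable_ridgeGradient hφ' hC' g)]
      refine integral_congr_ae (Filter.Eventually.of_forall fun x => ?_)
      simp only [inner_smul_right, real_inner_comm v]
    rw [e1]
    have hinner : ∀ x : sphere (0 : EuclideanSpace ℝ (Fin d)) 1,
        |⟪(x : EuclideanSpace ℝ (Fin d)), v⟫| ≤ ‖v‖ := fun x => by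
      have := abs_real_inner_le_norm (x : EuclideanSpace ℝ (Fin d)) v
      simpa using this
    have hi2 : Integrable (fun x : sphere (0 : EuclideanSpace ℝ (Fin d)) 1 =>
        C * (h ⟪(x : EuclideanSpace ℝ (Fin d)), g⟫ *
          |⟪(x : EuclideanSpace ℝ (Fin d)), v⟫|)) ν := by
      have hmeas : Measurable fun x : sphere (0 : EuclideanSpace ℝ (Fin d)) 1 =>
        h ⟪(x : EuclideanSpace ℝ (Fin d)), g⟫ * |⟪(x : EuclideanSpace ℝ (Fin d)), v⟫| :=
        (hh.comp (by fun_prop)).mul (by fun_prop)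
      refine Integrable.const_mul (Integrable.of_bound hmeas.aestronglyMeasurable ‖v‖
        (Filter.Eventually.of_forall fun x => ?_)) C
      rw [Real.norm_eq_abs, abs_mul, abs_abs, abs_of_nonneg (h0 _)]
      calc _ ≤ 1 * ‖v‖ := mul_le_mul (h1 _) (hinner x) (abs_nonneg _) zero_le_one
        _ = _ := one_mul _
    calc _ ≤ ∫ x, C * (h ⟪(x : EuclideanSpace ℝ (Fin d)), g⟫ *
          |⟪(x : EuclideanSpace ℝ (Fin d)), v⟫|) ∂ν := by
          refine integral_mono (Integrable.of_bound (C := C * ‖v‖)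
            (Continuous.aestronglyMeasurable (by fun_prop))
            (Filter.Eventually.of_forall fun x => ?_)) hi2 fun x => ?_
          · rw [Real.norm_eq_abs, abs_mul]
            exact mul_le_mul (hC' _) (hinner x) (abs_nonneg _) hC
          · refine (le_abs_self _).trans ?_
            rw [abs_mul, ← mul_assoc]
            exact mul_le_mul_of_nonneg_right (hle _) (abs_nonneg _)
      _ = C * ∫ x, h ⟪(x : EuclideanSpace ℝ (Fin d)), g⟫ *
          |⟪(x : EuclideanSpace ℝ (Fin d)), v⟫| ∂ν := integral_const_mul _ _
      _ ≤ C * ((ridgeAverage ν h g + η) * ‖v‖ * √(8 * (m + Real.log (4 / η)) / d)) := by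
          gcongr
          exact integral_mul_abs_inner_le hd hm hη hη1 hν
            (h := fun x => h ⟪(x : EuclideanSpace ℝ (Fin d)), g⟫) (hh.comp (by fun_prop))
            (fun _ => h0 _) (fun _ => h1 _) v
      _ = _ := by ring
  rcases (norm_nonneg v).eq_or_lt with hz | hz
  · rw [← hz]; positivity
  · exact le_of_mul_le_mul_left key hz

theorem ridgeAverage_mem {h : ℝ → ℝ} (hh : Measurable h) (h0 : ∀ s, 0 ≤ h s)
    (h1 : ∀ s, h s ≤ 1) (g : EuclideanSpace ℝ (Fin d)) :
    0 ≤ ridgeAverage ν h g ∧ ridgeAverage ν h g ≤ 1 := by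
  refine ⟨integral_nonneg fun _ => h0 _, ?_⟩
  have := integral_mono (μ := ν) (integrable_ridge hh (C := 1)
    (fun s => by rw [abs_of_nonneg (h0 s)]; exact h1 s) g) (integrable_const (1 : ℝ))
    (fun x => h1 _)
  simpa [ridgeAverage] using this

/-- Every unit direction sees a standard normal variable, so after Fubini the mean is the same for
all `ν`. This is why the cell does not bias the edge probability. -/
theorem integral_ridgeAverage {φ : ℝ → ℝ} (hφ : Continuous φ) {C : ℝ}
    (hC : ∀ s, |φ s| ≤ C) :
    ∫ g, ridgeAverage ν φ g ∂(stdGaussian (EuclideanSpace ℝ (Fin d))) =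
      ∫ y, φ y ∂(gaussianReal 0 1) := by
  unfold ridgeAverage
  rw [integral_integral_swap]
  · have : ∀ x : sphere (0 : EuclideanSpace ℝ (Fin d)) 1,
        ∫ g, φ ⟪(x : EuclideanSpace ℝ (Fin d)), g⟫ ∂(stdGaussian (EuclideanSpace ℝ (Fin d))) =
          ∫ y, φ y ∂(gaussianReal 0 1) := by
      intro x
      have h := stdGaussian_map_inner (x : EuclideanSpace ℝ (Fin d))
      have hx : ‖(x : EuclideanSpace ℝ (Fin d))‖₊ ^ 2 = 1 := NNReal.eq (by simp)
      rw [hx] at h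
      rw [← h, integral_map (by fun_prop) (by fun_prop)]
    simp_rw [this]
    simp
  · exact Integrable.of_bound (Continuous.aestronglyMeasurable (by fun_prop)) C
      (Filter.Eventually.of_forall fun _ => hC _)

/-- By independence the moment of the ratio is the product of the `q`-th moments of `A / Q` and `Q /
A`. Since `A` is the mean of `Q`, the first of these is at least `1`, so the second inherits the
bound `K`. -/
theorem lintegral_exp_ratio_le {Q : EuclideanSpace ℝ (Fin d) → ℝ} (hQ : Continuous Q)
    {A K η : ℝ} (hη : 0 < η) (hQη : ∀ g, η ≤ Q g) (hQ2 : ∀ g, Q g ≤ 2)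
    (hA : ∫ g, Q g ∂(stdGaussian (EuclideanSpace ℝ (Fin d))) = A) (q : ℕ)
    (h : ∫⁻ z, ENNReal.ofReal ((Q z.2 / Q z.1) ^ q)
        ∂((stdGaussian (EuclideanSpace ℝ (Fin d))).prod
          (stdGaussian (EuclideanSpace ℝ (Fin d)))) ≤ ENNReal.ofReal K) :
    ∫⁻ g, ENNReal.ofReal (Q g ^ q) ∂(stdGaussian (EuclideanSpace ℝ (Fin d))) ≤
      ENNReal.ofReal (A ^ q * K) := by
  set γ := stdGaussian (EuclideanSpace ℝ (Fin d))
  have hQpos : ∀ g, 0 < Q g := fun g => hη.trans_le (hQη g)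
  have hQi : Integrable Q γ := Integrable.of_bound hQ.aestronglyMeasurable 2
    (Filter.Eventually.of_forall fun g => by
      rw [Real.norm_of_nonneg (hQpos g).le]; exact hQ2 g)
  have hApos : 0 < A := by
    have := integral_mono (μ := γ) (integrable_const η) hQi hQη
    rw [hA] at this
    simp at this
    linarith
  have hne : ∀ g, Q g ≠ 0 := fun g => (hQpos g).ne'
  have hlow : 1 ≤ ∫⁻ g, ENNReal.ofReal ((A / Q g) ^ q) ∂γ := by
    -- Bernoulli's inequality together with `y + y⁻¹ ≥ 2`; the linear minorant has mean exactly `1`.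
    have hb : ∀ g, 1 + q * (1 - Q g / A) ≤ (A / Q g) ^ q := by
      intro g
      have hy : 0 < A / Q g := div_pos hApos (hQpos g)
      have h1 := one_add_mul_le_pow (a := A / Q g - 1) (by linarith) q
      have h2 : 1 - Q g / A ≤ A / Q g - 1 := by
        have : Q g / A = (A / Q g)⁻¹ := by rw [inv_div]
        rw [this]
        have h3 : 0 < (A / Q g)⁻¹ := inv_pos.2 hy
        have h4 : A / Q g * (A / Q g)⁻¹ = 1 := mul_inv_cancel₀ hy.ne'
        nlinarith [sq_nonneg (A / Q g - 1), sq_nonneg (A / Q g - (A / Q g)⁻¹)]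
      have h5 : (q : ℝ) * (1 - Q g / A) ≤ q * (A / Q g - 1) :=
        mul_le_mul_of_nonneg_left h2 (Nat.cast_nonneg q)
      simp only [add_sub_cancel] at h1
      linarith
    have hi : Integrable (fun g => (A / Q g) ^ q) γ := by
      refine Integrable.of_bound (Continuous.aestronglyMeasurable (by fun_prop (disch := exact hne _)))
        ((A / η) ^ q) (Filter.Eventually.of_forall fun g => ?_)
      have := hQpos g
      rw [Real.norm_of_nonneg (by positivity)]
      gcongr
      exact hQη g
    rw [← ofReal_integral_eq_lintegral_ofReal hi (Filter.Eventually.of_forall fun g => by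
      have := hQpos g; positivity), ← ENNReal.ofReal_one]
    apply ENNReal.ofReal_le_ofReal
    have hlin : Integrable (fun g => (1 + q : ℝ) - q / A * Q g) γ :=
      (integrable_const _).sub (hQi.const_mul _)
    have h2 := integral_mono (μ := γ) hlin hi fun g => by
      refine le_trans (le_of_eq ?_) (hb g)
      ring
    refine le_trans (le_of_eq ?_) h2
    rw [integral_sub (integrable_const _) (hQi.const_mul _), integral_const_mul, hA]
    simp only [integral_const, probReal_univ, smul_eq_mul]
    field_simp
    ring
  have hsplit : ∫⁻ z, ENNReal.ofReal ((Q z.2 / Q z.1) ^ q) ∂(γ.prod γ) =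
      (∫⁻ g, ENNReal.ofReal ((A / Q g) ^ q) ∂γ) *
        ∫⁻ g, ENNReal.ofReal ((Q g / A) ^ q) ∂γ := by
    rw [← lintegral_prod_mul]
    · refine lintegral_congr fun z => ?_
      have := hQpos z.1
      rw [← ENNReal.ofReal_mul (by positivity), ← mul_pow]
      congr 2
      have := hQpos z.1
      field_simp
    · exact (ENNReal.continuous_ofReal.comp
        (by fun_prop (disch := exact hne _))).measurable.aemeasurable
    · exact (ENNReal.continuous_ofReal.comp (by fun_prop)).measurable.aemeasurable
  have h3 : ∫⁻ g, ENNReal.ofReal ((Q g / A) ^ q) ∂γ ≤ ENNReal.ofReal K := by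
    calc _ = 1 * ∫⁻ g, ENNReal.ofReal ((Q g / A) ^ q) ∂γ := (one_mul _).symm
      _ ≤ (∫⁻ g, ENNReal.ofReal ((A / Q g) ^ q) ∂γ) *
          ∫⁻ g, ENNReal.ofReal ((Q g / A) ^ q) ∂γ := by gcongr
      _ ≤ _ := hsplit ▸ h
  have h4 : ∀ g, ENNReal.ofReal (Q g ^ q) =
      ENNReal.ofReal (A ^ q) * ENNReal.ofReal ((Q g / A) ^ q) := by
    intro g
    rw [← ENNReal.ofReal_mul (by positivity), ← mul_pow]
    congr 2
    field_simp
  simp_rw [h4]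
  have hm : Measurable fun g => ENNReal.ofReal ((Q g / A) ^ q) :=
    (ENNReal.continuous_ofReal.comp (by fun_prop)).measurable
  rw [lintegral_const_mul _ hm, ENNReal.ofReal_mul (by positivity)]
  gcongr

/-- Reverse-Jensen moment bound for ridge averages of a log-Lipschitz profile. -/
theorem lintegral_ridgeAverage_pow_le (hd : 100 ≤ d) {m η : ℝ} (hm : 0 ≤ m) (hη : 0 < η)
    (hη1 : η ≤ 1) (hν : ν ≤ ENNReal.ofReal (Real.exp m) • sphereUniform d)
    {χ χ' : ℝ → ℝ} (hχ : ∀ s, HasDerivAt χ (χ' s) s) (hχ' : Continuous χ') {C : ℝ} (hC : 0 ≤ C)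
    (hle : ∀ s, |χ' s| ≤ C * χ s) (h0 : ∀ s, 0 ≤ χ s) (h1 : ∀ s, χ s ≤ 1) (q : ℕ) :
    ∫⁻ g, ENNReal.ofReal ((ridgeAverage ν χ g + η) ^ q)
        ∂(stdGaussian (EuclideanSpace ℝ (Fin d))) ≤
      ENNReal.ofReal ((∫ y, χ y ∂(gaussianReal 0 1) + η) ^ q *
        Real.exp (Real.pi ^ 2 * (q * (C * √(8 * (m + Real.log (4 / η)) / d))) ^ 2 / 8)) := by
  have hχc : Continuous χ := continuous_iff_continuousAt.2 fun s => (hχ s).continuousAt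
  have hb : ∀ s, |χ s| ≤ 1 := fun s => by rw [abs_of_nonneg (h0 s)]; exact h1 s
  have hb' : ∀ s, |χ' s| ≤ C := fun s => (hle s).trans (mul_le_of_le_one_right hC (h1 s))
  have hQc : Continuous (ridgeAverage ν χ) := continuous_ridgeAverage hχc hb
  have hmem := fun g => ridgeAverage_mem (ν := ν) hχc.measurable h0 h1 g
  have hpos : ∀ g, 0 < ridgeAverage ν χ g + η := fun g => by linarith [(hmem g).1]
  set B := √(8 * (m + Real.log (4 / η)) / d) with hB
  refine lintegral_exp_ratio_le (Q := fun g => ridgeAverage ν χ g + η) (by fun_prop) hη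
    (fun g => by linarith [(hmem g).1]) (fun g => by linarith [(hmem g).2]) ?_ q ?_
  · rw [integral_add (Integrable.of_bound hQc.aestronglyMeasurable 1
      (Filter.Eventually.of_forall fun g => by
        rw [Real.norm_of_nonneg (hmem g).1]; exact (hmem g).2)) (integrable_const _),
      integral_ridgeAverage hχc hb]
    simp
  -- The hypothesis `|χ'| ≤ C χ` makes the gradient bound proportional to `ridgeAverage ν χ g + η`
  -- itself, so the logarithm of this quantity has gradient at most `C * B`. Exponential
  -- concentration of `q` times the logarithm is a moment bound on ratios.
  · have hder : ∀ g, HasFDerivAt (fun g => q * Real.log (ridgeAverage ν χ g + η))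
        (innerSL ℝ ((q * (ridgeAverage ν χ g + η)⁻¹) • ridgeGradient ν χ' g)) g := by
      intro g
      have h := (((hasFDerivAt_ridgeAverage hχ hχ' hb hb' g).add_const η).log
        (hpos g).ne').const_mul (q : ℝ)
      rw [map_smul, mul_smul]
      exact h
    have hexp := lintegral_exp_sub_le hder
      (by
        have := continuous_ridgeGradient (ν := ν) hχ' hb'
        fun_prop (disch := exact fun g => (hpos g).ne'))
      (L := q * (C * B)) (fun g => by
        rw [norm_smul, Real.norm_of_nonneg (by have := hpos g; positivity), mul_assoc]
        refine mul_le_mul_of_nonneg_left ?_ (Nat.cast_nonneg q)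
        rw [inv_mul_le_iff₀ (hpos g)]
        have := norm_ridgeGradient_le hd hm hη hη1 hν hχ' hC hle hχc.measurable h0 h1 g
        refine this.trans (le_of_eq ?_)
        ring)
    refine le_trans (lintegral_mono fun z => ENNReal.ofReal_le_ofReal (le_of_eq ?_)) hexp
    rw [← mul_sub, ← Real.log_div (hpos _).ne' (hpos _).ne', Real.exp_nat_mul,
      Real.exp_log (div_pos (hpos _) (hpos _))]

/-- Moment bound for the deviation of a smooth function from its Gaussian mean. -/
theorem lintegral_sub_integral_pow_le {F : EuclideanSpace ℝ (Fin d) → ℝ}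
    (hF : Continuous F) {C : ℝ} (hC : ∀ g, |F g| ≤ C) (r : ℕ) :
    ∫⁻ g, ENNReal.ofReal ((∫ g, F g ∂(stdGaussian (EuclideanSpace ℝ (Fin d))) - F g) ^ (2 * r))
        ∂(stdGaussian (EuclideanSpace ℝ (Fin d))) ≤
      ∫⁻ z, ENNReal.ofReal ((F z.2 - F z.1) ^ (2 * r))
        ∂((stdGaussian (EuclideanSpace ℝ (Fin d))).prod
          (stdGaussian (EuclideanSpace ℝ (Fin d)))) := by
  set γ := stdGaussian (EuclideanSpace ℝ (Fin d))
  have hmeas : Measurable fun z : EuclideanSpace ℝ (Fin d) × EuclideanSpace ℝ (Fin d) =>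
      ENNReal.ofReal ((F z.2 - F z.1) ^ (2 * r)) :=
    (ENNReal.continuous_ofReal.comp (by fun_prop)).measurable
  rw [lintegral_prod _ hmeas.aemeasurable]
  refine lintegral_mono fun g => ?_
  have hFi : Integrable F γ := Integrable.of_bound hF.aestronglyMeasurable C
    (Filter.Eventually.of_forall hC)
  have hi : Integrable (fun y => (F y - F g) ^ (2 * r)) γ := by
    refine Integrable.of_bound (Continuous.aestronglyMeasurable (by fun_prop)) ((C + C) ^ (2 * r))
      (Filter.Eventually.of_forall fun y => ?_)
    rw [norm_pow, Real.norm_eq_abs]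
    gcongr
    exact (abs_sub _ _).trans (add_le_add (hC y) (hC g))
  rw [← ofReal_integral_eq_lintegral_ofReal hi
    (Filter.Eventually.of_forall fun y => (even_two_mul r).pow_nonneg _)]
  apply ENNReal.ofReal_le_ofReal
  -- The mean is an average over an independent copy; Jensen for the even power moves that average
  -- outside.
  have e : ∫ g, F g ∂γ - F g = ∫ y, (F y - F g) ∂γ := by
    rw [integral_sub hFi (integrable_const _)]; simp
  rw [e]
  exact (even_two_mul r).convexOn_pow.map_integral_le (by fun_prop) isClosed_univ
    (Filter.Eventually.of_forall fun _ => Set.mem_univ _) (hFi.sub (integrable_const _)) hi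

end RidgeAverages

/-! ### Gaussian density estimates, the sech bump and the smooth step. -/

section GaussianProfiles

open ProbabilityTheory
open scoped ENNReal

theorem gaussianPDFReal_std (u : ℝ) :
    gaussianPDFReal 0 1 u = (√(2 * Real.pi))⁻¹ * Real.exp (-u ^ 2 / 2) := by
  simp [gaussianPDFReal]

theorem gaussianPDFReal_std_le_one (u : ℝ) : gaussianPDFReal 0 1 u ≤ 1 := by
  rw [gaussianPDFReal_std]
  have h1 : 1 ≤ √(2 * Real.pi) := Real.one_le_sqrt.2 (by linarith [Real.pi_gt_three])
  have h2 : Real.exp (-u ^ 2 / 2) ≤ 1 := Real.exp_le_one_iff.2 (by nlinarith [sq_nonneg u])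
  calc _ ≤ 1 * 1 := mul_le_mul (inv_le_one_of_one_le₀ h1) h2 (by positivity) zero_le_one
    _ = 1 := one_mul 1

/-- The exponents differ by `|u² - v²| / 2 ≤ h T`. On windows of width at most of order `1 / T` the
density is thus constant up to a bounded factor. -/
theorem gaussianPDFReal_std_le_mul {u v T h : ℝ} (hu : |u| ≤ T) (hv : |v| ≤ T)
    (huv : |u - v| ≤ h) : gaussianPDFReal 0 1 u ≤ Real.exp (h * T) * gaussianPDFReal 0 1 v := by
  rw [gaussianPDFReal_std, gaussianPDFReal_std, mul_left_comm, ← Real.exp_add]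
  gcongr
  have h1 : |(v - u) * (v + u)| ≤ h * (2 * T) := by
    rw [abs_mul, abs_sub_comm]
    exact mul_le_mul huv ((abs_add_le _ _).trans (by linarith)) (abs_nonneg _)
      ((abs_nonneg _).trans huv)
  have h2 := (abs_le.1 h1).2
  nlinarith

theorem gaussianReal_real_Icc_le {a b M : ℝ} (hab : a ≤ b)
    (hM : ∀ u ∈ Set.Icc a b, gaussianPDFReal 0 1 u ≤ M) :
    (gaussianReal 0 1).real (Set.Icc a b) ≤ (b - a) * M := by
  have hM0 : 0 ≤ M := (gaussianPDFReal_nonneg 0 1 a).trans (hM a ⟨le_rfl, hab⟩)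
  refine ENNReal.toReal_le_of_le_ofReal (mul_nonneg (by linarith) hM0) ?_
  rw [gaussianReal_apply 0 one_ne_zero]
  calc ∫⁻ x in Set.Icc a b, gaussianPDF 0 1 x ≤ ∫⁻ x in Set.Icc a b, ENNReal.ofReal M :=
        setLIntegral_mono' measurableSet_Icc fun x hx => ENNReal.ofReal_le_ofReal (hM x hx)
    _ = _ := by
        rw [setLIntegral_const, Real.volume_Icc, ← ENNReal.ofReal_mul hM0, mul_comm]

theorem le_gaussianReal_real_Ici {a b M : ℝ} (hM0 : 0 ≤ M)
    (hM : ∀ u ∈ Set.Icc a b, M ≤ gaussianPDFReal 0 1 u) :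
    (b - a) * M ≤ (gaussianReal 0 1).real (Set.Ici a) := by
  refine le_trans ?_ (measureReal_mono (s₁ := Set.Icc a b) fun x hx => hx.1)
  refine (ENNReal.ofReal_le_iff_le_toReal (measure_ne_top _ _)).1 ?_
  rw [gaussianReal_apply 0 one_ne_zero]
  calc _ = ∫⁻ x in Set.Icc a b, ENNReal.ofReal M := by
        rw [setLIntegral_const, Real.volume_Icc, ← ENNReal.ofReal_mul hM0, mul_comm]
    _ ≤ _ := setLIntegral_mono' measurableSet_Icc fun x hx => ENNReal.ofReal_le_ofReal (hM x hx)

theorem integral_exp_neg_mul_abs {b : ℝ} (hb : 0 < b) :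
    ∫ x : ℝ, Real.exp (-b * |x|) = 2 / b := by
  rw [integral_comp_abs (f := fun x => Real.exp (-b * x)), integral_exp_mul_Ioi (by linarith)]
  simp
  field_simp

theorem integrable_exp_neg_mul_abs {b : ℝ} (hb : 0 < b) :
    Integrable fun x : ℝ => Real.exp (-b * |x|) := by
  by_contra h
  have := integral_exp_neg_mul_abs hb
  rw [integral_undef h] at this
  have : 0 < 2 / b := by positivity
  linarith

/-- The hyperbolic-secant bump of width `w` centred at `c`. -/
noncomputable def sechBump (c w s : ℝ) : ℝ := (Real.cosh ((s - c) / w))⁻¹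

/-- The derivative of `sechBump`. -/
noncomputable def sechBumpDeriv (c w s : ℝ) : ℝ :=
  -(Real.sinh ((s - c) / w) * w⁻¹) / Real.cosh ((s - c) / w) ^ 2

theorem hasDerivAt_sechBump (c w s : ℝ) :
    HasDerivAt (sechBump c w) (sechBumpDeriv c w s) s := by
  have h1 : HasDerivAt (fun s : ℝ => (s - c) / w) w⁻¹ s := by
    have := ((hasDerivAt_id s).sub_const c).div_const w
    simpa using this
  exact ((Real.hasDerivAt_cosh _).comp s h1).inv (Real.cosh_pos _).ne'

theorem continuous_sechBumpDeriv (c w : ℝ) : Continuous (sechBumpDeriv c w) := by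
  unfold sechBumpDeriv
  exact Continuous.div (by fun_prop) (by fun_prop) fun s => pow_ne_zero 2 (Real.cosh_pos _).ne'

theorem sechBump_nonneg (c w s : ℝ) : 0 ≤ sechBump c w s := inv_nonneg.2 (Real.cosh_pos _).le

theorem sechBump_le_one (c w s : ℝ) : sechBump c w s ≤ 1 :=
  inv_le_one_of_one_le₀ (Real.one_le_cosh _)

/-- This is `|tanh| ≤ 1`. The bound of the derivative by the function itself is the reason for
choosing sech: a compactly supported bump cannot satisfy it, and the reverse-Jensen moment bound
depends on it. -/
theorem abs_sechBumpDeriv_le {w : ℝ} (hw : 0 < w) (c s : ℝ) :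
    |sechBumpDeriv c w s| ≤ w⁻¹ * sechBump c w s := by
  unfold sechBumpDeriv sechBump
  set y := (s - c) / w
  have hc := Real.cosh_pos y
  have hs : |Real.sinh y| ≤ Real.cosh y := by
    rw [abs_le]
    constructor <;> linarith [Real.cosh_add_sinh y, Real.cosh_sub_sinh y, Real.exp_pos y,
      Real.exp_pos (-y)]
  rw [abs_div, abs_neg, abs_mul, abs_of_pos (inv_pos.2 hw),
    abs_of_pos (show 0 < Real.cosh y ^ 2 by positivity), sq,
    div_le_iff₀ (by positivity)]
  calc |Real.sinh y| * w⁻¹ ≤ Real.cosh y * w⁻¹ := by gcongr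
    _ = _ := by field_simp

/-- The bump decays like `exp (-|s - c| / w)`, while moving from `c` to `s` raises the density by at
most the factor `exp (|c| |s - c|)`. As `|c| ≤ 1 / (2w)`, half of the decay rate survives. -/
theorem integral_sechBump_le {c w : ℝ} (hw : 0 < w) (hcw : |c| * w ≤ 1 / 2) :
    ∫ y, sechBump c w y ∂(gaussianReal 0 1) ≤ 8 * w * gaussianPDFReal 0 1 c := by
  rw [integral_gaussianReal_eq_integral_smul one_ne_zero]
  have hb : 0 < 1 / (2 * w) := by positivity
  have hi : Integrable fun s : ℝ => Real.exp (-(1 / (2 * w)) * |s - c|) :=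
    (integrable_exp_neg_mul_abs hb).comp_sub_right c
  have hpt : ∀ s : ℝ, gaussianPDFReal 0 1 s • sechBump c w s ≤
      2 * gaussianPDFReal 0 1 c * Real.exp (-(1 / (2 * w)) * |s - c|) := by
    intro s
    have h1 : sechBump c w s ≤ 2 * Real.exp (-|s - c| / w) := by
      unfold sechBump
      rw [← Real.cosh_abs, abs_div, abs_of_pos hw, neg_div, Real.exp_neg,
        inv_le_comm₀ (Real.cosh_pos _) (by positivity), mul_inv, inv_inv, Real.cosh_eq]
      linarith [Real.exp_pos (-(|s - c| / w))]
    have h2 : gaussianPDFReal 0 1 s ≤ gaussianPDFReal 0 1 c * Real.exp (|c| * |s - c|) := by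
      rw [gaussianPDFReal_std, gaussianPDFReal_std, mul_assoc, ← Real.exp_add]
      gcongr
      have := neg_abs_le (c * (s - c))
      rw [abs_mul] at this
      nlinarith [sq_nonneg (s - c)]
    have h3 : |c| ≤ 1 / (2 * w) := by rw [le_div_iff₀ (by positivity)]; linarith
    have h4 := gaussianPDFReal_nonneg 0 1 c
    rw [smul_eq_mul]
    calc _ ≤ (gaussianPDFReal 0 1 c * Real.exp (|c| * |s - c|)) *
          (2 * Real.exp (-|s - c| / w)) :=
          mul_le_mul h2 h1 (sechBump_nonneg _ _ _) (by positivity)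
      _ = 2 * gaussianPDFReal 0 1 c * Real.exp (|c| * |s - c| + -|s - c| / w) := by
          rw [Real.exp_add]; ring
      _ ≤ _ := by
          gcongr
          have : -(1 / (2 * w)) * |s - c| = 1 / (2 * w) * |s - c| + -|s - c| / w := by
            field_simp; ring
          rw [this]
          gcongr
  calc _ ≤ ∫ s : ℝ, 2 * gaussianPDFReal 0 1 c * Real.exp (-(1 / (2 * w)) * |s - c|) :=
        integral_mono_of_nonneg (Filter.Eventually.of_forall fun s =>
          mul_nonneg (gaussianPDFReal_nonneg 0 1 s) (sechBump_nonneg _ _ _)) (hi.const_mul _)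
          (Filter.Eventually.of_forall hpt)
    _ = _ := by
        rw [integral_const_mul, integral_sub_right_eq_self
          (fun s => Real.exp (-(1 / (2 * w)) * |s|)) c, integral_exp_neg_mul_abs hb]
        field_simp; ring

/-- A continuously differentiable step from `0` to `1` with derivative supported in `[-1, 1]`. -/
structure IsSmoothStep (S S' : ℝ → ℝ) : Prop where
  hasDerivAt : ∀ s, HasDerivAt S (S' s) s
  continuous_deriv : Continuous S'
  nonneg : ∀ s, 0 ≤ S s
  le_one : ∀ s, S s ≤ 1
  eq_zero : ∀ s ≤ -1, S s = 0
  eq_one : ∀ s, 1 ≤ s → S s = 1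
  abs_deriv_le_one : ∀ s, |S' s| ≤ 1
  abs_deriv_le : ∀ s, |S' s| ≤ 2 * (Real.cosh s)⁻¹

/-- The step is the primitive of the tent function `max 0 (1 - |s|)`. The tent lies below `2 sech`
because it vanishes outside `[-1, 1]` and `cosh 1 ≤ 2`. -/
theorem exists_isSmoothStep : ∃ S S' : ℝ → ℝ, IsSmoothStep S S' := by
  set f : ℝ → ℝ := fun s => max 0 (1 - |s|) with hf
  have hfc : Continuous f := by fun_prop
  have hf0 : ∀ s, 0 ≤ f s := fun s => le_max_left _ _
  have hf1 : ∀ s, f s ≤ 1 := fun s => max_le zero_le_one (by linarith [abs_nonneg s])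
  have hz : ∀ s, 1 ≤ |s| → f s = 0 := fun s hs => max_eq_left (by linarith)
  set S : ℝ → ℝ := fun s => ∫ u in (-1 : ℝ)..s, f u with hS
  have hii : ∀ a b, IntervalIntegrable f volume a b := fun a b => hfc.intervalIntegrable a b
  have hneg : ∫ u in (-1 : ℝ)..0, f u = 1 / 2 := by
    have : ∫ u in (-1 : ℝ)..0, f u = ∫ u in (-1 : ℝ)..0, (1 + u) := by
      refine intervalIntegral.integral_congr fun u hu => ?_
      rw [Set.uIcc_of_le (by norm_num)] at hu
      simp only [hf]
      rw [abs_of_nonpos hu.2, max_eq_right (by linarith [hu.1])]; ring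
    rw [this, intervalIntegral.integral_add (by simp) (by simp)]
    simp [integral_id]; norm_num
  have hposi : ∫ u in (0 : ℝ)..1, f u = 1 / 2 := by
    have : ∫ u in (0 : ℝ)..1, f u = ∫ u in (0 : ℝ)..1, (1 - u) := by
      refine intervalIntegral.integral_congr fun u hu => ?_
      rw [Set.uIcc_of_le (by norm_num)] at hu
      simp only [hf]
      rw [abs_of_nonneg hu.1, max_eq_right (by linarith [hu.2])]
    rw [this, intervalIntegral.integral_sub (by simp) (by simp)]
    simp [integral_id]; norm_num
  have hder : ∀ s, HasDerivAt S (f s) s := fun s =>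
    intervalIntegral.integral_hasDerivAt_right (hii _ _)
      (hfc.stronglyMeasurableAtFilter _ _) hfc.continuousAt
  have hmono : Monotone S := monotone_of_hasDerivAt_nonneg hder hf0
  have hzero : ∀ s ≤ -1, S s = 0 := fun s hs => by
    have : S s = ∫ u in (-1 : ℝ)..s, (0 : ℝ) := by
      refine intervalIntegral.integral_congr fun u hu => hz u ?_
      rw [Set.uIcc_of_ge hs] at hu
      rw [abs_of_nonpos (by linarith [hu.2])]; linarith [hu.2]
    rw [this]; simp
  have hone : ∀ s, 1 ≤ s → S s = 1 := fun s hs => by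
    have h1 : S s = (∫ u in (-1 : ℝ)..0, f u) + (∫ u in (0 : ℝ)..1, f u) + ∫ u in (1 : ℝ)..s, f u := by
      rw [intervalIntegral.integral_add_adjacent_intervals (hii _ _) (hii _ _),
        intervalIntegral.integral_add_adjacent_intervals (hii _ _) (hii _ _)]
    have h2 : ∫ u in (1 : ℝ)..s, f u = ∫ u in (1 : ℝ)..s, (0 : ℝ) := by
      refine intervalIntegral.integral_congr fun u hu => hz u ?_
      rw [Set.uIcc_of_le hs] at hu
      exact hu.1.trans (le_abs_self u)
    rw [h1, h2, hneg, hposi]; simp; norm_num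
  refine ⟨S, f, hder, hfc, fun s => ?_, fun s => ?_, hzero, hone, fun s => ?_, fun s => ?_⟩
  · rcases le_total s (-1) with h | h
    · exact (hzero s h).ge
    · exact (hzero (-1) le_rfl).ge.trans (hmono h)
  · rcases le_total 1 s with h | h
    · exact (hone s h).le
    · exact (hmono h).trans (hone 1 le_rfl).le
  · rw [abs_of_nonneg (hf0 s)]; exact hf1 s
  · rw [abs_of_nonneg (hf0 s)]
    rcases le_total 1 |s| with h | h
    · rw [hz s h]; positivity
    · refine (hf1 s).trans ?_
      rw [← div_eq_mul_inv, le_div_iff₀ (Real.cosh_pos s), one_mul]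
      have h1 : Real.cosh s ≤ Real.cosh 1 := Real.cosh_le_cosh.2 (by simpa using h)
      have h2 : Real.cosh 1 ≤ 2 := by
        rw [Real.cosh_eq]
        have := Real.exp_one_lt_d9
        have : Real.exp (-1) ≤ 1 := Real.exp_le_one_iff.2 (by norm_num)
        linarith
      linarith

end GaussianProfiles

/-! ### Concentration of smoothed cap averages. -/

section Concentration

open ProbabilityTheory Metric
open scoped ENNReal RealInnerProductSpace

variable {d : ℕ} {ν : Measure (sphere (0 : EuclideanSpace ℝ (Fin d)) 1)}
  [IsProbabilityMeasure ν]

theorem IsSmoothStep.hasDerivAt_comp {S S' : ℝ → ℝ} (hS : IsSmoothStep S S') (c w s : ℝ) :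
    HasDerivAt (fun s => S ((s - c) / w)) (S' ((s - c) / w) * w⁻¹) s := by
  have h1 : HasDerivAt (fun s : ℝ => (s - c) / w) w⁻¹ s := by
    have := ((hasDerivAt_id s).sub_const c).div_const w
    simpa using this
  exact (hS.hasDerivAt _).comp s h1

theorem IsSmoothStep.continuous {S S' : ℝ → ℝ} (hS : IsSmoothStep S S') : Continuous S :=
  continuous_iff_continuousAt.2 fun s => (hS.hasDerivAt s).continuousAt

theorem IsSmoothStep.abs_le_one {S S' : ℝ → ℝ} (hS : IsSmoothStep S S') (s : ℝ) : |S s| ≤ 1 := by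
  rw [abs_of_nonneg (hS.nonneg s)]; exact hS.le_one s

/-- Deviation moments of a smoothed cap average. -/
theorem lintegral_smoothStep_deviation_pow_le (hd : 100 ≤ d) {m η : ℝ} (hm : 0 ≤ m) (hη : 0 < η)
    (hη1 : η ≤ 1) (hν : ν ≤ ENNReal.ofReal (Real.exp m) • sphereUniform d)
    {S S' : ℝ → ℝ} (hS : IsSmoothStep S S') {c w : ℝ} (hw : 0 < w) (hcw : |c| * w ≤ 1 / 2)
    {r : ℕ} (hr : r ≠ 0) (hB : √(8 * (m + Real.log (4 / η)) / d) ^ 2 * r ≤ w ^ 2) :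
    ∫⁻ g, ENNReal.ofReal ((∫ y, S ((y - c) / w) ∂(gaussianReal 0 1) -
        ridgeAverage ν (fun s => S ((s - c) / w)) g) ^ (2 * r))
        ∂(stdGaussian (EuclideanSpace ℝ (Fin d))) ≤
      ENNReal.ofReal (2 * (100 * (8 * w * gaussianPDFReal 0 1 c + η)) ^ (2 * r)) := by
  set B := √(8 * (m + Real.log (4 / η)) / d) with hBdef
  have hr0 : (0 : ℝ) < r := by exact_mod_cast Nat.pos_of_ne_zero hr
  have hlog : 0 < Real.log (4 / η) := Real.log_pos (by rw [lt_div_iff₀ hη]; linarith)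
  have hB0 : 0 ≤ B := Real.sqrt_nonneg _
  have hφ0 := gaussianPDFReal_nonneg 0 1 c
  set A := 8 * w * gaussianPDFReal 0 1 c + η with hA
  have hA0 : 0 < A := by positivity
  have hder := fun s => hS.hasDerivAt_comp c w s
  have hc' : Continuous fun s => S' ((s - c) / w) * w⁻¹ := by
    have := hS.continuous_deriv
    fun_prop
  have hc : Continuous fun s => S ((s - c) / w) := by
    have := hS.continuous
    fun_prop
  have hbd : ∀ s, |S' ((s - c) / w) * w⁻¹| ≤ w⁻¹ := fun s => by
    rw [abs_mul, abs_of_pos (inv_pos.2 hw)]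
    exact mul_le_of_le_one_left (by positivity) (hS.abs_deriv_le_one _)
  have hle : ∀ s, |S' ((s - c) / w) * w⁻¹| ≤ 2 * w⁻¹ * sechBump c w s := fun s => by
    rw [abs_mul, abs_of_pos (inv_pos.2 hw)]
    have := mul_le_mul_of_nonneg_right (hS.abs_deriv_le ((s - c) / w)) (inv_pos.2 hw).le
    refine this.trans (le_of_eq ?_)
    unfold sechBump; ring
  have hmeas : Measurable (sechBump c w) :=
    (continuous_iff_continuousAt.2 fun s => (hasDerivAt_sechBump c w s).continuousAt).measurable
  -- The step's derivative is dominated by the sech bump, so the gradient moments reduce to those of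
  -- the bump average, which `hQ` controls by the Gaussian density at `c`.
  have hgrad : ∀ g, ‖ridgeGradient ν (fun s => S' ((s - c) / w) * w⁻¹) g‖ ≤
      2 * w⁻¹ * B * (ridgeAverage ν (sechBump c w) g + η) := fun g =>
    (norm_ridgeGradient_le hd hm hη hη1 hν hc' (by positivity) hle hmeas
      (sechBump_nonneg c w) (sechBump_le_one c w) g).trans (le_of_eq (by ring))
  have hQ := lintegral_ridgeAverage_pow_le (ν := ν) hd hm hη hη1 hν (hasDerivAt_sechBump c w)
    (continuous_sechBumpDeriv c w) (inv_pos.2 hw).le (abs_sechBumpDeriv_le hw c)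
    (sechBump_nonneg c w) (sechBump_le_one c w) (2 * r)
  rw [← hBdef] at hQ
  have hEQ : ∫ y, sechBump c w y ∂(gaussianReal 0 1) + η ≤ A := by
    rw [hA]; linarith [integral_sechBump_le hw hcw]
  have hEQ0 : 0 ≤ ∫ y, sechBump c w y ∂(gaussianReal 0 1) + η :=
    add_nonneg (integral_nonneg fun y => sechBump_nonneg c w y) hη.le
  have hmean := integral_ridgeAverage (ν := ν) hc (fun s => hS.abs_le_one ((s - c) / w))
  have h1 := lintegral_sub_integral_pow_le
    (continuous_ridgeAverage (ν := ν) hc (fun s => hS.abs_le_one ((s - c) / w)))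
    (C := 1) (fun g => by
      have := ridgeAverage_mem (ν := ν) hc.measurable (fun s => hS.nonneg ((s - c) / w))
        (fun s => hS.le_one ((s - c) / w)) g
      rw [abs_of_nonneg this.1]; exact this.2) r
  rw [hmean] at h1
  have h2 := lintegral_sub_pow_le (F := ridgeAverage ν (fun s => S ((s - c) / w)))
    (F' := ridgeGradient ν (fun s => S' ((s - c) / w) * w⁻¹))
    (hasFDerivAt_ridgeAverage hder hc' (fun s => hS.abs_le_one ((s - c) / w)) hbd)
    (continuous_ridgeGradient hc' hbd) hr
  have hQm : Measurable fun g => ENNReal.ofReal ((ridgeAverage ν (sechBump c w) g + η) ^ (2 * r)) := by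
    have hcs : Continuous (sechBump c w) :=
      continuous_iff_continuousAt.2 fun s => (hasDerivAt_sechBump c w s).continuousAt
    have := continuous_ridgeAverage (ν := ν) hcs (C := 1) (fun s => by
      rw [abs_of_nonneg (sechBump_nonneg c w s)]; exact sechBump_le_one c w s)
    exact (ENNReal.continuous_ofReal.comp (by fun_prop)).measurable
  refine (h1.trans h2).trans ?_
  calc _ ≤ ENNReal.ofReal (2 * (Real.pi ^ 2 / 2 * Real.exp 1 * r) ^ r) *
        (ENNReal.ofReal ((2 * w⁻¹ * B) ^ (2 * r)) *
          ENNReal.ofReal (A ^ (2 * r) * Real.exp (Real.pi ^ 2 / 2 * r))) := by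
        gcongr
        calc _ ≤ ∫⁻ g, ENNReal.ofReal ((2 * w⁻¹ * B) ^ (2 * r)) *
              ENNReal.ofReal ((ridgeAverage ν (sechBump c w) g + η) ^ (2 * r))
              ∂(stdGaussian (EuclideanSpace ℝ (Fin d))) := by
              refine lintegral_mono fun g => ?_
              rw [← ENNReal.ofReal_mul (by positivity), ← mul_pow]
              exact ENNReal.ofReal_le_ofReal (pow_le_pow_left₀ (norm_nonneg _) (hgrad g) _)
          _ = _ := lintegral_const_mul _ hQm
          _ ≤ _ := by
              gcongr
              refine hQ.trans (ENNReal.ofReal_le_ofReal ?_)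
              gcongr
              -- The hypothesis `B² r ≤ w²` enters here: it makes the exponent linear in `r`, so
              -- that the correction is a constant to the power `r`.
              have : (((2 * r : ℕ) : ℝ) * (w⁻¹ * B)) ^ 2 / 8 = r * (B ^ 2 * r / w ^ 2) / 2 := by
                push_cast; field_simp; ring
              rw [mul_div_assoc, this]
              have h3 : B ^ 2 * r / w ^ 2 ≤ 1 := by rw [div_le_one (by positivity)]; exact hB
              have : r * (B ^ 2 * r / w ^ 2) / 2 ≤ (r : ℝ) / 2 := by nlinarith
              calc _ ≤ Real.pi ^ 2 * ((r : ℝ) / 2) := by gcongr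
                _ = _ := by ring
    _ = ENNReal.ofReal (2 * (A ^ (2 * r) * (Real.pi ^ 2 / 2 * Real.exp 1 * r *
          (2 * w⁻¹ * B) ^ 2 * Real.exp (Real.pi ^ 2 / 2)) ^ r)) := by
        rw [← ENNReal.ofReal_mul (by positivity), ← ENNReal.ofReal_mul (by positivity)]
        congr 1
        have : Real.exp (Real.pi ^ 2 / 2 * r) = Real.exp (Real.pi ^ 2 / 2) ^ r := by
          rw [← Real.exp_nat_mul, mul_comm]
        rw [this, pow_mul (2 * w⁻¹ * B)]
        simp only [mul_pow]
        ring
    _ ≤ _ := by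
        apply ENNReal.ofReal_le_ofReal
        rw [mul_pow 100 A, mul_comm (A ^ (2 * r)), pow_mul (100 : ℝ)]
        gcongr
        have h3 : r * (2 * w⁻¹ * B) ^ 2 ≤ 4 := by
          have : r * (2 * w⁻¹ * B) ^ 2 = 4 * (B ^ 2 * r) / w ^ 2 := by field_simp; ring
          rw [this, div_le_iff₀ (by positivity)]; linarith
        have hπ2 : Real.pi ^ 2 ≤ 10 := by nlinarith [Real.pi_lt_d2, Real.pi_gt_three]
        have he := Real.exp_one_lt_d9
        have he5 : Real.exp (Real.pi ^ 2 / 2) ≤ 2.7182818286 ^ 5 := by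
          have : Real.exp (Real.pi ^ 2 / 2) ≤ Real.exp 1 ^ 5 := by
            rw [← Real.exp_nat_mul]; apply Real.exp_le_exp.2; norm_num; linarith
          exact this.trans (pow_le_pow_left₀ (Real.exp_pos 1).le he.le 5)
        -- The base of the `r`-th power is at most `20 e⁶`, which is below `100²`.
        calc _ = (Real.pi ^ 2 / 2) * Real.exp 1 * (r * (2 * w⁻¹ * B) ^ 2) *
              Real.exp (Real.pi ^ 2 / 2) := by ring
          _ ≤ 5 * 2.7182818286 * 4 * 2.7182818286 ^ 5 := by gcongr; linarith
          _ ≤ _ := by norm_num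

/-- Concentration of a smoothed cap average at scale `w`. -/
theorem stdGaussian_smoothStep_deviation_le (hd : 100 ≤ d) {m η : ℝ} (hm : 0 ≤ m) (hη : 0 < η)
    (hη1 : η ≤ 1) (hν : ν ≤ ENNReal.ofReal (Real.exp m) • sphereUniform d)
    {S S' : ℝ → ℝ} (hS : IsSmoothStep S S') {c w : ℝ} (hw : 0 < w) (hcw : |c| * w ≤ 1 / 2)
    {r : ℕ} (hr : r ≠ 0) (hB : √(8 * (m + Real.log (4 / η)) / d) ^ 2 * r ≤ w ^ 2) :
    stdGaussian (EuclideanSpace ℝ (Fin d)) {g | 300 * (8 * w * gaussianPDFReal 0 1 c + η) ≤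
        |∫ y, S ((y - c) / w) ∂(gaussianReal 0 1) -
          ridgeAverage ν (fun s => S ((s - c) / w)) g|} ≤
      ENNReal.ofReal (2 * Real.exp (-(2 * r))) := by
  have h := lintegral_smoothStep_deviation_pow_le hd hm hη hη1 hν hS hw hcw hr hB
  set A := 8 * w * gaussianPDFReal 0 1 c + η with hA
  have hφ0 := gaussianPDFReal_nonneg 0 1 c
  have hA0 : 0 < A := by positivity
  have hc : Continuous fun s => S ((s - c) / w) := by
    have := hS.continuous
    fun_prop
  have hRc := continuous_ridgeAverage (ν := ν) hc (fun s => hS.abs_le_one ((s - c) / w))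
  have hm2 := mul_meas_ge_le_lintegral₀ (μ := stdGaussian (EuclideanSpace ℝ (Fin d)))
    (f := fun g => ENNReal.ofReal ((∫ y, S ((y - c) / w) ∂(gaussianReal 0 1) -
        ridgeAverage ν (fun s => S ((s - c) / w)) g) ^ (2 * r)))
    (ENNReal.continuous_ofReal.comp (by fun_prop)).measurable.aemeasurable
    (ENNReal.ofReal ((300 * A) ^ (2 * r)))
  -- Markov's inequality at three times the moment scale, using `1 / 3 ≤ exp (-1)`.
  have e : ENNReal.ofReal (2 * (100 * A) ^ (2 * r)) ≤ ENNReal.ofReal ((300 * A) ^ (2 * r)) *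
      ENNReal.ofReal (2 * Real.exp (-(2 * r))) := by
    rw [← ENNReal.ofReal_mul (by positivity)]
    apply ENNReal.ofReal_le_ofReal
    have h1 : Real.exp (-(2 * (r : ℝ))) = Real.exp (-1) ^ (2 * r) := by
      rw [← Real.exp_nat_mul]; congr 1; push_cast; ring
    have h2 : (1 / 3 : ℝ) ≤ Real.exp (-1) := by
      rw [Real.exp_neg, one_div]
      exact inv_anti₀ (Real.exp_pos 1) (by linarith [Real.exp_one_lt_d9])
    rw [h1]
    calc 2 * (100 * A) ^ (2 * r) = 2 * ((300 * A) * (1 / 3)) ^ (2 * r) := by congr 2; ring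
      _ = (300 * A) ^ (2 * r) * (2 * (1 / 3) ^ (2 * r)) := by rw [mul_pow]; ring
      _ ≤ _ := by gcongr
  refine le_trans (measure_mono fun g hg => ?_)
    ((ENNReal.mul_le_mul_iff_right (by
      simp only [ne_eq, ENNReal.ofReal_eq_zero, not_le]; positivity) ENNReal.ofReal_ne_top).1
      ((hm2.trans h).trans e))
  simp only [Set.mem_ofPred_eq] at hg ⊢
  apply ENNReal.ofReal_le_ofReal
  rw [← (even_two_mul r).pow_abs (∫ y, S ((y - c) / w) ∂(gaussianReal 0 1) - _)]
  gcongr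

/-- First-moment deviation bound for a smoothed cap average. -/
theorem lintegral_abs_smoothStep_deviation_le (hd : 100 ≤ d) {m : ℝ} (hm : 0 ≤ m)
    (hν : ν ≤ ENNReal.ofReal (Real.exp m) • sphereUniform d)
    {S S' : ℝ → ℝ} (hS : IsSmoothStep S S') {w : ℝ} (hw : 0 < w) (c : ℝ) :
    ∫⁻ g, ENNReal.ofReal |∫ y, S ((y - c) / w) ∂(gaussianReal 0 1) -
        ridgeAverage ν (fun s => S ((s - c) / w)) g|
        ∂(stdGaussian (EuclideanSpace ℝ (Fin d))) ≤
      ENNReal.ofReal (11 * √(8 * (m + Real.log 4) / d) / w) := by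
  set B := √(8 * (m + Real.log 4) / d) with hBdef
  have hd' : (100 : ℝ) ≤ d := by exact_mod_cast hd
  have hB0 : 0 < B := by
    have := Real.log_pos (by norm_num : (1 : ℝ) < 4)
    positivity
  have hder := fun s => hS.hasDerivAt_comp c w s
  have hc' : Continuous fun s => S' ((s - c) / w) * w⁻¹ := by
    have := hS.continuous_deriv
    fun_prop
  have hc : Continuous fun s => S ((s - c) / w) := by
    have := hS.continuous
    fun_prop
  have hbd : ∀ s, |S' ((s - c) / w) * w⁻¹| ≤ w⁻¹ := fun s => by
    rw [abs_mul, abs_of_pos (inv_pos.2 hw)]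
    exact mul_le_of_le_one_left (by positivity) (hS.abs_deriv_le_one _)
  have hgrad : ∀ g, ‖ridgeGradient ν (fun s => S' ((s - c) / w) * w⁻¹) g‖ ≤ 2 * B / w := fun g => by
    -- Constant weight and `η = 1`: an absolute error is enough here, so no information about the
    -- mass near the boundary is kept.
    have h := norm_ridgeGradient_le (η := 1) hd hm one_pos le_rfl hν hc' (C := w⁻¹) (by positivity)
      (h := fun _ => 1) (fun s => by simpa using hbd s) measurable_const (fun _ => zero_le_one)
      (fun _ => le_rfl) g
    rw [div_one, ← hBdef] at h
    refine h.trans (le_of_eq ?_)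
    simp [ridgeAverage]
    field_simp; norm_num
  have hmean := integral_ridgeAverage (ν := ν) hc (fun s => hS.abs_le_one ((s - c) / w))
  have hRc := continuous_ridgeAverage (ν := ν) hc (fun s => hS.abs_le_one ((s - c) / w))
  have h1 := lintegral_sub_integral_pow_le hRc
    (C := 1) (fun g => by
      have := ridgeAverage_mem (ν := ν) hc.measurable (fun s => hS.nonneg ((s - c) / w))
        (fun s => hS.le_one ((s - c) / w)) g
      rw [abs_of_nonneg this.1]; exact this.2) 1
  rw [hmean] at h1
  have h2 := lintegral_sub_pow_le (F := ridgeAverage ν (fun s => S ((s - c) / w)))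
    (F' := ridgeGradient ν (fun s => S' ((s - c) / w) * w⁻¹))
    (hasFDerivAt_ridgeAverage hder hc' (fun s => hS.abs_le_one ((s - c) / w)) hbd)
    (continuous_ridgeGradient hc' hbd) one_ne_zero
  set κ := 11 * B / w with hκ
  have hκ0 : 0 < κ := by positivity
  have h3 := h1.trans h2
  simp only [mul_one, pow_one, Nat.cast_one] at h3
  have h4 : ∫⁻ g, ENNReal.ofReal ((∫ y, S ((y - c) / w) ∂(gaussianReal 0 1) -
        ridgeAverage ν (fun s => S ((s - c) / w)) g) ^ 2)
        ∂(stdGaussian (EuclideanSpace ℝ (Fin d))) ≤ ENNReal.ofReal (κ ^ 2) := by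
    refine h3.trans ?_
    calc _ ≤ ENNReal.ofReal (2 * (Real.pi ^ 2 / 2 * Real.exp 1)) *
          ∫⁻ _, ENNReal.ofReal ((2 * B / w) ^ 2) ∂(stdGaussian (EuclideanSpace ℝ (Fin d))) := by
          gcongr with g
          exact hgrad g
      _ = ENNReal.ofReal (2 * (Real.pi ^ 2 / 2 * Real.exp 1) * (2 * B / w) ^ 2) := by
          rw [lintegral_const, measure_univ, mul_one, ← ENNReal.ofReal_mul (by positivity)]
      _ ≤ _ := by
          apply ENNReal.ofReal_le_ofReal
          have hπ2 : Real.pi ^ 2 ≤ 10 := by nlinarith [Real.pi_lt_d2, Real.pi_gt_three]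
          have he := Real.exp_one_lt_d9
          have h5 : Real.pi ^ 2 * Real.exp 1 ≤ 121 / 4 :=
            (mul_le_mul hπ2 he.le (Real.exp_pos 1).le (by norm_num)).trans (by norm_num)
          have : κ ^ 2 = 121 / 4 * (2 * B / w) ^ 2 := by rw [hκ]; field_simp; norm_num
          rw [this]
          have : 2 * (Real.pi ^ 2 / 2 * Real.exp 1) = Real.pi ^ 2 * Real.exp 1 := by ring
          rw [this]
          gcongr
  -- The arithmetic–geometric mean inequality passes from the second moment to the first.
  have hpt : ∀ y : ℝ, ENNReal.ofReal |y| ≤ ENNReal.ofReal (1 / (2 * κ)) * ENNReal.ofReal (y ^ 2) +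
      ENNReal.ofReal (κ / 2) := fun y => by
    rw [← ENNReal.ofReal_mul (by positivity), ← ENNReal.ofReal_add (by positivity) (by positivity)]
    apply ENNReal.ofReal_le_ofReal
    have : 1 / (2 * κ) * y ^ 2 + κ / 2 = (y ^ 2 + κ ^ 2) / (2 * κ) := by field_simp
    rw [this, le_div_iff₀ (by positivity), ← sq_abs y]
    nlinarith [sq_nonneg (|y| - κ)]
  have hm2 : Measurable fun g => ENNReal.ofReal ((∫ y, S ((y - c) / w) ∂(gaussianReal 0 1) -
        ridgeAverage ν (fun s => S ((s - c) / w)) g) ^ 2) :=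
    (ENNReal.continuous_ofReal.comp (by fun_prop)).measurable
  refine (lintegral_mono fun g => hpt _).trans ?_
  rw [lintegral_add_right _ measurable_const, lintegral_const_mul _ hm2, lintegral_const,
    measure_univ, mul_one]
  calc _ ≤ ENNReal.ofReal (1 / (2 * κ)) * ENNReal.ofReal (κ ^ 2) + ENNReal.ofReal (κ / 2) := by
        gcongr
    _ = _ := by
        rw [← ENNReal.ofReal_mul (by positivity), ← ENNReal.ofReal_add (by positivity)
          (by positivity)]
        congr 1; field_simp; norm_num

end Concentration

/-! ### From Gaussian ridge averages to masses of spherical caps. -/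

section CapMass

open ProbabilityTheory Metric
open scoped ENNReal RealInnerProductSpace

variable {d : ℕ}

/-- The `ν`-mass of the spherical cap `{x | τ ≤ ⟪x, v⟫}`. -/
noncomputable def capMass (ν : Measure (sphere (0 : EuclideanSpace ℝ (Fin d)) 1)) (τ : ℝ)
    (v : EuclideanSpace ℝ (Fin d)) : ℝ :=
  ν.real {x | τ ≤ ⟪(x : EuclideanSpace ℝ (Fin d)), v⟫}

theorem measurable_capMass (ν : Measure (sphere (0 : EuclideanSpace ℝ (Fin d)) 1))
    [IsProbabilityMeasure ν] (τ : ℝ) : Measurable (capMass ν τ) := by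
  have hs : MeasurableSet {q : EuclideanSpace ℝ (Fin d) × sphere (0 : EuclideanSpace ℝ (Fin d)) 1 |
      τ ≤ ⟪(q.2 : EuclideanSpace ℝ (Fin d)), q.1⟫} :=
    measurableSet_le measurable_const (by fun_prop)
  exact (measurable_measure_prodMk_left (ν := ν) hs).ennreal_toReal

theorem capMass_nonneg (ν : Measure (sphere (0 : EuclideanSpace ℝ (Fin d)) 1)) (τ : ℝ)
    (v : EuclideanSpace ℝ (Fin d)) : 0 ≤ capMass ν τ v := measureReal_nonneg

theorem capMass_le_one (ν : Measure (sphere (0 : EuclideanSpace ℝ (Fin d)) 1))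
    [IsProbabilityMeasure ν] (τ : ℝ) (v : EuclideanSpace ℝ (Fin d)) : capMass ν τ v ≤ 1 :=
  measureReal_le_one

theorem sphereUniform_apply_eq (hd : d ≠ 0) {s : Set (EuclideanSpace ℝ (Fin d))}
    (hs : MeasurableSet s) :
    sphereUniform d {v | (v : EuclideanSpace ℝ (Fin d)) ∈ s} =
      stdGaussian (EuclideanSpace ℝ (Fin d)) {g | ‖g‖⁻¹ • g ∈ s} := by
  have h := lintegral_stdGaussian_direction hd (f := s.indicator 1) (measurable_one.indicator hs)
  have h1 : ∀ g : EuclideanSpace ℝ (Fin d), s.indicator (1 : EuclideanSpace ℝ (Fin d) → ℝ≥0∞) (‖g‖⁻¹ • g) =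
      {g : EuclideanSpace ℝ (Fin d) | ‖g‖⁻¹ • g ∈ s}.indicator 1 g := fun g => rfl
  have h2 : ∀ v : sphere (0 : EuclideanSpace ℝ (Fin d)) 1,
      s.indicator (1 : EuclideanSpace ℝ (Fin d) → ℝ≥0∞) (v : EuclideanSpace ℝ (Fin d)) =
      {v : sphere (0 : EuclideanSpace ℝ (Fin d)) 1 |
        (v : EuclideanSpace ℝ (Fin d)) ∈ s}.indicator 1 v := fun g => rfl
  have hm : Measurable fun g : EuclideanSpace ℝ (Fin d) => ‖g‖⁻¹ • g := by fun_prop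
  have hs1 : MeasurableSet {g : EuclideanSpace ℝ (Fin d) | ‖g‖⁻¹ • g ∈ s} := hm hs
  have hs2 : MeasurableSet {v : sphere (0 : EuclideanSpace ℝ (Fin d)) 1 |
    (v : EuclideanSpace ℝ (Fin d)) ∈ s} := measurable_subtype_coe hs
  simp_rw [h1, h2] at h
  rw [lintegral_indicator_one hs1, lintegral_indicator_one hs2] at h
  exact h.symm

theorem stdGaussian_ae_ne_zero (hd : d ≠ 0) :
    ∀ᵐ g ∂(stdGaussian (EuclideanSpace ℝ (Fin d))), g ≠ 0 := by
  have : Nonempty (Fin d) := ⟨⟨0, Nat.pos_of_ne_zero hd⟩⟩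
  rw [stdGaussian_eq_withDensity]
  refine (withDensity_absolutelyContinuous _ _).ae_le ?_
  exact compl_mem_ae_iff.2 (measure_singleton 0)

/-- `τ` cuts off caps of uniform mass `p` around every unit vector. -/
def HasCapMass (d : ℕ) (τ p : ℝ) : Prop :=
  ∀ u : EuclideanSpace ℝ (Fin d), ‖u‖ = 1 →
    sphereUniform d {x | τ ≤ ⟪(x : EuclideanSpace ℝ (Fin d)), u⟫} = ENNReal.ofReal p

/-- Multiplying by `‖g‖`, which is almost surely positive, turns a cap condition on the direction
into a half-space condition with random threshold `τ ‖g‖`. -/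
theorem HasCapMass.stdGaussian_real {τ p : ℝ} (h : HasCapMass d τ p) (hd : d ≠ 0) (hp : 0 ≤ p)
    {u : EuclideanSpace ℝ (Fin d)} (hu : ‖u‖ = 1) :
    (stdGaussian (EuclideanSpace ℝ (Fin d))).real {g | τ * ‖g‖ ≤ ⟪u, g⟫} = p := by
  have h1 := h u hu
  have hs : MeasurableSet {g : EuclideanSpace ℝ (Fin d) | τ ≤ ⟪g, u⟫} :=
    measurableSet_le measurable_const (by fun_prop)
  have h2 := sphereUniform_apply_eq hd hs
  simp only [Set.mem_ofPred_eq] at h2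
  rw [h1] at h2
  have h3 : stdGaussian (EuclideanSpace ℝ (Fin d)) {g | τ * ‖g‖ ≤ ⟪u, g⟫} =
      stdGaussian (EuclideanSpace ℝ (Fin d)) {g | τ ≤ ⟪‖g‖⁻¹ • g, u⟫} := by
    refine measure_congr ?_
    filter_upwards [stdGaussian_ae_ne_zero hd] with g hg
    have hg' : 0 < ‖g‖ := norm_pos_iff.2 hg
    apply propext
    change τ * ‖g‖ ≤ ⟪u, g⟫ ↔ τ ≤ ⟪‖g‖⁻¹ • g, u⟫
    rw [inner_smul_left, real_inner_comm]
    simp only [conj_trivial]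
    rw [le_inv_mul_iff₀ hg', mul_comm]
  rw [measureReal_def, h3, ← h2, ENNReal.toReal_ofReal hp]

/-- The set on which replacing `τ‖g‖` by `τ√d` costs more than `w`. -/
def normDeviation (d : ℕ) (τ w : ℝ) : Set (EuclideanSpace ℝ (Fin d)) :=
  {g | w < |τ| * |‖g‖ - √d|}

theorem stdGaussian_normDeviation_le {τ w T : ℝ} (hτ : |τ| * √d ≤ T) (hT : 0 < T) (hw : 0 < w)
    (hwT : w ≤ T) (hd : d ≠ 0) :
    stdGaussian (EuclideanSpace ℝ (Fin d)) (normDeviation d τ w) ≤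
      ENNReal.ofReal (2 * Real.exp (-(w ^ 2 * d / (16 * T ^ 2)))) := by
  have hd' : (0 : ℝ) < d := by exact_mod_cast Nat.pos_of_ne_zero hd
  have hsq : √(d : ℝ) ^ 2 = d := Real.sq_sqrt hd'.le
  have hsp : 0 < √(d : ℝ) := Real.sqrt_pos.2 hd'
  have h := stdGaussian_norm_tail (d := d) (s := w * √d / T) (by positivity) (by
    rw [div_le_iff₀ hT, mul_comm]; gcongr)
  have e : -(w * √d / T) ^ 2 / 16 = -(w ^ 2 * d / (16 * T ^ 2)) := by
    rw [div_pow, mul_pow, hsq]; field_simp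
  rw [e] at h
  refine (measure_mono fun g hg => ?_).trans h
  have hg' : w < |τ| * |‖g‖ - √d| := hg
  change w * √d / T < |‖g‖ - √d|
  rw [div_lt_iff₀ hT]
  calc w * √d < |τ| * |‖g‖ - √d| * √d := by gcongr
    _ = |‖g‖ - √d| * (|τ| * √d) := by ring
    _ ≤ _ := by gcongr

theorem abs_le_of_notMem_normDeviation {τ w : ℝ} {g : EuclideanSpace ℝ (Fin d)}
    (hg : g ∉ normDeviation d τ w) : |τ * ‖g‖ - τ * √d| ≤ w := by
  have : ¬ w < |τ| * |‖g‖ - √d| := hg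
  rw [← mul_sub, abs_mul]
  exact not_lt.1 this

theorem stdGaussian_real_inner_ge {u : EuclideanSpace ℝ (Fin d)} (hu : ‖u‖ = 1) (s : ℝ) :
    (stdGaussian (EuclideanSpace ℝ (Fin d))).real {g | s ≤ ⟪u, g⟫} =
      (gaussianReal 0 1).real (Set.Ici s) := by
  have h := stdGaussian_map_inner u
  have hx : ‖u‖₊ ^ 2 = 1 := NNReal.eq (by simp [hu])
  rw [hx] at h
  rw [← h, map_measureReal_apply (by fun_prop) measurableSet_Ici]
  rfl

/-- Off `normDeviation` the random threshold `τ ‖g‖` is within `w` of `τ √d`, and `⟪u, g⟫` is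
standard normal; this compares `p` with Gaussian tails. -/
theorem HasCapMass.gaussian_bounds {τ p : ℝ} (h : HasCapMass d τ p) (hd : d ≠ 0) (hp : 0 ≤ p)
    {w β : ℝ} (hβ0 : 0 ≤ β)
    (hβ : stdGaussian (EuclideanSpace ℝ (Fin d)) (normDeviation d τ w) ≤ ENNReal.ofReal β) :
    (gaussianReal 0 1).real (Set.Ici (τ * √d + w)) - β ≤ p ∧
      p ≤ (gaussianReal 0 1).real (Set.Ici (τ * √d - w)) + β := by
  obtain ⟨u, hu⟩ : ∃ u : EuclideanSpace ℝ (Fin d), ‖u‖ = 1 :=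
    ⟨EuclideanSpace.single ⟨0, Nat.pos_of_ne_zero hd⟩ 1, by simp⟩
  have hβ' : (stdGaussian (EuclideanSpace ℝ (Fin d))).real (normDeviation d τ w) ≤ β :=
    ENNReal.toReal_le_of_le_ofReal hβ0 hβ
  have hpe := h.stdGaussian_real hd hp hu
  constructor
  · rw [← stdGaussian_real_inner_ge hu]
    have : (stdGaussian (EuclideanSpace ℝ (Fin d))).real {g | τ * √d + w ≤ ⟪u, g⟫} ≤
        (stdGaussian (EuclideanSpace ℝ (Fin d))).real
          ({g | τ * ‖g‖ ≤ ⟪u, g⟫} ∪ normDeviation d τ w) := by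
      refine measureReal_mono fun g hg => ?_
      by_cases hgd : g ∈ normDeviation d τ w
      · exact Or.inr hgd
      · left
        have h1 := (abs_le.1 (abs_le_of_notMem_normDeviation hgd)).2
        have h2 : τ * √d + w ≤ ⟪u, g⟫ := hg
        change τ * ‖g‖ ≤ ⟪u, g⟫
        linarith
    linarith [measureReal_union_le (μ := stdGaussian (EuclideanSpace ℝ (Fin d)))
      {g | τ * ‖g‖ ≤ ⟪u, g⟫} (normDeviation d τ w)]
  · rw [← stdGaussian_real_inner_ge hu, ← hpe]
    have : (stdGaussian (EuclideanSpace ℝ (Fin d))).real {g | τ * ‖g‖ ≤ ⟪u, g⟫} ≤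
        (stdGaussian (EuclideanSpace ℝ (Fin d))).real
          ({g | τ * √d - w ≤ ⟪u, g⟫} ∪ normDeviation d τ w) := by
      refine measureReal_mono fun g hg => ?_
      by_cases hgd : g ∈ normDeviation d τ w
      · exact Or.inr hgd
      · left
        have h1 := (abs_le.1 (abs_le_of_notMem_normDeviation hgd)).1
        have h2 : τ * ‖g‖ ≤ ⟪u, g⟫ := hg
        change τ * √d - w ≤ ⟪u, g⟫
        linarith
    linarith [measureReal_union_le (μ := stdGaussian (EuclideanSpace ℝ (Fin d)))
      {g | τ * √d - w ≤ ⟪u, g⟫} (normDeviation d τ w)]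

variable {ν : Measure (sphere (0 : EuclideanSpace ℝ (Fin d)) 1)} [IsProbabilityMeasure ν]
  {S S' : ℝ → ℝ}

theorem IsSmoothStep.integrable_comp (hS : IsSmoothStep S S') {Ω : Type*} [MeasurableSpace Ω]
    {P : Measure Ω} [IsFiniteMeasure P] {X : Ω → ℝ} (hX : Measurable X) (c w : ℝ) :
    Integrable (fun ω => S ((X ω - c) / w)) P := by
  have := hS.continuous.measurable
  exact Integrable.of_bound (Measurable.aestronglyMeasurable (by fun_prop)) 1
    (Filter.Eventually.of_forall fun ω => hS.abs_le_one _)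

/-- A smooth step centred at `c` of width `w` lies above the indicator of `[c + w, ∞)`. -/
theorem IsSmoothStep.real_le_integral (hS : IsSmoothStep S S') {Ω : Type*} [MeasurableSpace Ω]
    {P : Measure Ω} [IsFiniteMeasure P] {X : Ω → ℝ} (hX : Measurable X) {c w s : ℝ}
    (hw : 0 < w) (hs : c + w ≤ s) :
    P.real {ω | s ≤ X ω} ≤ ∫ ω, S ((X ω - c) / w) ∂P := by
  have hm : MeasurableSet {ω | s ≤ X ω} := measurableSet_le measurable_const hX
  rw [← integral_indicator_one hm]
  refine integral_mono ((integrable_const (1 : ℝ)).indicator hm) (hS.integrable_comp hX c w) ?_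
  intro ω
  by_cases h : ω ∈ {ω | s ≤ X ω}
  · rw [Set.indicator_of_mem h]
    have h' : s ≤ X ω := h
    simp only [Pi.one_apply]
    rw [hS.eq_one _ (by rw [le_div_iff₀ hw]; linarith)]
  · rw [Set.indicator_of_notMem h]
    exact hS.nonneg _

/-- A smooth step centred at `c` of width `w` lies below the indicator of `[c - w, ∞)`. -/
theorem IsSmoothStep.integral_le_real (hS : IsSmoothStep S S') {Ω : Type*} [MeasurableSpace Ω]
    {P : Measure Ω} [IsFiniteMeasure P] {X : Ω → ℝ} (hX : Measurable X) {c w s : ℝ}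
    (hw : 0 < w) (hs : s ≤ c - w) :
    ∫ ω, S ((X ω - c) / w) ∂P ≤ P.real {ω | s ≤ X ω} := by
  have hm : MeasurableSet {ω | s ≤ X ω} := measurableSet_le measurable_const hX
  rw [← integral_indicator_one hm]
  refine integral_mono (hS.integrable_comp hX c w) ((integrable_const (1 : ℝ)).indicator hm) ?_
  intro ω
  by_cases h : ω ∈ {ω | s ≤ X ω}
  · rw [Set.indicator_of_mem h]
    exact hS.le_one _
  · rw [Set.indicator_of_notMem h]
    have h' : X ω < s := not_le.1 h
    simp only
    rw [hS.eq_zero _ (by rw [div_le_iff₀ hw]; linarith)]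

/-- Off the norm-deviation event, the cap mass is sandwiched by smoothed cap averages. -/
theorem abs_capMass_sub_le (hS : IsSmoothStep S S') {τ p : ℝ} (h : HasCapMass d τ p)
    (hd : d ≠ 0) (hp : 0 ≤ p) {w β : ℝ} (hw : 0 < w) (hβ0 : 0 ≤ β)
    (hβ : stdGaussian (EuclideanSpace ℝ (Fin d)) (normDeviation d τ w) ≤ ENNReal.ofReal β)
    {g : EuclideanSpace ℝ (Fin d)} (hg0 : g ≠ 0) (hg : g ∉ normDeviation d τ w) {κ M : ℝ}
    (h1 : |∫ y, S ((y - (τ * √d - 2 * w)) / w) ∂(gaussianReal 0 1) -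
      ridgeAverage ν (fun s => S ((s - (τ * √d - 2 * w)) / w)) g| ≤ κ)
    (h2 : |∫ y, S ((y - (τ * √d + 2 * w)) / w) ∂(gaussianReal 0 1) -
      ridgeAverage ν (fun s => S ((s - (τ * √d + 2 * w)) / w)) g| ≤ κ)
    (hM : ∀ u ∈ Set.Icc (τ * √d - 3 * w) (τ * √d + 3 * w), gaussianPDFReal 0 1 u ≤ M) :
    |capMass ν τ (‖g‖⁻¹ • g) - p| ≤ κ + 6 * w * M + β := by
  set t := τ * √d with ht
  have hg' : 0 < ‖g‖ := norm_pos_iff.2 hg0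
  have hb := h.gaussian_bounds hd hp hβ0 hβ
  have hdev := abs_le.1 (abs_le_of_notMem_normDeviation hg)
  have hcap : capMass ν τ (‖g‖⁻¹ • g) =
      ν.real {x | τ * ‖g‖ ≤ ⟪(x : EuclideanSpace ℝ (Fin d)), g⟫} := by
    unfold capMass
    congr 1
    ext x
    change τ ≤ ⟪(x : EuclideanSpace ℝ (Fin d)), ‖g‖⁻¹ • g⟫ ↔ τ * ‖g‖ ≤ _
    rw [inner_smul_right, le_inv_mul_iff₀ hg', mul_comm]
  -- The centre is shifted by `2 * w`: one `w` for the norm fluctuation and one for the half-width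
  -- of the step. Comparing the Gaussian mean of the step with a tail costs a third `w`.
  have hup : capMass ν τ (‖g‖⁻¹ • g) ≤ ridgeAverage ν (fun s => S ((s - (t - 2 * w)) / w)) g := by
    rw [hcap]
    exact hS.real_le_integral (by fun_prop) hw (by linarith [hdev.1])
  have hlo : ridgeAverage ν (fun s => S ((s - (t + 2 * w)) / w)) g ≤ capMass ν τ (‖g‖⁻¹ • g) := by
    rw [hcap]
    exact hS.integral_le_real (by fun_prop) hw (by linarith [hdev.2])
  have hup2 := hS.integral_le_real (P := gaussianReal 0 1) measurable_id (c := t - 2 * w)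
    (s := t - 3 * w) hw (by linarith)
  have hlo2 := hS.real_le_integral (P := gaussianReal 0 1) measurable_id (c := t + 2 * w)
    (s := t + 3 * w) hw (by linarith)
  have hwin := gaussianReal_real_Icc_le (a := t - 3 * w) (b := t + 3 * w) (by linarith) hM
  have hsplit : (gaussianReal 0 1).real (Set.Ici (t - 3 * w)) ≤
      (gaussianReal 0 1).real (Set.Icc (t - 3 * w) (t + 3 * w)) +
        (gaussianReal 0 1).real (Set.Ici (t + 3 * w)) := by
    refine le_trans (measureReal_mono fun x hx => ?_) (measureReal_union_le _ _)
    rcases le_total x (t + 3 * w) with hx2 | hx2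
    · exact Or.inl ⟨hx, hx2⟩
    · exact Or.inr hx2
  have m1 : (gaussianReal 0 1).real (Set.Ici (t + 3 * w)) ≤
      (gaussianReal 0 1).real (Set.Ici (t + w)) :=
    measureReal_mono (Set.Ici_subset_Ici.2 (by linarith))
  have m2 : (gaussianReal 0 1).real (Set.Ici (t - w)) ≤
      (gaussianReal 0 1).real (Set.Ici (t - 3 * w)) :=
    measureReal_mono (Set.Ici_subset_Ici.2 (by linarith))
  have e1 : (gaussianReal 0 1).real {ω | t - 3 * w ≤ id ω} =
    (gaussianReal 0 1).real (Set.Ici (t - 3 * w)) := rfl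
  have e2 : (gaussianReal 0 1).real {ω | t + 3 * w ≤ id ω} =
    (gaussianReal 0 1).real (Set.Ici (t + 3 * w)) := rfl
  rw [e1] at hup2
  rw [e2] at hlo2
  simp only [id] at hup2 hlo2
  have h1' := abs_le.1 h1
  have h2' := abs_le.1 h2
  rw [abs_le]
  constructor <;> linarith [hb.1, hb.2]

/-- Uniform cap masses seen from a measure of density at most `exp m`: high-probability bound. -/
theorem sphereUniform_capMass_deviation_le (hd : 100 ≤ d) {m η : ℝ} (hm : 0 ≤ m) (hη : 0 < η)
    (hη1 : η ≤ 1) (hν : ν ≤ ENNReal.ofReal (Real.exp m) • sphereUniform d)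
    {τ p : ℝ} (h : HasCapMass d τ p) (hp : 0 ≤ p) {w T β : ℝ} (hT : 1 ≤ T) (hw : 0 < w)
    (hwT : w * T ≤ 1 / 10) (hτ : |τ| * √d ≤ T)
    (hβ : β = 2 * Real.exp (-(w ^ 2 * d / (16 * T ^ 2))))
    {r : ℕ} (hr : r ≠ 0) (hB : √(8 * (m + Real.log (4 / η)) / d) ^ 2 * r ≤ w ^ 2) :
    sphereUniform d {v | 80000 * (w * T) * (p + β) + 300 * η + β <
        |capMass ν τ (v : EuclideanSpace ℝ (Fin d)) - p|} ≤
      ENNReal.ofReal (4 * Real.exp (-(2 * r)) + β) := by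
  obtain ⟨S, S', hS⟩ := exists_isSmoothStep
  have hd0 : d ≠ 0 := by omega
  have hβ0 : 0 ≤ β := by rw [hβ]; positivity
  set t := τ * √d with ht
  have htT : |t| ≤ T := by rw [ht, abs_mul, abs_of_nonneg (Real.sqrt_nonneg _)]; exact hτ
  have hw1 : w ≤ 1 / 10 := by nlinarith
  have hN := stdGaussian_normDeviation_le (d := d) hτ (by linarith) hw (by linarith) hd0
  rw [← hβ] at hN
  have htT' := abs_le.1 htT
  have hφ0 := gaussianPDFReal_nonneg 0 1 t
  have he : Real.exp 1 ≤ 3 := by linarith [Real.exp_one_lt_d9]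
  have hnear : ∀ u, |u - t| ≤ 3 * w → gaussianPDFReal 0 1 u ≤ 3 * gaussianPDFReal 0 1 t := by
    intro u hu
    have hu' := abs_le.1 hu
    refine (gaussianPDFReal_std_le_mul (T := T + 1) (h := 3 * w) ?_ (by linarith) hu).trans ?_
    · rw [abs_le]; constructor <;> linarith
    · gcongr
      exact (Real.exp_le_exp.2 (by nlinarith)).trans he
  -- Converts density into probability: on an interval of length `1 / T` just above `t + w` the
  -- density is at least a fixed fraction of its value at `t`, and that interval has mass at most `p
  -- + β`. The constant `11` exceeds `exp 2.31`. The resulting factor `T` is the only loss in the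
  -- relative error.
  have hφp : gaussianPDFReal 0 1 t ≤ 11 * T * (p + β) := by
    have h1 := le_gaussianReal_real_Ici (a := t + w) (b := t + w + 1 / T)
      (M := gaussianPDFReal 0 1 t / 11) (by positivity) (fun u hu => by
        rw [div_le_iff₀ (by norm_num), mul_comm]
        have hT1 : 1 / T ≤ 1 := by rw [div_le_one (by linarith)]; exact hT
        have hwT' : w ≤ 1 / 10 / T := by rw [le_div_iff₀ (by linarith)]; exact hwT
        refine (gaussianPDFReal_std_le_mul (v := u) (T := T + 1.1) (h := 1.1 / T) (by linarith) ?_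
          ?_).trans ?_
        · rw [abs_le]; constructor <;> linarith [hu.1, hu.2]
        · have : (1.1 : ℝ) / T = 1 / 10 / T + 1 / T := by rw [← add_div]; norm_num
          rw [abs_sub_comm, abs_le, this]
          constructor <;> linarith [hu.1, hu.2, show 0 < 1 / T by positivity]
        · gcongr
          · exact gaussianPDFReal_nonneg 0 1 u
          have : 1.1 / T * (T + 1.1) ≤ 1 + 1.31 := by
            have : 1.1 / T * (T + 1.1) = 1.1 + 1.21 * (1 / T) := by field_simp; ring
            linarith
          refine (Real.exp_le_exp.2 this).trans ?_
          have e5 : Real.exp (1 + 1.31) = Real.exp (2.31 / 3) ^ 3 := by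
            rw [← Real.exp_nat_mul]; norm_num
          have e6 : Real.exp (0.77) ≤ 2.2 := by
            have := Real.exp_bound' (x := 0.77) (by norm_num) (by norm_num) (n := 4) (by norm_num)
            refine this.trans ?_
            simp [Finset.sum_range_succ, Nat.factorial]
            norm_num
          have e7 : (2.31 / 3 : ℝ) = 0.77 := by norm_num
          rw [e5, e7]
          calc Real.exp 0.77 ^ 3 ≤ 2.2 ^ 3 := by gcongr
            _ ≤ 11 := by norm_num)
    have h2 := (h.gaussian_bounds hd0 hp hβ0 hN).1
    have h3 : (t + w + 1 / T - (t + w)) * (gaussianPDFReal 0 1 t / 11) ≤ p + β := by linarith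
    have h4 : (t + w + 1 / T - (t + w)) * (gaussianPDFReal 0 1 t / 11) =
        gaussianPDFReal 0 1 t / (11 * T) := by field_simp; ring
    rw [h4, div_le_iff₀ (by positivity)] at h3
    linarith
  have hconc : ∀ c, |c - t| ≤ 2 * w →
      stdGaussian (EuclideanSpace ℝ (Fin d)) {g | 300 * (24 * w * gaussianPDFReal 0 1 t + η) ≤
        |∫ y, S ((y - c) / w) ∂(gaussianReal 0 1) -
          ridgeAverage ν (fun s => S ((s - c) / w)) g|} ≤
      ENNReal.ofReal (2 * Real.exp (-(2 * r))) := by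
    intro c hc
    have hc' := abs_le.1 hc
    have hcw : |c| * w ≤ 1 / 2 := by
      have : |c| ≤ T + 2 * w := by rw [abs_le]; constructor <;> linarith
      nlinarith
    refine (measure_mono fun g hg => ?_).trans
      (stdGaussian_smoothStep_deviation_le hd hm hη hη1 hν hS hw hcw hr hB)
    refine le_trans ?_ (show 300 * (24 * w * gaussianPDFReal 0 1 t + η) ≤ _ from hg)
    have := hnear c (by linarith)
    nlinarith
  have hmeas : MeasurableSet {v : EuclideanSpace ℝ (Fin d) |
      80000 * (w * T) * (p + β) + 300 * η + β < |capMass ν τ v - p|} :=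
    measurableSet_lt measurable_const ((measurable_capMass ν τ).sub_const p).abs
  have hσ := sphereUniform_apply_eq hd0 hmeas
  refine (le_of_eq hσ).trans ?_
  set κ := 300 * (24 * w * gaussianPDFReal 0 1 t + η) with hκ
  set D1 := {g : EuclideanSpace ℝ (Fin d) | κ ≤
        |∫ y, S ((y - (t - 2 * w)) / w) ∂(gaussianReal 0 1) -
          ridgeAverage ν (fun s => S ((s - (t - 2 * w)) / w)) g|}
  set D2 := {g : EuclideanSpace ℝ (Fin d) | κ ≤
        |∫ y, S ((y - (t + 2 * w)) / w) ∂(gaussianReal 0 1) -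
          ridgeAverage ν (fun s => S ((s - (t + 2 * w)) / w)) g|}
  have hsub : ∀ᵐ g ∂(stdGaussian (EuclideanSpace ℝ (Fin d))),
      g ∈ {g : EuclideanSpace ℝ (Fin d) | ‖g‖⁻¹ • g ∈ {v : EuclideanSpace ℝ (Fin d) |
        80000 * (w * T) * (p + β) + 300 * η + β < |capMass ν τ v - p|}} →
      g ∈ (D1 ∪ D2) ∪ normDeviation d τ w := by
    filter_upwards [stdGaussian_ae_ne_zero hd0] with g hg0 hgm
    by_contra hcon
    simp only [Set.mem_union, not_or] at hcon
    obtain ⟨⟨hn1, hn2⟩, hn3⟩ := hcon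
    have hgm' : 80000 * (w * T) * (p + β) + 300 * η + β <
      |capMass ν τ (‖g‖⁻¹ • g) - p| := hgm
    have hres := abs_capMass_sub_le (ν := ν) hS h hd0 hp hw hβ0 hN hg0 hn3
      (not_le.1 hn1).le (not_le.1 hn2).le (M := 3 * gaussianPDFReal 0 1 t) (fun u hu => hnear u (by
        rw [abs_le]; constructor <;> linarith [hu.1, hu.2]))
    -- The coefficient of `w` times the density is `7200 + 18`, and `7218 * 11 ≤ 80000`.
    have : κ + 6 * w * (3 * gaussianPDFReal 0 1 t) ≤ 80000 * (w * T) * (p + β) + 300 * η := by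
      have h5 := mul_le_mul_of_nonneg_left hφp (show 0 ≤ 7218 * w by positivity)
      have h6 : 0 ≤ (w * T) * (p + β) := by positivity
      rw [hκ]
      nlinarith
    linarith
  calc _ ≤ stdGaussian (EuclideanSpace ℝ (Fin d)) ((D1 ∪ D2) ∪ normDeviation d τ w) :=
        measure_mono_ae hsub
    _ ≤ (ENNReal.ofReal (2 * Real.exp (-(2 * r))) + ENNReal.ofReal (2 * Real.exp (-(2 * r)))) +
        ENNReal.ofReal β := by
        refine (measure_union_le _ _).trans (add_le_add ((measure_union_le _ _).trans
          (add_le_add (hconc _ ?_) (hconc _ ?_))) hN)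
        · rw [abs_le]; constructor <;> linarith
        · rw [abs_le]; constructor <;> linarith
    _ = _ := by
        rw [← ENNReal.ofReal_add (by positivity) (by positivity),
          ← ENNReal.ofReal_add (by positivity) hβ0]
        congr 1; ring

/-- Uniform cap masses seen from a measure of density at most `exp m`: first-moment bound. -/
theorem lintegral_abs_capMass_sub_le (hd : 100 ≤ d) {m : ℝ} (hm : 0 ≤ m)
    (hν : ν ≤ ENNReal.ofReal (Real.exp m) • sphereUniform d)
    {τ p : ℝ} (h : HasCapMass d τ p) (hp : 0 ≤ p) (hp1 : p ≤ 1) {w T β : ℝ} (hT : 0 < T)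
    (hw : 0 < w) (hwT : w ≤ T) (hτ : |τ| * √d ≤ T)
    (hβ : β = 2 * Real.exp (-(w ^ 2 * d / (16 * T ^ 2)))) :
    ∫⁻ v : sphere (0 : EuclideanSpace ℝ (Fin d)) 1,
        ENNReal.ofReal |capMass ν τ (v : EuclideanSpace ℝ (Fin d)) - p| ∂(sphereUniform d) ≤
      ENNReal.ofReal (22 * √(8 * (m + Real.log 4) / d) / w + 6 * w + 2 * β) := by
  obtain ⟨S, S', hS⟩ := exists_isSmoothStep
  have hd0 : d ≠ 0 := by omega
  have hβ0 : 0 ≤ β := by rw [hβ]; positivity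
  have hN := stdGaussian_normDeviation_le (d := d) hτ hT hw hwT hd0
  rw [← hβ] at hN
  set t := τ * √d with ht
  have hcm := measurable_capMass ν τ
  have hmf : Measurable fun v : EuclideanSpace ℝ (Fin d) =>
    ENNReal.ofReal |capMass ν τ v - p| := by fun_prop
  rw [← lintegral_stdGaussian_direction hd0 hmf]
  set D : ℝ → EuclideanSpace ℝ (Fin d) → ℝ := fun c g =>
    |∫ y, S ((y - c) / w) ∂(gaussianReal 0 1) - ridgeAverage ν (fun s => S ((s - c) / w)) g|
    with hD
  have hDm : ∀ c, Measurable fun g => ENNReal.ofReal (D c g) := fun c => by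
    have hc : Continuous fun s => S ((s - c) / w) := by
      have := hS.continuous
      fun_prop
    have hRc := continuous_ridgeAverage (ν := ν) hc (fun s => hS.abs_le_one ((s - c) / w))
    exact (ENNReal.continuous_ofReal.comp (by fun_prop)).measurable
  have hNm : MeasurableSet (normDeviation d τ w) :=
    measurableSet_lt measurable_const (by fun_prop)
  have hpt : ∀ᵐ g ∂(stdGaussian (EuclideanSpace ℝ (Fin d))),
      ENNReal.ofReal |capMass ν τ (‖g‖⁻¹ • g) - p| ≤
        (ENNReal.ofReal (D (t - 2 * w) g) + ENNReal.ofReal (D (t + 2 * w) g)) +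
          (ENNReal.ofReal (6 * w + β) + (normDeviation d τ w).indicator 1 g) := by
    filter_upwards [stdGaussian_ae_ne_zero hd0] with g hg0
    -- On the norm-deviation event the difference is bounded by `1`, which contributes one more `β`;
    -- elsewhere the density is crudely bounded by `1`.
    by_cases hg : g ∈ normDeviation d τ w
    · rw [Set.indicator_of_mem hg]
      refine le_trans ?_ (le_add_left (le_add_left le_rfl))
      rw [Pi.one_apply, ← ENNReal.ofReal_one]
      apply ENNReal.ofReal_le_ofReal
      have := capMass_nonneg ν τ (‖g‖⁻¹ • g)
      have := capMass_le_one ν τ (‖g‖⁻¹ • g)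
      rw [abs_le]; constructor <;> linarith
    · rw [Set.indicator_of_notMem hg, add_zero, ← ENNReal.ofReal_add (abs_nonneg _) (abs_nonneg _),
        ← ENNReal.ofReal_add (by positivity) (by positivity)]
      apply ENNReal.ofReal_le_ofReal
      have := abs_capMass_sub_le (ν := ν) hS h hd0 hp hw hβ0 hN hg0 hg
        (κ := D (t - 2 * w) g + D (t + 2 * w) g)
        (le_add_of_nonneg_right (abs_nonneg _)) (le_add_of_nonneg_left (abs_nonneg _))
        (M := 1) (fun u _ => gaussianPDFReal_std_le_one u)
      linarith
  refine (lintegral_mono_ae hpt).trans ?_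
  have hsum : Measurable fun g => ENNReal.ofReal (D (t - 2 * w) g) +
      ENNReal.ofReal (D (t + 2 * w) g) := (hDm _).add (hDm _)
  rw [lintegral_add_left hsum, lintegral_add_left (hDm _),
    lintegral_add_left measurable_const, lintegral_const, measure_univ, mul_one,
    lintegral_indicator_one hNm]
  have hB0 : 0 ≤ √(8 * (m + Real.log 4) / d) := Real.sqrt_nonneg _
  calc _ ≤ (ENNReal.ofReal (11 * √(8 * (m + Real.log 4) / d) / w) +
        ENNReal.ofReal (11 * √(8 * (m + Real.log 4) / d) / w)) +
          (ENNReal.ofReal (6 * w + β) + ENNReal.ofReal β) := by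
        gcongr
        · exact lintegral_abs_smoothStep_deviation_le hd hm hν hS hw _
        · exact lintegral_abs_smoothStep_deviation_le hd hm hν hS hw _
    _ = _ := by
        rw [← ENNReal.ofReal_add (by positivity) (by positivity),
          ← ENNReal.ofReal_add (by positivity) (by positivity),
          ← ENNReal.ofReal_add (by positivity) (by positivity)]
        congr 1; ring

end CapMass

/-! ### Expected excess of the cap mass over the permitted relative error. -/

section CapExcess

open ProbabilityTheory Metric
open scoped ENNReal RealInnerProductSpace

variable {d : ℕ} {ν : Measure (sphere (0 : EuclideanSpace ℝ (Fin d)) 1)} [IsProbabilityMeasure ν]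
  {τ p : ℝ}

theorem ofReal_capMass (v : EuclideanSpace ℝ (Fin d)) : ENNReal.ofReal (capMass ν τ v) =
    ν {x | τ ≤ ⟪(x : EuclideanSpace ℝ (Fin d)), v⟫} := by
  rw [capMass, ofReal_measureReal]

/-- Fubini and the symmetry of the relation "lies in the cap of": for each fixed `x`, a uniform `v`
has `x` in its cap with probability `p`. -/
theorem HasCapMass.lintegral_capMass (h : HasCapMass d τ p) (hd : d ≠ 0) :
    ∫⁻ v : sphere (0 : EuclideanSpace ℝ (Fin d)) 1,
      ENNReal.ofReal (capMass ν τ (v : EuclideanSpace ℝ (Fin d))) ∂(sphereUniform d) =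
        ENNReal.ofReal p := by
  have := isProbabilityMeasure_sphereUniform hd
  have hs : MeasurableSet {q : sphere (0 : EuclideanSpace ℝ (Fin d)) 1 ×
      sphere (0 : EuclideanSpace ℝ (Fin d)) 1 |
      τ ≤ ⟪(q.2 : EuclideanSpace ℝ (Fin d)), (q.1 : EuclideanSpace ℝ (Fin d))⟫} :=
    measurableSet_le measurable_const (by fun_prop)
  have h1 := Measure.prod_apply (μ := sphereUniform d) (ν := ν) hs
  have h2 := Measure.prod_apply_symm (μ := sphereUniform d) (ν := ν) hs
  simp_rw [ofReal_capMass]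
  refine (h1.symm.trans h2).trans ?_
  have h3 : ∀ x : sphere (0 : EuclideanSpace ℝ (Fin d)) 1,
      sphereUniform d ((fun v => (v, x)) ⁻¹' {q : sphere (0 : EuclideanSpace ℝ (Fin d)) 1 ×
      sphere (0 : EuclideanSpace ℝ (Fin d)) 1 |
      τ ≤ ⟪(q.2 : EuclideanSpace ℝ (Fin d)), (q.1 : EuclideanSpace ℝ (Fin d))⟫}) =
        ENNReal.ofReal p := fun x => by
    rw [← h x (by simp)]
    congr 1
    ext v
    change τ ≤ ⟪(x : EuclideanSpace ℝ (Fin d)), (v : EuclideanSpace ℝ (Fin d))⟫ ↔ τ ≤ ⟪(v : EuclideanSpace ℝ (Fin d)), (x : EuclideanSpace ℝ (Fin d))⟫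
    rw [real_inner_comm]
  simp_rw [h3]
  simp

/-- A crude first-moment bound, useful when the caps are almost the whole sphere. -/
theorem HasCapMass.lintegral_abs_capMass_sub_le_compl (h : HasCapMass d τ p) (hd : d ≠ 0)
    (hp : 0 ≤ p) (hp1 : p ≤ 1) :
    ∫⁻ v : sphere (0 : EuclideanSpace ℝ (Fin d)) 1,
      ENNReal.ofReal |capMass ν τ (v : EuclideanSpace ℝ (Fin d)) - p| ∂(sphereUniform d) ≤
        ENNReal.ofReal (2 * (1 - p)) := by
  have := isProbabilityMeasure_sphereUniform hd
  have hcm := measurable_capMass ν τ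
  have hm1 : Measurable fun v : sphere (0 : EuclideanSpace ℝ (Fin d)) 1 =>
    ENNReal.ofReal (1 - capMass ν τ (v : EuclideanSpace ℝ (Fin d))) := by fun_prop
  have hX : ∫⁻ v : sphere (0 : EuclideanSpace ℝ (Fin d)) 1,
      ENNReal.ofReal (1 - capMass ν τ (v : EuclideanSpace ℝ (Fin d))) ∂(sphereUniform d) ≤
        ENNReal.ofReal (1 - p) := by
    have h1 : ∫⁻ v : sphere (0 : EuclideanSpace ℝ (Fin d)) 1,
        (ENNReal.ofReal (1 - capMass ν τ (v : EuclideanSpace ℝ (Fin d))) +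
          ENNReal.ofReal (capMass ν τ (v : EuclideanSpace ℝ (Fin d)))) ∂(sphereUniform d) = 1 := by
      have : ∀ v : sphere (0 : EuclideanSpace ℝ (Fin d)) 1,
          ENNReal.ofReal (1 - capMass ν τ (v : EuclideanSpace ℝ (Fin d))) +
          ENNReal.ofReal (capMass ν τ (v : EuclideanSpace ℝ (Fin d))) = 1 := fun v => by
        rw [← ENNReal.ofReal_add (sub_nonneg.2 (capMass_le_one ν τ _)) (capMass_nonneg ν τ _)]
        simp
      simp_rw [this]; simp
    rw [lintegral_add_left hm1, h.lintegral_capMass hd] at h1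
    rw [ENNReal.ofReal_sub _ hp, ENNReal.ofReal_one, ← h1, ENNReal.add_sub_cancel_right
      ENNReal.ofReal_ne_top]
  calc _ ≤ ∫⁻ v : sphere (0 : EuclideanSpace ℝ (Fin d)) 1,
        (ENNReal.ofReal (1 - capMass ν τ (v : EuclideanSpace ℝ (Fin d))) +
          ENNReal.ofReal (1 - p)) ∂(sphereUniform d) := by
        refine lintegral_mono fun v => ?_
        have h0 := capMass_le_one ν τ (v : EuclideanSpace ℝ (Fin d))
        rw [← ENNReal.ofReal_add (by linarith) (by linarith)]
        apply ENNReal.ofReal_le_ofReal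
        rw [abs_le]; constructor <;> linarith
    _ ≤ ENNReal.ofReal (1 - p) + ENNReal.ofReal (1 - p) := by
        rw [lintegral_add_left hm1]
        gcongr
        simp
    _ = _ := by
        rw [← ENNReal.ofReal_add (by linarith) (by linarith)]; congr 1; ring

theorem HasCapMass.le_of_nonneg (h : HasCapMass d τ p) (hd : 100 ≤ d) (hτ : 0 ≤ τ) :
    p ≤ 4 * Real.exp (-(d * τ ^ 2) / 8) := by
  obtain ⟨u, hu⟩ : ∃ u : EuclideanSpace ℝ (Fin d), ‖u‖ = 1 :=
    ⟨EuclideanSpace.single ⟨0, by omega⟩ 1, by simp⟩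
  have h1 := sphereUniform_inner_tail hd hu hτ
  rw [h u hu] at h1
  exact (ENNReal.ofReal_le_ofReal_iff (by positivity)).1 h1

theorem HasCapMass.one_sub_le_of_nonpos (h : HasCapMass d τ p) (hd : 100 ≤ d) (hp : 0 ≤ p)
    (hτ : τ ≤ 0) : 1 - p ≤ 4 * Real.exp (-(d * τ ^ 2) / 8) := by
  obtain ⟨u, hu⟩ : ∃ u : EuclideanSpace ℝ (Fin d), ‖u‖ = 1 :=
    ⟨EuclideanSpace.single ⟨0, by omega⟩ 1, by simp⟩
  have := isProbabilityMeasure_sphereUniform (d := d) (by omega)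
  have h1 := sphereUniform_inner_tail hd (u := -u) (s := -τ) (by simpa using hu) (by linarith)
  have h2 := h u hu
  have h3 : (1 : ℝ≥0∞) ≤ ENNReal.ofReal p + ENNReal.ofReal (4 * Real.exp (-(d * (-τ) ^ 2) / 8)) := by
    rw [← h2, ← measure_univ (μ := sphereUniform d)]
    refine le_trans (measure_mono fun x _ => ?_) ((measure_union_le _ _).trans
      (add_le_add le_rfl h1))
    by_cases hx : τ ≤ ⟪(x : EuclideanSpace ℝ (Fin d)), u⟫
    · exact Or.inl hx
    · right
      change -τ ≤ ⟪(x : EuclideanSpace ℝ (Fin d)), -u⟫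
      rw [inner_neg_right]; linarith
  rw [← ENNReal.ofReal_add hp (by positivity), ← ENNReal.ofReal_one,
    ENNReal.ofReal_le_ofReal_iff (by positivity), neg_sq] at h3
  linarith

/-- Moderate dimension: the cap mass rarely deviates from `p` by a relative error `δ`. -/
theorem lintegral_capMass_excess_le_of_le {a b L Z δ : ℝ} (hL : 10 ^ 17 ≤ L)
    (haL : 10 ^ 16 ≤ a * L) (hbL : 1000 ≤ b * L) (hZ : L ≤ Z)
    (hd : a * Z * L ^ 4 ≤ d) (hd40 : (d : ℝ) ≤ Real.exp (40 * L))
    (hδ : δ = √Z * L ^ 2 / √d) (hp : b * Real.exp (-L) ≤ p) (hp1 : p ≤ 1)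
    (h : HasCapMass d τ p) (hτ : |τ| * √d ≤ 30 * √L)
    (hν : ν ≤ ENNReal.ofReal (Real.exp (12 * L * Z)) • sphereUniform d) :
    ∫⁻ v : sphere (0 : EuclideanSpace ℝ (Fin d)) 1,
      ENNReal.ofReal (|capMass ν τ (v : EuclideanSpace ℝ (Fin d)) - p| - p * δ)
        ∂(sphereUniform d) ≤ ENNReal.ofReal (20 * Real.exp (-(3 * L))) := by
  have hL0 : 0 < L := by linarith
  have hb0 : 0 < b := pos_of_mul_pos_left (by linarith) hL0.le
  have ha0 : 0 < a := pos_of_mul_pos_left (by linarith) hL0.le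
  have hZ0 : 0 < Z := by linarith
  have hp0 : 0 < p := lt_of_lt_of_le (by positivity) hp
  have hdpos : (0 : ℝ) < d := lt_of_lt_of_le (by positivity) hd
  have hd100 : 100 ≤ d := by
    have : (100 : ℝ) ≤ d := by
      refine le_trans ?_ hd
      calc (100 : ℝ) ≤ 10 ^ 16 * 1 := by norm_num
        _ ≤ (a * L) * L ^ 4 := by gcongr; exact one_le_pow₀ (by linarith)
        _ ≤ _ := by gcongr
    exact_mod_cast this
  have hprob := isProbabilityMeasure_sphereUniform (d := d) (by omega)
  set s := √(d : ℝ) with hs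
  set y := √Z with hy
  set l := √L with hl
  have hs0 : 0 < s := Real.sqrt_pos.2 hdpos
  have hy0 : 0 < y := Real.sqrt_pos.2 hZ0
  have hl0 : 0 < l := Real.sqrt_pos.2 hL0
  have hs2 : s ^ 2 = d := Real.sq_sqrt hdpos.le
  have hy2 : y ^ 2 = Z := Real.sq_sqrt hZ0.le
  have hl2 : l ^ 2 = L := Real.sq_sqrt hL0.le
  have hlbig : 2 * 10 ^ 8 ≤ l := Real.le_sqrt_of_sq_le (by linarith)
  have hy1 : 1 ≤ y := Real.one_le_sqrt.2 (by linarith)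
  have hδ0 : 0 < δ := by rw [hδ]; positivity
  -- The least scale, up to constants, allowed by the moment condition: with `r ≤ 3 L` and a
  -- log-density budget of `13 L Z` that condition asks for `w² ≥ 312 L² Z / d`, and `18² = 324`.
  set w := 18 * L * y / s with hw
  have hw0 : 0 < w := by positivity
  have hwT : w * (30 * l) = 540 * δ / l := by
    rw [hw, hδ, ← hl2]; field_simp; ring
  -- The lower bound on `d` is used here: `δ` stays bounded, hence is small compared with `√L`.
  have hδa : a * δ ^ 2 ≤ 1 := by
    rw [hδ, div_pow, mul_pow, hs2, hy2, ← mul_div_assoc, div_le_one hdpos]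
    calc a * (Z * (L ^ 2) ^ 2) = a * Z * L ^ 4 := by ring
      _ ≤ (d : ℝ) := hd
  have hδl : 5400 * δ ≤ l := by
    refine le_of_sq_le_sq ?_ hl0.le
    rw [hl2]
    have h1 : 10 ^ 16 * δ ^ 2 ≤ L := by
      calc 10 ^ 16 * δ ^ 2 ≤ a * L * δ ^ 2 := by gcongr
        _ = (a * δ ^ 2) * L := by ring
        _ ≤ 1 * L := by gcongr
        _ = L := one_mul L
    nlinarith [sq_nonneg δ]
  set β := 2 * Real.exp (-(w ^ 2 * d / (16 * (30 * l) ^ 2))) with hβ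
  have hβle : β ≤ 2 * Real.exp (-(100 * L)) := by
    rw [hβ]
    gcongr
    have : w ^ 2 * d / (16 * (30 * l) ^ 2) = 9 / 400 * L * Z := by
      rw [hw, div_pow, ← hs2, mul_pow, mul_pow, mul_pow, hl2, hy2]; field_simp; norm_num
    rw [this]
    nlinarith
  -- Makes the failure probability of order `exp (-4 L)`, below the target `exp (-3 L)`.
  set r : ℕ := ⌈2 * L⌉₊ with hr
  have hr1 : 2 * L ≤ r := Nat.le_ceil _
  have hr2 : (r : ℝ) ≤ 3 * L := (Nat.ceil_lt_add_one (by positivity)).le.trans (by linarith)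
  set η := Real.exp (-(100 * L)) with hη
  have hη1 : η ≤ 1 := by rw [hη]; exact Real.exp_le_one_iff.2 (by linarith)
  have hlogη : Real.log (4 / η) ≤ L * Z := by
    rw [Real.log_div (by norm_num) (Real.exp_pos _).ne', Real.log_exp]
    have h4 : Real.log 4 ≤ 3 := by
      have := Real.log_le_sub_one_of_pos (show (0 : ℝ) < 4 by norm_num); linarith
    nlinarith
  have hlogη0 : 0 ≤ Real.log (4 / η) := by
    apply Real.log_nonneg
    rw [le_div_iff₀ (Real.exp_pos _)]; linarith
  have hB : √(8 * (12 * L * Z + Real.log (4 / η)) / d) ^ 2 * r ≤ w ^ 2 := by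
    rw [Real.sq_sqrt (by positivity)]
    calc 8 * (12 * L * Z + Real.log (4 / η)) / d * r ≤ 8 * (12 * L * Z + L * Z) / d * (3 * L) := by
          gcongr
      _ = 312 * (L ^ 2 * Z) / d := by ring
      _ ≤ 324 * (L ^ 2 * Z) / d := by gcongr; norm_num
      _ = w ^ 2 := by rw [hw, div_pow, hs2, mul_pow, mul_pow, hy2]; ring
  have hmain := sphereUniform_capMass_deviation_le hd100 (m := 12 * L * Z) (by positivity)
    (Real.exp_pos _) hη1 hν h hp0.le (w := w) (T := 30 * l) (by linarith) hw0
    (by rw [hwT, div_le_iff₀ hl0]; linarith) hτ hβ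
    (r := r) (by intro h0; rw [h0] at hr1; push_cast at hr1; linarith) hB
  have hexpL : L ≤ Real.exp L := by linarith [Real.add_one_le_exp L]
  have hsmall : η * 1000 ≤ b * Real.exp (-(21 * L)) := by
    have e1 : η = Real.exp (-(21 * L)) * Real.exp (-(79 * L)) := by
      rw [hη, ← Real.exp_add]; congr 1; ring
    have e2 : Real.exp (-(79 * L)) * L ≤ 1 := by
      have : Real.exp (-(79 * L)) ≤ Real.exp (-L) := Real.exp_le_exp.2 (by linarith)
      calc Real.exp (-(79 * L)) * L ≤ Real.exp (-L) * Real.exp L := by gcongr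
        _ = 1 := by rw [← Real.exp_add]; simp
    have e3 : Real.exp (-(79 * L)) * 1000 ≤ b := by
      calc Real.exp (-(79 * L)) * 1000 ≤ Real.exp (-(79 * L)) * (b * L) := by gcongr
        _ = (Real.exp (-(79 * L)) * L) * b := by ring
        _ ≤ 1 * b := by gcongr
        _ = b := one_mul b
    rw [e1]
    calc _ = Real.exp (-(21 * L)) * (Real.exp (-(79 * L)) * 1000) := by ring
      _ ≤ Real.exp (-(21 * L)) * b := by gcongr
      _ = _ := mul_comm _ _
  -- The upper bound on `d` keeps `p * δ` far above the additive errors `η` and `β`, both of order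
  -- at most `exp (-100 L)`.
  have hδlow : Real.exp (-(20 * L)) ≤ δ := by
    have h1 : s ≤ Real.exp (20 * L) := by
      rw [hs, Real.sqrt_le_left (Real.exp_pos _).le, ← Real.exp_nat_mul]
      refine hd40.trans (Real.exp_le_exp.2 ?_)
      push_cast; linarith
    rw [hδ, Real.exp_neg, inv_eq_one_div]
    gcongr
    exact one_le_mul_of_one_le_of_one_le hy1 (one_le_pow₀ (by linarith))
  have hpδ : b * Real.exp (-(21 * L)) ≤ p * δ := by
    calc b * Real.exp (-(21 * L)) = b * Real.exp (-L) * Real.exp (-(20 * L)) := by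
          rw [mul_assoc, ← Real.exp_add]; congr 2; ring
      _ ≤ p * δ := by gcongr
  have hηp : 1000 * η ≤ p := by
    have : Real.exp (-(21 * L)) ≤ Real.exp (-L) := Real.exp_le_exp.2 (by linarith)
    calc 1000 * η = η * 1000 := mul_comm _ _
      _ ≤ b * Real.exp (-(21 * L)) := hsmall
      _ ≤ b * Real.exp (-L) := by gcongr
      _ ≤ p := hp
  have hηpos : 0 < η := Real.exp_pos _
  have hthr : 80000 * (w * (30 * l)) * (p + β) + 300 * η + β ≤ p * δ := by
    have h1 : 80000 * (w * (30 * l)) * (p + β) ≤ p * δ / 2 := by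
      rw [hwT]
      have : p + β ≤ 2 * p := by linarith
      calc 80000 * (540 * δ / l) * (p + β) ≤ 80000 * (540 * δ / l) * (2 * p) := by gcongr
        _ = (p * δ) * (86400000 / l) := by ring
        _ ≤ (p * δ) * (1 / 2) := by
            refine mul_le_mul_of_nonneg_left ?_ (by positivity)
            rw [div_le_iff₀ hl0]; linarith
        _ = p * δ / 2 := by ring
    linarith
  have hset : MeasurableSet {v : sphere (0 : EuclideanSpace ℝ (Fin d)) 1 |
      80000 * (w * (30 * l)) * (p + β) + 300 * η + β <
        |capMass ν τ (v : EuclideanSpace ℝ (Fin d)) - p|} :=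
    measurableSet_lt measurable_const
      (((measurable_capMass ν τ).comp measurable_subtype_coe).sub_const p).abs
  calc _ ≤ ∫⁻ v, {v : sphere (0 : EuclideanSpace ℝ (Fin d)) 1 |
      80000 * (w * (30 * l)) * (p + β) + 300 * η + β <
        |capMass ν τ (v : EuclideanSpace ℝ (Fin d)) - p|}.indicator 1 v ∂(sphereUniform d) := by
        -- The excess is at most `1` everywhere and vanishes off the deviation event, so its
        -- expectation is at most the probability of that event.
        refine lintegral_mono fun v => ?_
        by_cases hv : v ∈ {v : sphere (0 : EuclideanSpace ℝ (Fin d)) 1 |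
            80000 * (w * (30 * l)) * (p + β) + 300 * η + β <
              |capMass ν τ (v : EuclideanSpace ℝ (Fin d)) - p|}
        · rw [Set.indicator_of_mem hv, Pi.one_apply, ← ENNReal.ofReal_one]
          apply ENNReal.ofReal_le_ofReal
          have := capMass_nonneg ν τ (v : EuclideanSpace ℝ (Fin d))
          have := capMass_le_one ν τ (v : EuclideanSpace ℝ (Fin d))
          have : |capMass ν τ (v : EuclideanSpace ℝ (Fin d)) - p| ≤ 1 := by
            rw [abs_le]; constructor <;> linarith
          have : 0 < p * δ := by positivity
          linarith
        · rw [Set.indicator_of_notMem hv, ENNReal.ofReal_of_nonpos]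
          have hv' := not_lt.1 (show ¬ (80000 * (w * (30 * l)) * (p + β) + 300 * η + β <
            |capMass ν τ (v : EuclideanSpace ℝ (Fin d)) - p|) from hv)
          linarith
    _ ≤ ENNReal.ofReal (4 * Real.exp (-(2 * r)) + β) := by
        rw [lintegral_indicator_one hset]; exact hmain
    _ ≤ _ := by
        apply ENNReal.ofReal_le_ofReal
        have h1 : Real.exp (-(2 * (r : ℝ))) ≤ Real.exp (-(3 * L)) :=
          Real.exp_le_exp.2 (by linarith)
        have h2 : η ≤ Real.exp (-(3 * L)) := Real.exp_le_exp.2 (by linarith)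
        linarith [Real.exp_pos (-(3 * L))]

/-- Huge dimension: the cap mass is close to `p` on average. -/
theorem lintegral_capMass_excess_le_of_ge {L Z δ : ℝ} (hL : 10 ^ 17 ≤ L)
    (hZ : L ≤ Z) (hZL : Z ≤ Real.exp L)
    (hd100 : 100 ≤ d) (hd40 : Real.exp (40 * L) ≤ d)
    (hδ : 0 ≤ δ) (hp : 0 ≤ p) (hp1 : p ≤ 1)
    (h : HasCapMass d τ p) (hτ : |τ| * √d ≤ 30 * √L)
    (hν : ν ≤ ENNReal.ofReal (Real.exp (12 * L * Z)) • sphereUniform d) :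
    ∫⁻ v : sphere (0 : EuclideanSpace ℝ (Fin d)) 1,
      ENNReal.ofReal (|capMass ν τ (v : EuclideanSpace ℝ (Fin d)) - p| - p * δ)
        ∂(sphereUniform d) ≤ ENNReal.ofReal (20 * Real.exp (-(3 * L))) := by
  have hL0 : 0 < L := by linarith
  have hZ0 : 0 < Z := by linarith
  have hdpos : (0 : ℝ) < d := by positivity
  have hexpL : L ≤ Real.exp L := by linarith [Real.add_one_le_exp L]
  have hlbig : 1 ≤ √L := Real.one_le_sqrt.2 (by linarith)
  set e := Real.exp L with he
  have he0 : 0 < e := Real.exp_pos _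
  have hpow : ∀ k : ℕ, Real.exp (k * L) = e ^ k := fun k => by rw [he, ← Real.exp_nat_mul]
  have h40 : e ^ 40 ≤ d := by rw [← hpow]; exact_mod_cast hd40
  have hw : Real.exp (-(4 * L)) = (e ^ 4)⁻¹ := by rw [Real.exp_neg, ← hpow]; norm_num
  have h3 : Real.exp (-(3 * L)) = (e ^ 3)⁻¹ := by rw [Real.exp_neg, ← hpow]; norm_num
  have he1 : 10 ^ 17 ≤ e := by linarith
  -- Here the allowance `p * δ` is ignored. With `w = exp (-4 L)` the dimension is so large that all
  -- terms of the first-moment bound are at most of order `exp (-3 L)`.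
  have hmain := lintegral_abs_capMass_sub_le hd100 (m := 12 * L * Z) (by positivity) hν h hp hp1
    (w := (e ^ 4)⁻¹) (T := 30 * √L) (by positivity) (by positivity) (by
      have : (e ^ 4)⁻¹ ≤ 1 := inv_le_one_of_one_le₀ (one_le_pow₀ (by linarith))
      linarith) hτ rfl
  refine (lintegral_mono fun v => ENNReal.ofReal_le_ofReal ?_).trans
    (hmain.trans (ENNReal.ofReal_le_ofReal ?_))
  · have : 0 ≤ p * δ := by positivity
    linarith
  have hB : √(8 * (12 * L * Z + Real.log 4) / d) ≤ 11 * (e ^ 19)⁻¹ := by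
    rw [Real.sqrt_le_left (by positivity)]
    have h4 : Real.log 4 ≤ 3 := by
      have := Real.log_le_sub_one_of_pos (show (0 : ℝ) < 4 by norm_num); linarith
    have h5 : 12 * L * Z + Real.log 4 ≤ 13 * e ^ 2 := by
      have : L * Z ≤ e * e := by gcongr
      nlinarith
    calc 8 * (12 * L * Z + Real.log 4) / d ≤ 8 * (13 * e ^ 2) / e ^ 40 := by gcongr
      _ = 104 * (e ^ 38)⁻¹ := by field_simp; norm_num
      _ ≤ 121 * (e ^ 38)⁻¹ := by gcongr; norm_num
      _ = _ := by field_simp; norm_num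
  have hβ : Real.exp (-(((e ^ 4)⁻¹) ^ 2 * d / (16 * (30 * √L) ^ 2))) ≤ (e ^ 3)⁻¹ := by
    rw [← h3]
    apply Real.exp_le_exp.2
    rw [mul_pow, Real.sq_sqrt hL0.le, neg_le_neg_iff, le_div_iff₀ (by positivity)]
    have h6 : e ^ 32 ≤ ((e ^ 4)⁻¹) ^ 2 * d := by
      calc e ^ 32 = ((e ^ 4)⁻¹) ^ 2 * e ^ 40 := by field_simp
        _ ≤ _ := by gcongr
    refine le_trans ?_ h6
    calc 3 * L * (16 * (30 ^ 2 * L)) = 43200 * (L * L) := by ring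
      _ ≤ e * (e * e) := by gcongr; linarith
      _ = e ^ 3 := by ring
      _ ≤ e ^ 32 := pow_le_pow_right₀ (by linarith) (by norm_num)
  rw [h3]
  have h7 : 22 * √(8 * (12 * L * Z + Real.log 4) / d) / (e ^ 4)⁻¹ ≤ (e ^ 3)⁻¹ := by
    calc 22 * √(8 * (12 * L * Z + Real.log 4) / d) / (e ^ 4)⁻¹
        ≤ 22 * (11 * (e ^ 19)⁻¹) / (e ^ 4)⁻¹ := by gcongr
      _ = 242 * (e ^ 15)⁻¹ := by field_simp; norm_num
      _ ≤ e * (e ^ 15)⁻¹ := by gcongr; linarith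
      _ = (e ^ 14)⁻¹ := by field_simp
      _ ≤ (e ^ 3)⁻¹ := by
          gcongr
          · linarith
          · norm_num
  have h8 : (e ^ 4)⁻¹ ≤ (e ^ 3)⁻¹ := by
    gcongr
    · linarith
    · norm_num
  have h9 : 0 < (e ^ 3)⁻¹ := by positivity
  linarith

/-- The expected relative excess `(|f - p| - δ p)₊` of the cap mass `f` is negligible. -/
theorem lintegral_capMass_excess_le {a b L Z δ : ℝ} (hL : 10 ^ 17 ≤ L)
    (haL : 10 ^ 16 ≤ a * L) (hbL : 1000 ≤ b * L) (hZ : L ≤ Z) (hZL : Z ≤ Real.exp L)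
    (hd : a * Z * L ^ 4 ≤ d) (hδ : δ = √Z * L ^ 2 / √d)
    (hp : b * Real.exp (-L) ≤ p) (hp1 : p ≤ 1) (h : HasCapMass d τ p)
    (hν : ν ≤ ENNReal.ofReal (Real.exp (12 * L * Z)) • sphereUniform d) :
    ∫⁻ v : sphere (0 : EuclideanSpace ℝ (Fin d)) 1,
      ENNReal.ofReal (|capMass ν τ (v : EuclideanSpace ℝ (Fin d)) - p| - p * δ)
        ∂(sphereUniform d) ≤ ENNReal.ofReal (20 * Real.exp (-(3 * L))) := by
  have hL0 : 0 < L := by linarith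
  have hb0 : 0 < b := pos_of_mul_pos_left (by linarith) hL0.le
  have ha0 : 0 < a := pos_of_mul_pos_left (by linarith) hL0.le
  have hZ0 : 0 < Z := by linarith
  have hp0 : 0 < p := lt_of_lt_of_le (by positivity) hp
  have hdpos : (0 : ℝ) < d := lt_of_lt_of_le (by positivity) hd
  have hd100 : 100 ≤ d := by
    have : (100 : ℝ) ≤ d := by
      refine le_trans ?_ hd
      calc (100 : ℝ) ≤ 10 ^ 16 * 1 := by norm_num
        _ ≤ (a * L) * L ^ 4 := by gcongr; exact one_le_pow₀ (by linarith)
        _ ≤ _ := by gcongr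
    exact_mod_cast this
  have hδ0 : 0 ≤ δ := by rw [hδ]; positivity
  by_cases hτ : |τ| * √d ≤ 30 * √L
  · rcases le_total (d : ℝ) (Real.exp (40 * L)) with h40 | h40
    · exact lintegral_capMass_excess_le_of_le hL haL hbL hZ hd h40 hδ hp hp1 h hτ hν
    · exact lintegral_capMass_excess_le_of_ge hL hZ hZL hd100 h40 hδ0 hp0.le hp1 h hτ hν
  have hsq : 900 * L ≤ d * τ ^ 2 := by
    have h1 := pow_le_pow_left₀ (by positivity) (not_le.1 hτ).le 2
    rw [mul_pow, mul_pow, Real.sq_sqrt hL0.le, Real.sq_sqrt hdpos.le, sq_abs] at h1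
    linarith
  have htail : Real.exp (-(d * τ ^ 2) / 8) ≤ Real.exp (-(4 * L)) :=
    Real.exp_le_exp.2 (by linarith)
  rcases le_total 0 τ with h0 | h0
  -- A large positive threshold gives caps of mass at most `4 exp (-4 L)`, less than the assumed
  -- lower bound on `p`.
  · exfalso
    have h1 := h.le_of_nonneg hd100 h0
    have h2 : 4 * Real.exp (-(4 * L)) < b * Real.exp (-L) := by
      have e1 : Real.exp (-(4 * L)) = Real.exp (-L) * Real.exp (-(3 * L)) := by
        rw [← Real.exp_add]; congr 1; ring
      have e2 : Real.exp (-(3 * L)) * L ≤ 1 := by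
        have h3 : Real.exp (-(3 * L)) ≤ Real.exp (-L) := Real.exp_le_exp.2 (by linarith)
        have h4 : L ≤ Real.exp L := by linarith [Real.add_one_le_exp L]
        calc Real.exp (-(3 * L)) * L ≤ Real.exp (-L) * Real.exp L := by gcongr
          _ = 1 := by rw [← Real.exp_add]; simp
      have e3 : 1000 * Real.exp (-(3 * L)) ≤ b := by
        calc 1000 * Real.exp (-(3 * L)) ≤ (b * L) * Real.exp (-(3 * L)) := by gcongr
          _ = (Real.exp (-(3 * L)) * L) * b := by ring
          _ ≤ 1 * b := by gcongr
          _ = b := one_mul b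
      have e4 := Real.exp_pos (-(3 * L))
      rw [e1, mul_comm b, ← mul_assoc, mul_comm 4, mul_assoc]
      exact mul_lt_mul_of_pos_left (by linarith) (Real.exp_pos _)
    linarith
  -- A large negative threshold makes the caps almost the whole sphere, and the crude bound by `2 (1
  -- - p)` suffices.
  · have h1 := h.one_sub_le_of_nonpos hd100 hp0.le h0
    refine (lintegral_mono fun v => ENNReal.ofReal_le_ofReal ?_).trans
      ((h.lintegral_abs_capMass_sub_le_compl (ν := ν) (by omega) hp0.le hp1).trans
        (ENNReal.ofReal_le_ofReal ?_))
    · have : 0 ≤ p * δ := by positivity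
      linarith
    · have h3 : Real.exp (-(4 * L)) ≤ Real.exp (-(3 * L)) := Real.exp_le_exp.2 (by linarith)
      linarith [Real.exp_pos (-(3 * L))]

end CapExcess

/-! ### Sequential coupling of a random bit string with independent coins. -/

section SequentialCoupling

theorem sum_fin_succ_bool {M : ℕ} (f : (Fin (M + 1) → Bool) → ℝ) :
    ∑ x, f x = ∑ x : Fin M → Bool, f (Fin.cons true x) + ∑ x : Fin M → Bool, f (Fin.cons false x) := by
  rw [← (Fin.consEquiv fun _ => Bool).sum_comp f, Fintype.sum_prod_type, Fintype.sum_bool]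
  rfl

theorem measureReal_eq_add_bool {Ω : Type*} [MeasurableSpace Ω] (μ : Measure Ω)
    [IsFiniteMeasure μ] {X : Ω → Bool} (hX : Measurable X) (s : Set Ω) :
    μ.real s = μ.real (s ∩ {ω | X ω = true}) + μ.real (s ∩ {ω | X ω = false}) := by
  have hm : MeasurableSet {ω | X ω = true} := hX (measurableSet_singleton true)
  have e : s ∩ {ω | X ω = false} = s \ {ω | X ω = true} := by
    ext ω
    simp only [Set.mem_inter_iff, Set.mem_ofPred_eq, Set.mem_sdiff, Bool.not_eq_true]
  rw [e, measureReal_inter_add_sdiff hm]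

open Classical in
/-- Sequential coupling of a random bit string with a Bernoulli string. If the `j`-th bit has
conditional probability `π j` given the preceding bits, in the averaged sense of `h`, the bit
string can be coupled with an i.i.d. Bernoulli(`q`) string so that the order between the two
fails with probability at most the expected excess of `q` over the `π j`, respectively of the
`π j` over `q`. -/
theorem exists_bernoulli_coupling {q : ℝ} (hq0 : 0 ≤ q) (hq1 : q ≤ 1) (M : ℕ) {Ω : Type*}
    [MeasurableSpace Ω] (μ : Measure Ω) [IsFiniteMeasure μ] (X : Fin M → Ω → Bool)
    (hX : ∀ j, Measurable (X j)) (π : Fin M → Ω → ℝ) (hπ : ∀ j, Measurable (π j))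
    (hπ0 : ∀ j ω, 0 ≤ π j ω) (hπ1 : ∀ j ω, π j ω ≤ 1)
    (h : ∀ j (y : Fin M → Bool), μ.real {ω | (∀ i < j, X i ω = y i) ∧ X j ω = true} =
      ∫ ω in {ω | ∀ i < j, X i ω = y i}, π j ω ∂μ) :
    ∃ K : (Fin M → Bool) → (Fin M → Bool) → ℝ, (∀ x z, 0 ≤ K x z) ∧
      (∀ x, ∑ z, K x z = μ.real {ω | ∀ j, X j ω = x j}) ∧
      (∀ z, ∑ x, K x z = μ.real Set.univ * ∏ j, (if z j then q else 1 - q)) ∧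
      (∑ x, ∑ z, K x z = μ.real Set.univ) ∧
      (∑ x, ∑ z, (if z ≤ x then 0 else K x z) ≤ ∑ j, ∫ ω, max 0 (q - π j ω) ∂μ) ∧
      (∑ x, ∑ z, (if x ≤ z then 0 else K x z) ≤ ∑ j, ∫ ω, max 0 (π j ω - q) ∂μ) := by
  induction M generalizing μ with
  | zero => exact ⟨fun _ _ => μ.real Set.univ, by simp⟩
  | succ M ih =>
    have hS : ∀ b, MeasurableSet {ω | X 0 ω = b} := fun b => hX 0 (measurableSet_singleton b)
    have hft : (false ≤ true) = True := by decide
    have htf : (true ≤ false) = False := by decide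
    -- The induction peels off the first bit and applies to `μ` restricted to each of its values.
    -- Working with finite rather than probability measures avoids renormalizing, also when one
    -- value has mass zero.
    have key : ∀ b, ∃ K : (Fin M → Bool) → (Fin M → Bool) → ℝ, (∀ x z, 0 ≤ K x z) ∧
        (∀ x, ∑ z, K x z = μ.real ({ω | ∀ j : Fin M, X j.succ ω = x j} ∩ {ω | X 0 ω = b})) ∧
        (∀ z, ∑ x, K x z = μ.real {ω | X 0 ω = b} * ∏ j, (if z j then q else 1 - q)) ∧
        (∑ x, ∑ z, K x z = μ.real {ω | X 0 ω = b}) ∧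
        (∑ x, ∑ z, (if z ≤ x then 0 else K x z) ≤
          ∑ j : Fin M, ∫ ω in {ω | X 0 ω = b}, max 0 (q - π j.succ ω) ∂μ) ∧
        (∑ x, ∑ z, (if x ≤ z then 0 else K x z) ≤
          ∑ j : Fin M, ∫ ω in {ω | X 0 ω = b}, max 0 (π j.succ ω - q) ∂μ) := by
      intro b
      obtain ⟨K, k0, k1, k2, k3, k4, k5⟩ := ih (μ.restrict {ω | X 0 ω = b}) (fun j => X j.succ)
        (fun j => hX _) (fun j => π j.succ) (fun j => hπ _) (fun j => hπ0 _) (fun j => hπ1 _)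
        (fun j y => by
          have hset : {ω | ∀ i < j, X i.succ ω = y i} ∩ {ω | X 0 ω = b} =
              {ω | ∀ i < j.succ, X i ω = (Fin.cons b y : Fin (M + 1) → Bool) i} := by
            ext ω
            simp only [Set.mem_inter_iff, Set.mem_ofPred_eq]
            constructor
            · rintro ⟨h1, h2⟩ i hi
              induction i using Fin.cases with
              | zero => simpa using h2
              | succ i => simpa using h1 i (Fin.succ_lt_succ_iff.1 hi)
            · intro h1
              exact ⟨fun i hi => by simpa using h1 i.succ (Fin.succ_lt_succ_iff.2 hi),
                by simpa using h1 0 (Fin.succ_pos j)⟩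
          have hset2 : {ω | (∀ i < j, X i.succ ω = y i) ∧ X j.succ ω = true} ∩ {ω | X 0 ω = b} =
              {ω | (∀ i < j.succ, X i ω = (Fin.cons b y : Fin (M + 1) → Bool) i) ∧
                X j.succ ω = true} := by
            have e1 : {ω | (∀ i < j, X i.succ ω = y i) ∧ X j.succ ω = true} ∩ {ω | X 0 ω = b} =
              ({ω | ∀ i < j, X i.succ ω = y i} ∩ {ω | X 0 ω = b}) ∩ {ω | X j.succ ω = true} := by
              ext ω; simp only [Set.mem_inter_iff, Set.mem_ofPred_eq]; tauto
            rw [e1, hset]; rfl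
          rw [measureReal_restrict_apply' (hS b), Measure.restrict_restrict' (hS b), hset, hset2]
          exact h j.succ (Fin.cons b y))
      refine ⟨K, k0, ?_, ?_, ?_, k4, k5⟩
      · intro x; rw [k1, measureReal_restrict_apply' (hS b)]
      · intro z; rw [k2, measureReal_restrict_apply' (hS b), Set.univ_inter]
      · rw [k3, measureReal_restrict_apply' (hS b), Set.univ_inter]
    choose K k0 k1 k2 k3 k4 k5 using key
    set W := μ.real Set.univ with hW
    set W1 := μ.real {ω | X 0 ω = true} with hW1
    set W0 := μ.real {ω | X 0 ω = false} with hW0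
    have hWadd : W = W1 + W0 := by
      rw [hW, measureReal_eq_add_bool μ (hX 0) Set.univ, Set.univ_inter, Set.univ_inter]
    have hW1n : 0 ≤ W1 := measureReal_nonneg
    have hW0n : 0 ≤ W0 := measureReal_nonneg
    have hWn : 0 ≤ W := measureReal_nonneg
    have hqW : q * W ≤ W := by nlinarith
    have hqW0 : 0 ≤ q * W := by positivity
    -- `r1` and `r0` are the chances of heads for the coin given that the first bit is `true` or
    -- `false`, in the monotone coupling of two Bernoulli variables. Division by zero does no harm,
    -- since only the products with `W1` and `W0` matter.
    set r1 := min (q * W) W1 / W1 with hr1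
    set r0 := max 0 (q * W - W1) / W0 with hr0
    have hr1m : r1 * W1 = min (q * W) W1 := by
      rcases hW1n.eq_or_lt with h0 | h0
      · rw [← h0, mul_zero, min_eq_right hqW0]
      · rw [hr1, div_mul_cancel₀ _ h0.ne']
    have hr0m : r0 * W0 = max 0 (q * W - W1) := by
      rcases hW0n.eq_or_lt with h0 | h0
      · rw [← h0, mul_zero, max_eq_left]; linarith
      · rw [hr0, div_mul_cancel₀ _ h0.ne']
    have hr1n : 0 ≤ r1 := div_nonneg (le_min hqW0 hW1n) hW1n
    have hr0n : 0 ≤ r0 := div_nonneg (le_max_left _ _) hW0n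
    have hr1l : r1 ≤ 1 := div_le_one_of_le₀ (min_le_right _ _) hW1n
    have hr0l : r0 ≤ 1 := div_le_one_of_le₀ (max_le hW0n (by linarith)) hW0n
    have hsum : r1 * W1 + r0 * W0 = q * W := by
      rw [hr1m, hr0m]
      rcases le_total (q * W) W1 with h0 | h0
      · rw [min_eq_left h0, max_eq_left (by linarith)]; ring
      · rw [min_eq_right h0, max_eq_right (by linarith)]; ring
    let κ : Bool → Bool → ℝ := fun b a =>
      match b, a with
      | true, true => r1
      | true, false => 1 - r1
      | false, true => r0
      | false, false => 1 - r0
    have hκ : ∀ b a, 0 ≤ κ b a := by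
      intro b a
      cases b <;> cases a <;> simp only [κ] <;> linarith
    have hint : ∀ (f : ℝ → ℝ), Continuous f → (∀ u ∈ Set.Icc (0 : ℝ) 1, |f u| ≤ 1) → ∀ j,
        Integrable (fun ω => f (π j ω)) μ := fun f hf hb j =>
      Integrable.of_bound (hf.measurable.comp (hπ j)).aestronglyMeasurable 1
        (Filter.Eventually.of_forall fun ω => hb _ ⟨hπ0 j ω, hπ1 j ω⟩)
    have hintπ : Integrable (π 0) μ := hint (fun u => u) continuous_id
      (fun u hu => by rw [abs_of_nonneg hu.1]; exact hu.2) 0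
    have hint1 : ∀ j, Integrable (fun ω => max 0 (q - π j ω)) μ :=
      hint (fun u => max 0 (q - u)) (by fun_prop) (fun u hu => by
        rw [abs_of_nonneg (le_max_left _ _)]; exact max_le zero_le_one (by linarith [hu.1]))
    have hint2 : ∀ j, Integrable (fun ω => max 0 (π j ω - q)) μ :=
      hint (fun u => max 0 (u - q)) (by fun_prop) (fun u hu => by
        rw [abs_of_nonneg (le_max_left _ _)]; exact max_le zero_le_one (by linarith [hu.2]))
    have hπint : W1 = ∫ ω, π 0 ω ∂μ := by
      have h0 := h 0 (fun _ => true)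
      simpa using h0
    -- The order fails at the first bit with the positive part of the averaged difference, which is
    -- at most the average of the positive part. Hence it is harmless that `π` carries more
    -- information than the earlier bits.
    have hfail1 : r0 * W0 ≤ ∫ ω, max 0 (q - π 0 ω) ∂μ := by
      rw [hr0m]
      refine max_le (integral_nonneg fun ω => le_max_left _ _) ?_
      have e : q * W - W1 = ∫ ω, (q - π 0 ω) ∂μ := by
        rw [integral_sub (integrable_const q) hintπ, ← hπint, integral_const, smul_eq_mul, mul_comm]
      rw [e]
      exact integral_mono ((integrable_const q).sub hintπ) (hint1 0) fun ω => le_max_right _ _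
    have hfail2 : (1 - r1) * W1 ≤ ∫ ω, max 0 (π 0 ω - q) ∂μ := by
      have e : (1 - r1) * W1 = max 0 (W1 - q * W) := by
        rw [sub_mul, hr1m, one_mul]
        rcases le_total (q * W) W1 with h0 | h0
        · rw [min_eq_left h0, max_eq_right (by linarith)]
        · rw [min_eq_right h0, max_eq_left (by linarith)]; ring
      rw [e]
      refine max_le (integral_nonneg fun ω => le_max_left _ _) ?_
      have e : W1 - q * W = ∫ ω, (π 0 ω - q) ∂μ := by
        rw [integral_sub hintπ (integrable_const q), ← hπint, integral_const, smul_eq_mul, mul_comm]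
      rw [e]
      exact integral_mono (hintπ.sub (integrable_const q)) (hint2 0) fun ω => le_max_right _ _
    have hsplit : ∀ f : Ω → ℝ, Integrable f μ →
        ∫ ω, f ω ∂μ = ∫ ω in {ω | X 0 ω = true}, f ω ∂μ + ∫ ω in {ω | X 0 ω = false}, f ω ∂μ := by
      intro f hf
      have e : {ω | X 0 ω = false} = {ω | X 0 ω = true}ᶜ := by
        ext ω; simp
      rw [e, integral_add_compl (hS true) hf]
    -- The rest of the coin string is coupled according to the first bit of `x` only, and its
    -- marginal is the same product law in both branches. This keeps the coins independent.
    refine ⟨fun x z => κ (x 0) (z 0) * K (x 0) (Fin.tail x) (Fin.tail z), ?_, ?_, ?_, ?_, ?_, ?_⟩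
    · exact fun x z => mul_nonneg (hκ _ _) (k0 _ _ _)
    · intro x
      rw [sum_fin_succ_bool]
      simp only [Fin.cons_zero, Fin.tail_cons, ← Finset.mul_sum]
      rw [← add_mul, k1]
      have : κ (x 0) true + κ (x 0) false = 1 := by cases x 0 <;> simp [κ]
      rw [this, one_mul]
      congr 1
      ext ω
      simp only [Set.mem_inter_iff, Set.mem_ofPred_eq, Fin.forall_fin_succ, Fin.tail]
      tauto
    · intro z
      rw [sum_fin_succ_bool]
      simp only [Fin.cons_zero, Fin.tail_cons, ← Finset.mul_sum]
      rw [k2, k2, Fin.prod_univ_succ]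
      have e : κ true (z 0) * W1 + κ false (z 0) * W0 = W * (if z 0 then q else 1 - q) := by
        cases z 0
        · simp only [κ, Bool.false_eq_true, if_false]; linarith
        · simp only [κ, if_true]; linarith
      rw [← hW1, ← hW0, ← mul_assoc, ← mul_assoc, ← add_mul, e, mul_assoc]
      rfl
    · simp only [sum_fin_succ_bool, Fin.cons_zero, Fin.tail_cons, ← Finset.mul_sum,
        Finset.sum_add_distrib, k3]
      simp only [κ, ← hW1, ← hW0]; linarith
    · simp only [sum_fin_succ_bool, Fin.cons_zero, Fin.tail_cons, Finset.sum_add_distrib,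
        Fin.cons_le_cons, le_refl, true_and, hft, htf, false_and, if_false]
      rw [Fin.sum_univ_succ]
      have hs : ∑ j : Fin M, ∫ ω, max 0 (q - π j.succ ω) ∂μ =
          ∑ j : Fin M, ∫ ω in {ω | X 0 ω = true}, max 0 (q - π j.succ ω) ∂μ +
          ∑ j : Fin M, ∫ ω in {ω | X 0 ω = false}, max 0 (q - π j.succ ω) ∂μ := by
        rw [← Finset.sum_add_distrib]
        exact Finset.sum_congr rfl fun j _ => hsplit _ (hint1 _)
      rw [hs]
      have hm : ∀ (c : ℝ) b, ∑ x, ∑ z, (if z ≤ x then 0 else c * K b x z) =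
          c * ∑ x, ∑ z, (if z ≤ x then 0 else K b x z) := fun c b => by
        simp only [Finset.mul_sum, mul_ite, mul_zero]
      rw [hm, hm, hm]
      simp only [← Finset.mul_sum, k3]
      have h1 := k4 true
      have h2 := k4 false
      have h3 : 0 ≤ ∑ x, ∑ z, (if z ≤ x then 0 else K false x z) :=
        Finset.sum_nonneg fun x _ => Finset.sum_nonneg fun z _ => by
          split_ifs
          · exact le_rfl
          · exact k0 _ _ _
      simp only [κ, ← hW0]
      nlinarith
    · simp only [sum_fin_succ_bool, Fin.cons_zero, Fin.tail_cons, Finset.sum_add_distrib,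
        Fin.cons_le_cons, le_refl, true_and, hft, htf, false_and, if_false]
      rw [Fin.sum_univ_succ]
      have hs : ∑ j : Fin M, ∫ ω, max 0 (π j.succ ω - q) ∂μ =
          ∑ j : Fin M, ∫ ω in {ω | X 0 ω = true}, max 0 (π j.succ ω - q) ∂μ +
          ∑ j : Fin M, ∫ ω in {ω | X 0 ω = false}, max 0 (π j.succ ω - q) ∂μ := by
        rw [← Finset.sum_add_distrib]
        exact Finset.sum_congr rfl fun j _ => hsplit _ (hint2 _)
      rw [hs]
      have hm : ∀ (c : ℝ) b, ∑ x, ∑ z, (if x ≤ z then 0 else c * K b x z) =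
          c * ∑ x, ∑ z, (if x ≤ z then 0 else K b x z) := fun c b => by
        simp only [Finset.mul_sum, mul_ite, mul_zero]
      rw [hm, hm, hm]
      simp only [← Finset.mul_sum, k3]
      have h1 := k5 true
      have h2 := k5 false
      have h3 : 0 ≤ ∑ x, ∑ z, (if x ≤ z then 0 else K true x z) :=
        Finset.sum_nonneg fun x _ => Finset.sum_nonneg fun z _ => by
          split_ifs
          · exact le_rfl
          · exact k0 _ _ _
      simp only [κ, ← hW1]
      nlinarith

end SequentialCoupling

/-! ### Gluing two couplings along their common marginal. -/

section TripleCoupling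

open Classical in
/-- Gluing two couplings along a common marginal on a finite type. -/
theorem exists_tripleCoupling_of_kernels {α : Type*} [Fintype α] [MeasurableSpace α]
    [MeasurableSingletonClass α] [LE α] {μ₁ μ₂ μ₃ : Measure α} [IsProbabilityMeasure μ₁]
    [IsProbabilityMeasure μ₂] [IsProbabilityMeasure μ₃] {k₁ k₃ : α → α → ℝ}
    (h₁0 : ∀ x z, 0 ≤ k₁ x z) (h₃0 : ∀ x z, 0 ≤ k₃ x z)
    (h₁r : ∀ x, ∑ z, k₁ x z = μ₂.real {x}) (h₃r : ∀ x, ∑ z, k₃ x z = μ₂.real {x})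
    (h₁c : ∀ z, ∑ x, k₁ x z = μ₁.real {z}) (h₃c : ∀ z, ∑ x, k₃ x z = μ₃.real {z}) {ε₁ ε₃ : ℝ}
    (h₁f : ∑ x, ∑ z, (if z ≤ x then 0 else k₁ x z) ≤ ε₁)
    (h₃f : ∑ x, ∑ z, (if x ≤ z then 0 else k₃ x z) ≤ ε₃) :
    ∃ γ : Measure (α × α × α), IsTripleCoupling μ₁ μ₂ μ₃ γ ∧
      ENNReal.ofReal (1 - (ε₁ + ε₃)) ≤ γ {x | x.1 ≤ x.2.1 ∧ x.2.1 ≤ x.2.2} := by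
  set P : α → ℝ := fun x => μ₂.real {x} with hP
  have hP0 : ∀ x, 0 ≤ P x := fun x => measureReal_nonneg
  -- The outer components are taken conditionally independent given the middle one. Where `P`
  -- vanishes the corresponding rows of both kernels vanish too, so the value `0` of the quotient is
  -- correct.
  set w : α × α × α → ℝ := fun t => k₁ t.2.1 t.1 * k₃ t.2.1 t.2.2 / P t.2.1 with hw
  have hw0 : ∀ t, 0 ≤ w t := fun t => div_nonneg (mul_nonneg (h₁0 _ _) (h₃0 _ _)) (hP0 _)
  set γ : Measure (α × α × α) := ∑ t, ENNReal.ofReal (w t) • Measure.dirac t with hγ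
  have hγA : ∀ A : Set (α × α × α), γ A =
      ENNReal.ofReal (∑ x, ∑ z, ∑ z', if (z, x, z') ∈ A then w (z, x, z') else 0) := by
    intro A
    have e : (∑ x, ∑ z, ∑ z', if (z, x, z') ∈ A then w (z, x, z') else 0) =
        ∑ t : α × α × α, if t ∈ A then w t else 0 := by
      simp only [Fintype.sum_prod_type]
      rw [Finset.sum_comm]
    rw [e, ENNReal.ofReal_sum_of_nonneg (fun t _ => by split_ifs; exacts [hw0 t, le_rfl]), hγ,
      Measure.finsetSum_apply]
    refine Finset.sum_congr rfl fun t _ => ?_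
    rw [Measure.smul_apply, Measure.dirac_apply' _ (Set.toFinite A).measurableSet]
    by_cases ht : t ∈ A <;> simp [ht]
  have hk₁0 : ∀ x z, P x = 0 → k₁ x z = 0 := fun x z hx => by
    have h := h₁r x
    rw [show μ₂.real {x} = 0 from hx, Finset.sum_eq_zero_iff_of_nonneg fun z _ => h₁0 x z] at h
    exact h z (Finset.mem_univ z)
  have hk₃0 : ∀ x z, P x = 0 → k₃ x z = 0 := fun x z hx => by
    have h := h₃r x
    rw [show μ₂.real {x} = 0 from hx, Finset.sum_eq_zero_iff_of_nonneg fun z _ => h₃0 x z] at h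
    exact h z (Finset.mem_univ z)
  have hs₁ : ∀ x z, ∑ z', w (z, x, z') = k₁ x z := fun x z => by
    simp only [hw]
    rw [← Finset.sum_div, ← Finset.mul_sum, h₃r]
    by_cases hx : P x = 0
    · rw [hk₁0 x z hx]; simp
    · exact mul_div_cancel_right₀ _ hx
  have hs₃ : ∀ x z', ∑ z, w (z, x, z') = k₃ x z' := fun x z' => by
    simp only [hw]
    rw [← Finset.sum_div, ← Finset.sum_mul, h₁r, mul_comm]
    by_cases hx : P x = 0
    · rw [hk₃0 x z' hx]; simp
    · exact mul_div_cancel_right₀ _ hx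
  have htot : ∑ x, P x = 1 := by
    have : ∑ x, μ₂.real {x} = μ₂.real Set.univ := by
      rw [← Finset.coe_univ, sum_measureReal_singleton]
    rw [hP, this, probReal_univ]
  refine ⟨γ, ⟨?_, ?_, ?_⟩, ?_⟩
  · refine Measure.ext_of_singleton fun a => ?_
    rw [Measure.map_apply (measurable_of_finite _) (measurableSet_singleton a), hγA,
      ← ofReal_measureReal, ← h₁c]
    congr 1
    refine Finset.sum_congr rfl fun x _ => ?_
    rw [Finset.sum_eq_single a]
    · simp [hs₁]
    · intro b _ hb; simp [hb]
    · simp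
  · refine Measure.ext_of_singleton fun a => ?_
    rw [Measure.map_apply (measurable_of_finite _) (measurableSet_singleton a), hγA,
      ← ofReal_measureReal, ← h₁r]
    congr 1
    rw [Finset.sum_eq_single a]
    · simp [hs₁]
    · intro b _ hb; simp [hb]
    · simp
  · refine Measure.ext_of_singleton fun a => ?_
    rw [Measure.map_apply (measurable_of_finite _) (measurableSet_singleton a), hγA,
      ← ofReal_measureReal, ← h₃c]
    congr 1
    refine Finset.sum_congr rfl fun x _ => ?_
    rw [Finset.sum_comm, Finset.sum_eq_single a]
    · simp [hs₃]
    · intro b _ hb; simp [hb]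
    · simp
  · set B : Set (α × α × α) := {t | t.1 ≤ t.2.1 ∧ t.2.1 ≤ t.2.2} with hB
    rw [hγA]
    apply ENNReal.ofReal_le_ofReal
    have e1 : ∑ x, ∑ z, ∑ z', w (z, x, z') = 1 := by
      simp only [hs₁, h₁r]; exact htot
    have e2 : ∑ x, ∑ z, ∑ z', (if z ≤ x then 0 else w (z, x, z')) ≤ ε₁ := by
      refine le_trans (le_of_eq ?_) h₁f
      refine Finset.sum_congr rfl fun x _ => Finset.sum_congr rfl fun z _ => ?_
      split_ifs
      · simp
      · exact hs₁ x z
    have e3 : ∑ x, ∑ z, ∑ z', (if x ≤ z' then 0 else w (z, x, z')) ≤ ε₃ := by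
      refine le_trans (le_of_eq ?_) h₃f
      refine Finset.sum_congr rfl fun x _ => ?_
      rw [Finset.sum_comm]
      refine Finset.sum_congr rfl fun z _ => ?_
      split_ifs
      · simp
      · exact hs₃ x z
    have e4 : ∑ x, ∑ z, ∑ z', w (z, x, z') ≤ (∑ x, ∑ z, ∑ z',
        if (z, x, z') ∈ B then w (z, x, z') else 0) +
        (∑ x, ∑ z, ∑ z', (if z ≤ x then 0 else w (z, x, z')) +
          ∑ x, ∑ z, ∑ z', (if x ≤ z' then 0 else w (z, x, z'))) := by
      simp only [← Finset.sum_add_distrib]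
      refine Finset.sum_le_sum fun x _ => Finset.sum_le_sum fun z _ =>
        Finset.sum_le_sum fun z' _ => ?_
      have := hw0 (z, x, z')
      have hmem : (z, x, z') ∈ B ↔ z ≤ x ∧ x ≤ z' := Iff.rfl
      by_cases c1 : z ≤ x <;> by_cases c2 : x ≤ z' <;> simp [hmem, c1, c2, this]
    have e5 : 1 - (ε₁ + ε₃) ≤ ∑ x, ∑ z, ∑ z', if (z, x, z') ∈ B then w (z, x, z') else 0 := by
      linarith
    convert e5

end TripleCoupling

/-! ### Graphs as bit strings over the lexicographically ordered potential edges. -/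

section EdgeBits

/-- Potential edges of a graph on `Fin n`, the larger endpoint first, ordered lexicographically. -/
abbrev LexEdge (n : ℕ) : Type := {e : Fin n ×ₗ Fin n // (ofLex e).2 < (ofLex e).1}

namespace LexEdge

variable {n : ℕ}

/-- The larger endpoint. -/
def hi (e : LexEdge n) : Fin n := (ofLex e.1).1

/-- The smaller endpoint. -/
def lo (e : LexEdge n) : Fin n := (ofLex e.1).2

theorem lo_lt_hi (e : LexEdge n) : e.lo < e.hi := e.2

/-- The edge with given endpoints. -/
def mk (a b : Fin n) (h : b < a) : LexEdge n := ⟨toLex (a, b), h⟩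

theorem lt_iff (e f : LexEdge n) : e < f ↔ e.hi < f.hi ∨ e.hi = f.hi ∧ e.lo < f.lo :=
  Prod.Lex.lt_iff

theorem ext_iff' {e f : LexEdge n} : e = f ↔ e.hi = f.hi ∧ e.lo = f.lo := by
  constructor
  · rintro rfl; exact ⟨rfl, rfl⟩
  · rintro ⟨h1, h2⟩
    apply Subtype.ext
    apply ofLex.injective
    exact Prod.ext h1 h2

noncomputable instance : Fintype (LexEdge n) :=
  have : Finite (Fin n ×ₗ Fin n) := inferInstanceAs (Finite (Fin n × Fin n))
  Fintype.ofFinite _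

theorem card_le : Fintype.card (LexEdge n) ≤ n ^ 2 := by
  have : Fintype.card (LexEdge n) ≤ Fintype.card (Fin n × Fin n) :=
    Fintype.card_le_of_injective (fun e : LexEdge n => (e.hi, e.lo)) fun e f h =>
      ext_iff'.2 (Prod.ext_iff.1 h)
  simpa [sq] using this

/-- The increasing enumeration of the potential edges. -/
noncomputable def enum (n : ℕ) : Fin (Fintype.card (LexEdge n)) ≃o LexEdge n :=
  Fintype.orderIsoFinOfCardEq _ rfl

end LexEdge

open Classical in
/-- The adjacency bits of a graph. -/
noncomputable def edgeBits {n : ℕ} (G : SimpleGraph (Fin n))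
    (j : Fin (Fintype.card (LexEdge n))) : Bool :=
  decide (G.Adj (LexEdge.enum n j).hi (LexEdge.enum n j).lo)

variable {n : ℕ}

theorem edgeBits_eq_true {G : SimpleGraph (Fin n)} {j : Fin (Fintype.card (LexEdge n))} :
    edgeBits G j = true ↔ G.Adj (LexEdge.enum n j).hi (LexEdge.enum n j).lo := by
  simp [edgeBits]

theorem edgeBits_le_iff {G H : SimpleGraph (Fin n)} : edgeBits G ≤ edgeBits H ↔ G ≤ H := by
  constructor
  · intro h
    have key : ∀ a b : Fin n, b < a → G.Adj a b → H.Adj a b := by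
      intro a b hab hG
      have h1 := h ((LexEdge.enum n).symm (LexEdge.mk a b hab))
      have h2 : edgeBits G ((LexEdge.enum n).symm (LexEdge.mk a b hab)) = true := by
        rw [edgeBits_eq_true, OrderIso.apply_symm_apply]; exact hG
      rw [h2] at h1
      have h3 := Bool.eq_true_of_true_le h1
      rw [edgeBits_eq_true, OrderIso.apply_symm_apply] at h3
      exact h3
    intro a b hG
    rcases lt_trichotomy a b with hab | hab | hab
    · exact (key b a hab hG.symm).symm
    · exact absurd hab hG.ne
    · exact key a b hab hG
  · intro h j
    by_cases hG : edgeBits G j = true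
    · have := edgeBits_eq_true.2 (h (edgeBits_eq_true.1 hG))
      rw [hG, this]
    · rw [Bool.not_eq_true] at hG
      rw [hG]; exact Bool.false_le _

theorem edgeBits_bijective : Function.Bijective (edgeBits (n := n)) := by
  constructor
  · intro G H h
    exact le_antisymm (edgeBits_le_iff.1 h.le) (edgeBits_le_iff.1 h.ge)
  · intro x
    refine ⟨SimpleGraph.fromRel fun a b => ∃ h : b < a,
      x ((LexEdge.enum n).symm (LexEdge.mk a b h)) = true, ?_⟩
    funext j
    rw [Bool.eq_iff_iff, edgeBits_eq_true, SimpleGraph.fromRel_adj]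
    have hlt := (LexEdge.enum n j).lo_lt_hi
    have hmk : LexEdge.mk (LexEdge.enum n j).hi (LexEdge.enum n j).lo hlt = LexEdge.enum n j := rfl
    constructor
    · rintro ⟨-, ⟨h1, h2⟩ | ⟨h1, -⟩⟩
      · rwa [hmk, OrderIso.symm_apply_apply] at h2
      · exact absurd h1 hlt.asymm
    · intro h
      refine ⟨hlt.ne', Or.inl ⟨hlt, ?_⟩⟩
      rwa [hmk, OrderIso.symm_apply_apply]

theorem ncard_edgeSet_eq (G : SimpleGraph (Fin n)) :
    G.edgeSet.ncard = (Finset.univ.filter fun j => edgeBits G j = true).card := by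
  have hinj : Function.Injective fun j : Fin (Fintype.card (LexEdge n)) =>
      s((LexEdge.enum n j).hi, (LexEdge.enum n j).lo) := by
    intro i j h
    rw [Sym2.eq_iff] at h
    rcases h with h | ⟨h1, h2⟩
    · exact (LexEdge.enum n).injective (LexEdge.ext_iff'.2 h)
    · exfalso
      have hi := (LexEdge.enum n i).lo_lt_hi
      have hj := (LexEdge.enum n j).lo_lt_hi
      rw [h1, h2] at hi
      exact hi.asymm hj
  have himg : G.edgeSet = (fun j : Fin (Fintype.card (LexEdge n)) =>
      s((LexEdge.enum n j).hi, (LexEdge.enum n j).lo)) '' {j | edgeBits G j = true} := by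
    ext e
    induction e using Sym2.ind with
    | _ a b =>
      rw [SimpleGraph.mem_edgeSet]
      constructor
      · intro hG
        rcases lt_trichotomy a b with hab | hab | hab
        · refine ⟨(LexEdge.enum n).symm (LexEdge.mk b a hab), ?_, ?_⟩
          · change edgeBits G _ = true
            rw [edgeBits_eq_true, OrderIso.apply_symm_apply]; exact hG.symm
          · simp only [OrderIso.apply_symm_apply]; exact Sym2.eq_swap
        · exact absurd hab hG.ne
        · refine ⟨(LexEdge.enum n).symm (LexEdge.mk a b hab), ?_, ?_⟩
          · change edgeBits G _ = true
            rw [edgeBits_eq_true, OrderIso.apply_symm_apply]; exact hG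
          · simp only [OrderIso.apply_symm_apply]; rfl
      · rintro ⟨j, hj, he⟩
        have h1 := edgeBits_eq_true.1 hj
        rw [← SimpleGraph.mem_edgeSet] at h1 ⊢
        rwa [show s((LexEdge.enum n j).hi, (LexEdge.enum n j).lo) = s(a, b) from he] at h1
  rw [himg, Set.ncard_image_of_injective _ hinj, ← Set.ncard_coe_finset]
  congr 1
  ext j; simp

/-- Read off from the complete graph, all of whose bits are `true`. -/
theorem card_lexEdge : Fintype.card (LexEdge n) = n.choose 2 := by
  classical
  have h := ncard_edgeSet_eq (⊤ : SimpleGraph (Fin n))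
  rw [Finset.filter_true_of_mem (fun j _ => edgeBits_eq_true.2
    (by rw [SimpleGraph.top_adj]; exact (LexEdge.enum n j).lo_lt_hi.ne')), Finset.card_univ,
    Fintype.card_fin, ← SimpleGraph.coe_edgeFinset, Set.ncard_coe_finset,
    SimpleGraph.card_edgeFinset_top_eq_card_choose_two, Fintype.card_fin] at h
  exact h.symm

theorem binomialRandom_real_singleton (q : unitInterval) (G : SimpleGraph (Fin n)) :
    (SimpleGraph.binomialRandom (Fin n) q).real {G} =
      ∏ j, (if edgeBits G j then (q : ℝ) else 1 - q) := by
  rw [measureReal_def, SimpleGraph.binomialRandom_singleton, Finset.prod_ite, Finset.prod_const,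
    Finset.prod_const, ncard_edgeSet_eq, Nat.card_fin, ← card_lexEdge]
  have hc : (Finset.univ.filter fun j => ¬ edgeBits G j = true).card =
      Fintype.card (LexEdge n) - (Finset.univ.filter fun j => edgeBits G j = true).card := by
    have h := Finset.card_filter_add_card_filter_not (s := Finset.univ)
      (fun j => edgeBits G j = true)
    rw [Finset.card_univ, Fintype.card_fin] at h
    omega
  rw [hc, ENNReal.toReal_mul, ENNReal.toReal_pow, ENNReal.toReal_pow]
  simp

end EdgeBits

/-! ### Transfer of the bit coupling to random graphs. -/

section GraphCoupling

variable {n : ℕ}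

/-- Sandwiching a random graph between two binomial random graphs, by exposing edges in
lexicographic order. -/
theorem exists_binomialRandom_sandwich {Ω : Type*} [MeasurableSpace Ω] (μ : Measure Ω)
    [IsProbabilityMeasure μ] {G : Ω → SimpleGraph (Fin n)} (hG : Measurable G)
    (π : LexEdge n → Ω → ℝ) (hπ : ∀ e, Measurable (π e)) (hπ0 : ∀ e ω, 0 ≤ π e ω)
    (hπ1 : ∀ e ω, π e ω ≤ 1)
    (h : ∀ e (y : LexEdge n → Prop), μ.real {ω | (∀ f < e, ((G ω).Adj f.hi f.lo ↔ y f)) ∧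
      (G ω).Adj e.hi e.lo} = ∫ ω in {ω | ∀ f < e, ((G ω).Adj f.hi f.lo ↔ y f)}, π e ω ∂μ)
    (q₁ q₃ : unitInterval) :
    ∃ γ : Measure (SimpleGraph (Fin n) × SimpleGraph (Fin n) × SimpleGraph (Fin n)),
      IsTripleCoupling (SimpleGraph.binomialRandom (Fin n) q₁) (μ.map G)
        (SimpleGraph.binomialRandom (Fin n) q₃) γ ∧
      ENNReal.ofReal (1 - (∑ e, ∫ ω, max 0 ((q₁ : ℝ) - π e ω) ∂μ +
        ∑ e, ∫ ω, max 0 (π e ω - (q₃ : ℝ)) ∂μ)) ≤ γ {x | x.1 ≤ x.2.1 ∧ x.2.1 ≤ x.2.2} := by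
  classical
  have : MeasurableSingletonClass (SimpleGraph (Fin n)) :=
    ⟨fun G => by
      have := (SimpleGraph.measurableEmbedding_edgeSet (V := Fin n)).measurable
        (measurableSet_singleton G.edgeSet)
      convert this
      ext H
      exact SimpleGraph.edgeSet_inj.symm⟩
  have : Fintype (SimpleGraph (Fin n)) := Fintype.ofFinite _
  have : IsProbabilityMeasure (μ.map G) := Measure.isProbabilityMeasure_map hG.aemeasurable
  set X : Fin (Fintype.card (LexEdge n)) → Ω → Bool := fun j ω => edgeBits (G ω) j with hX
  have hXm : ∀ j, Measurable (X j) := fun j =>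
    (measurable_of_finite fun H : SimpleGraph (Fin n) => edgeBits H j).comp hG
  have hbit : ∀ (H : SimpleGraph (Fin n)) (j : Fin (Fintype.card (LexEdge n))) (b : Bool),
      edgeBits H j = b ↔
      (H.Adj (LexEdge.enum n j).hi (LexEdge.enum n j).lo ↔ b = true) := fun H j b => by
    rw [Bool.eq_iff_iff, edgeBits_eq_true]
  have hpre : ∀ (j : Fin (Fintype.card (LexEdge n)))
      (y : Fin (Fintype.card (LexEdge n)) → Bool) (ω : Ω),
      (∀ i < j, X i ω = y i) ↔ ∀ f < LexEdge.enum n j,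
        ((G ω).Adj f.hi f.lo ↔ y ((LexEdge.enum n).symm f) = true) := fun j y ω => by
    constructor
    · intro h1 f hf
      have := (hbit _ _ _).1 (h1 ((LexEdge.enum n).symm f)
        ((OrderIso.symm_apply_lt _).2 hf))
      rwa [OrderIso.apply_symm_apply] at this
    · intro h1 i hi
      refine (hbit _ _ _).2 ?_
      have := h1 (LexEdge.enum n i) ((LexEdge.enum n).lt_iff_lt.2 hi)
      rwa [OrderIso.symm_apply_apply] at this
  have hcond : ∀ j (y : Fin (Fintype.card (LexEdge n)) → Bool),
      μ.real {ω | (∀ i < j, X i ω = y i) ∧ X j ω = true} =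
        ∫ ω in {ω | ∀ i < j, X i ω = y i}, π (LexEdge.enum n j) ω ∂μ := fun j y => by
    simp only [hpre]
    simp only [hX, edgeBits_eq_true]
    exact h (LexEdge.enum n j) fun f => y ((LexEdge.enum n).symm f) = true
  -- The sequential coupling is used twice, once per parameter and each time for one direction of
  -- the order; the row sums of both kernels are the law of the same graph.
  obtain ⟨K₁, a0, a1, a2, -, a4, -⟩ := exists_bernoulli_coupling q₁.2.1 q₁.2.2 _ μ X hXm
    (fun j => π (LexEdge.enum n j)) (fun j => hπ _) (fun j => hπ0 _) (fun j => hπ1 _) hcond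
  obtain ⟨K₃, b0, b1, b2, -, -, b5⟩ := exists_bernoulli_coupling q₃.2.1 q₃.2.2 _ μ X hXm
    (fun j => π (LexEdge.enum n j)) (fun j => hπ _) (fun j => hπ0 _) (fun j => hπ1 _) hcond
  let E := Equiv.ofBijective (edgeBits (n := n)) edgeBits_bijective
  have hE : ∀ H, edgeBits H = E H := fun H => rfl
  have hlaw : ∀ H, μ.real {ω | ∀ j, X j ω = edgeBits H j} = (μ.map G).real {H} := fun H => by
    rw [map_measureReal_apply hG (measurableSet_singleton H)]
    congr 1
    ext ω
    rw [Set.mem_preimage, Set.mem_singleton_iff, ← edgeBits_bijective.1.eq_iff, funext_iff]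
    rfl
  refine exists_tripleCoupling_of_kernels (k₁ := fun x z => K₁ (edgeBits x) (edgeBits z))
    (k₃ := fun x z => K₃ (edgeBits x) (edgeBits z)) (fun _ _ => a0 _ _) (fun _ _ => b0 _ _)
    ?_ ?_ ?_ ?_ ?_ ?_
  · intro x
    rw [← hlaw, ← a1]
    exact E.sum_comp fun z => K₁ (edgeBits x) z
  · intro x
    rw [← hlaw, ← b1]
    exact E.sum_comp fun z => K₃ (edgeBits x) z
  · intro z
    have hz := a2 (edgeBits z)
    rw [probReal_univ, one_mul] at hz
    rw [binomialRandom_real_singleton, ← hz]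
    exact E.sum_comp fun x => K₁ x (edgeBits z)
  · intro z
    have hz := b2 (edgeBits z)
    rw [probReal_univ, one_mul] at hz
    rw [binomialRandom_real_singleton, ← hz]
    exact E.sum_comp fun x => K₃ x (edgeBits z)
  · refine le_trans (le_of_eq ?_) (a4.trans (le_of_eq ?_))
    · rw [← E.sum_comp]
      refine Finset.sum_congr rfl fun x _ => ?_
      rw [← E.sum_comp]
      refine Finset.sum_congr rfl fun z _ => ?_
      rw [← hE, ← hE]
      simp only [edgeBits_le_iff]
    · exact (LexEdge.enum n).toEquiv.sum_comp fun e => ∫ ω, max 0 ((q₁ : ℝ) - π e ω) ∂μ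
  · refine le_trans (le_of_eq ?_) (b5.trans (le_of_eq ?_))
    · rw [← E.sum_comp]
      refine Finset.sum_congr rfl fun x _ => ?_
      rw [← E.sum_comp]
      refine Finset.sum_congr rfl fun z _ => ?_
      rw [← hE, ← hE]
      simp only [edgeBits_le_iff]
    · exact (LexEdge.enum n).toEquiv.sum_comp fun e => ∫ ω, max 0 (π e ω - (q₃ : ℝ)) ∂μ

end GraphCoupling

/-! ### Comparing product integrals by resampling one coordinate. -/

section PiUpdate

open scoped ENNReal

variable {ι S : Type*} [Fintype ι] [DecidableEq ι] [MeasurableSpace S] {σ : Measure S}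
  [SigmaFinite σ]

/-- Fubini in a form that freezes all coordinates but one: it is how one vector is treated as fresh
while the others are held fixed. -/
theorem lintegral_pi_eq_of_update (k : ι) {f g : (ι → S) → ℝ≥0∞} (hf : Measurable f)
    (hg : Measurable g) (h : ∀ v, ∫⁻ z, f (Function.update v k z) ∂σ =
      ∫⁻ z, g (Function.update v k z) ∂σ) :
    ∫⁻ v, f v ∂(Measure.pi fun _ => σ) = ∫⁻ v, g v ∂(Measure.pi fun _ => σ) := by
  refine lintegral_eq_of_lmarginal_eq {k} hf hg ?_
  rw [lmarginal_singleton, lmarginal_singleton]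
  exact funext h

theorem lintegral_pi_le_of_update (k : ι) {f g : (ι → S) → ℝ≥0∞} (hf : Measurable f)
    (hg : Measurable g) (h : ∀ v, ∫⁻ z, f (Function.update v k z) ∂σ ≤
      ∫⁻ z, g (Function.update v k z) ∂σ) :
    ∫⁻ v, f v ∂(Measure.pi fun _ => σ) ≤ ∫⁻ v, g v ∂(Measure.pi fun _ => σ) := by
  refine lintegral_le_of_lmarginal_le {k} hf hg ?_
  rw [lmarginal_singleton, lmarginal_singleton]
  exact h

end PiUpdate

/-! ### Cells and conditional edge probabilities. -/

section EdgeProbability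

open ProbabilityTheory Metric
open scoped ENNReal RealInnerProductSpace

variable {n d : ℕ}

/-- The unit sphere of `ℝ^d`. -/
abbrev UnitSphere (d : ℕ) : Type := sphere (0 : EuclideanSpace ℝ (Fin d)) 1

/-- The cap of height `τ` around `u`. -/
def sphereCap (τ : ℝ) (u : UnitSphere d) : Set (UnitSphere d) :=
  {y | τ ≤ ⟪(y : EuclideanSpace ℝ (Fin d)), (u : EuclideanSpace ℝ (Fin d))⟫}

theorem measurableSet_sphereCap (τ : ℝ) (u : UnitSphere d) : MeasurableSet (sphereCap τ u) :=
  measurableSet_le measurable_const (by fun_prop)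

theorem mem_sphereCap_comm {τ : ℝ} {u y : UnitSphere d} :
    y ∈ sphereCap τ u ↔ u ∈ sphereCap τ y := by
  change τ ≤ ⟪(y : EuclideanSpace ℝ (Fin d)), (u : EuclideanSpace ℝ (Fin d))⟫ ↔
    τ ≤ ⟪(u : EuclideanSpace ℝ (Fin d)), (y : EuclideanSpace ℝ (Fin d))⟫
  rw [real_inner_comm]

theorem Measurable.mem_sphereCap {Ω : Type*} [MeasurableSpace Ω] {f g : Ω → UnitSphere d}
    (hf : Measurable f) (hg : Measurable g) (τ : ℝ) :
    Measurable fun ω => f ω ∈ sphereCap τ (g ω) := by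
  refine measurableSet_setOfPred.1 ?_
  exact measurableSet_le measurable_const
    ((measurable_subtype_coe.comp hf).inner (𝕜 := ℝ) (measurable_subtype_coe.comp hg))

theorem sphericalGraph_adj_iff {τ : ℝ} {v : Fin n → UnitSphere d} (e : LexEdge n) :
    (sphericalGraph τ v).Adj e.hi e.lo ↔ v e.hi ∈ sphereCap τ (v e.lo) :=
  and_iff_right e.lo_lt_hi.ne'

/-- The points with prescribed adjacency `c` to the vectors `v a`, `a < i`. -/
def capCell (τ : ℝ) (v : Fin n → UnitSphere d) (i : Fin n) (c : Fin n → Prop) :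
    Set (UnitSphere d) :=
  {y | ∀ a < i, (y ∈ sphereCap τ (v a) ↔ c a)}

theorem measurableSet_capCell (τ : ℝ) (v : Fin n → UnitSphere d) (i : Fin n) (c : Fin n → Prop) :
    MeasurableSet (capCell τ v i c) :=
  measurableSet_setOfPred.2 <| Measurable.forall fun _ => Measurable.forall fun _ =>
    (measurable_id.mem_sphereCap measurable_const τ).iff measurable_const

theorem capCell_congr {τ : ℝ} {v w : Fin n → UnitSphere d} {i : Fin n} {c c' : Fin n → Prop}
    (h : ∀ a < i, v a = w a) (hc : ∀ a < i, (c a ↔ c' a)) :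
    capCell τ v i c = capCell τ w i c' := by
  ext y
  change (∀ a < i, _) ↔ (∀ a < i, _)
  refine forall_congr' fun a => forall_congr' fun ha => ?_
  rw [h a ha, hc a ha]

/-- The points adjacent to the same vectors `v a`, `a < e.lo`, as `v e.hi`. -/
def edgeCell (τ : ℝ) (e : LexEdge n) (v : Fin n → UnitSphere d) : Set (UnitSphere d) :=
  capCell τ v e.lo fun a => v e.hi ∈ sphereCap τ (v a)

theorem measurableSet_edgeCell (τ : ℝ) (e : LexEdge n) (v : Fin n → UnitSphere d) :
    MeasurableSet (edgeCell τ e v) := measurableSet_capCell _ _ _ _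

/-- The conditional probability of the edge `e` given the vectors other than `v e.hi` and the
adjacency of `v e.hi` to the vectors `v a`, `a < e.lo`. -/
noncomputable def edgeProb (τ : ℝ) (e : LexEdge n) (v : Fin n → UnitSphere d) : ℝ :=
  (sphereUniform d).real (edgeCell τ e v ∩ sphereCap τ (v e.lo)) /
    (sphereUniform d).real (edgeCell τ e v)

variable {τ : ℝ}

theorem edgeProb_nonneg (e : LexEdge n) (v : Fin n → UnitSphere d) : 0 ≤ edgeProb τ e v :=
  div_nonneg measureReal_nonneg measureReal_nonneg

theorem edgeProb_le_one (hd : d ≠ 0) (e : LexEdge n) (v : Fin n → UnitSphere d) :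
    edgeProb τ e v ≤ 1 := by
  have := isProbabilityMeasure_sphereUniform hd
  exact div_le_one_of_le₀ (measureReal_mono Set.inter_subset_left) measureReal_nonneg

theorem measurable_sphereUniform_edgeCell (hd : d ≠ 0) (e : LexEdge n) :
    Measurable fun v : Fin n → UnitSphere d => sphereUniform d (edgeCell τ e v) := by
  have := isProbabilityMeasure_sphereUniform hd
  have hs : MeasurableSet {q : (Fin n → UnitSphere d) × UnitSphere d |
      ∀ a < e.lo, (q.2 ∈ sphereCap τ (q.1 a) ↔ q.1 e.hi ∈ sphereCap τ (q.1 a))} :=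
    measurableSet_setOfPred.2 <| Measurable.forall fun a => Measurable.forall fun _ =>
      Measurable.iff (Measurable.mem_sphereCap (by fun_prop) (by fun_prop) τ)
        (Measurable.mem_sphereCap (by fun_prop) (by fun_prop) τ)
  exact measurable_measure_prodMk_left hs

theorem measurable_edgeProb (hd : d ≠ 0) (e : LexEdge n) :
    Measurable fun v : Fin n → UnitSphere d => edgeProb τ e v := by
  have := isProbabilityMeasure_sphereUniform hd
  have hs : MeasurableSet {q : (Fin n → UnitSphere d) × UnitSphere d |
      (∀ a < e.lo, (q.2 ∈ sphereCap τ (q.1 a) ↔ q.1 e.hi ∈ sphereCap τ (q.1 a))) ∧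
        q.2 ∈ sphereCap τ (q.1 e.lo)} :=
    measurableSet_setOfPred.2 <| Measurable.and (Measurable.forall fun a =>
      Measurable.forall fun _ =>
        Measurable.iff (Measurable.mem_sphereCap (by fun_prop) (by fun_prop) τ)
          (Measurable.mem_sphereCap (by fun_prop) (by fun_prop) τ))
      (Measurable.mem_sphereCap (by fun_prop) (by fun_prop) τ)
  have h1 : Measurable fun v : Fin n → UnitSphere d =>
      sphereUniform d (edgeCell τ e v ∩ sphereCap τ (v e.lo)) := measurable_measure_prodMk_left hs
  exact h1.ennreal_toReal.div (measurable_sphereUniform_edgeCell hd e).ennreal_toReal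

/-- `edgeProb` is the conditional probability of an edge given its lexicographic predecessors. -/
theorem measureReal_adj_eq_setIntegral_edgeProb (hd : d ≠ 0) (e : LexEdge n)
    (y : LexEdge n → Prop) :
    (Measure.pi fun _ : Fin n => sphereUniform d).real
        {v | (∀ f < e, ((sphericalGraph τ v).Adj f.hi f.lo ↔ y f)) ∧
          (sphericalGraph τ v).Adj e.hi e.lo} =
      ∫ v in {v | ∀ f < e, ((sphericalGraph τ v).Adj f.hi f.lo ↔ y f)}, edgeProb τ e v
        ∂(Measure.pi fun _ : Fin n => sphereUniform d) := by
  classical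
  have hprob := isProbabilityMeasure_sphereUniform hd
  set σ := sphereUniform d
  set A : Set (Fin n → UnitSphere d) := {v | ∀ f < e, ((sphericalGraph τ v).Adj f.hi f.lo ↔ y f)}
    with hA
  have hAm : MeasurableSet A := by
    refine measurableSet_setOfPred.2 <| Measurable.forall fun f => Measurable.forall fun _ =>
      Measurable.iff ?_ measurable_const
    simp only [sphericalGraph_adj_iff]
    exact Measurable.mem_sphereCap (by fun_prop) (by fun_prop) τ
  have hCm : MeasurableSet {v : Fin n → UnitSphere d | v e.hi ∈ sphereCap τ (v e.lo)} :=
    measurableSet_setOfPred.2 (Measurable.mem_sphereCap (by fun_prop) (by fun_prop) τ)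
  set c : Fin n → Prop := fun a => ∃ h : a < e.hi, y (LexEdge.mk e.hi a h) with hc
  -- With the other vectors frozen, the past splits into a condition not involving `z` and
  -- membership of `z` in a single cell. This is what the lexicographic order provides.
  have hmem : ∀ v z, Function.update v e.hi z ∈ A ↔
      (∀ f : LexEdge n, f.hi < e.hi → (v f.hi ∈ sphereCap τ (v f.lo) ↔ y f)) ∧
        z ∈ capCell τ v e.lo c := by
    intro v z
    constructor
    · intro h
      constructor
      · intro f hf
        have h1 := h f ((LexEdge.lt_iff _ _).2 (Or.inl hf))
        rwa [sphericalGraph_adj_iff, Function.update_of_ne hf.ne,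
          Function.update_of_ne (f.lo_lt_hi.trans hf).ne] at h1
      · intro a ha
        have hk := ha.trans e.lo_lt_hi
        have h1 := h (LexEdge.mk e.hi a hk) ((LexEdge.lt_iff _ _).2 (Or.inr ⟨rfl, ha⟩))
        rw [sphericalGraph_adj_iff] at h1
        change (Function.update v e.hi z e.hi ∈ sphereCap τ (Function.update v e.hi z a) ↔ _) at h1
        rw [Function.update_self, Function.update_of_ne hk.ne] at h1
        exact h1.trans ⟨fun h2 => ⟨hk, h2⟩, fun ⟨_, h2⟩ => h2⟩
    · rintro ⟨h1, h2⟩ f hf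
      rw [sphericalGraph_adj_iff]
      rcases (LexEdge.lt_iff _ _).1 hf with hf | ⟨hf1, hf2⟩
      · rw [Function.update_of_ne hf.ne, Function.update_of_ne (f.lo_lt_hi.trans hf).ne]
        exact h1 f hf
      · have hk := hf2.trans e.lo_lt_hi
        rw [hf1, Function.update_self, Function.update_of_ne hk.ne, h2 f.lo hf2]
        have hfe : ∀ h, LexEdge.mk e.hi f.lo h = f := fun h => LexEdge.ext_iff'.2 ⟨hf1.symm, rfl⟩
        exact ⟨fun ⟨h3, h4⟩ => hfe h3 ▸ h4, fun h3 => ⟨hk, (hfe hk).symm ▸ h3⟩⟩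
  -- `edgeProb` is therefore constant as `z` runs through the cell, and integrating it over the cell
  -- gives the mass of the cell's intersection with the cap.
  have hcell : ∀ (v : Fin n → UnitSphere d) z, z ∈ capCell τ v e.lo c →
      edgeCell τ e (Function.update v e.hi z) = capCell τ v e.lo c := by
    intro v z hz
    refine capCell_congr (fun a ha => Function.update_of_ne (ha.trans e.lo_lt_hi).ne _ _)
      fun a ha => ?_
    rw [Function.update_self, Function.update_of_ne (ha.trans e.lo_lt_hi).ne]
    exact hz a ha
  have hE := measurable_edgeProb (τ := τ) hd e
  have hset : {v | (∀ f < e, ((sphericalGraph τ v).Adj f.hi f.lo ↔ y f)) ∧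
      (sphericalGraph τ v).Adj e.hi e.lo} =
      A ∩ {v : Fin n → UnitSphere d | v e.hi ∈ sphereCap τ (v e.lo)} := by
    ext v
    exact and_congr_right fun _ => sphericalGraph_adj_iff e
  have hmain : ∫⁻ v, (A ∩ {v : Fin n → UnitSphere d | v e.hi ∈ sphereCap τ (v e.lo)}).indicator 1 v
        ∂(Measure.pi fun _ : Fin n => σ) =
      ∫⁻ v, A.indicator (fun v => ENNReal.ofReal (edgeProb τ e v)) v
        ∂(Measure.pi fun _ : Fin n => σ) := by
    refine lintegral_pi_eq_of_update e.hi (measurable_one.indicator (hAm.inter hCm))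
      (Measurable.indicator (by fun_prop) hAm) fun v => ?_
    by_cases hB : ∀ f : LexEdge n, f.hi < e.hi → (v f.hi ∈ sphereCap τ (v f.lo) ↔ y f)
    · have hAz : ∀ z, Function.update v e.hi z ∈ A ↔ z ∈ capCell τ v e.lo c := fun z => by
        rw [hmem]; exact and_iff_right hB
      set L := capCell τ v e.lo c with hL
      have hLm : MeasurableSet L := measurableSet_capCell _ _ _ _
      have e1 : ∀ z, (A ∩ {v : Fin n → UnitSphere d | v e.hi ∈ sphereCap τ (v e.lo)}).indicator
          (1 : (Fin n → UnitSphere d) → ℝ≥0∞) (Function.update v e.hi z) =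
          (L ∩ sphereCap τ (v e.lo)).indicator 1 z := by
        intro z
        have : Function.update v e.hi z ∈
            A ∩ {v : Fin n → UnitSphere d | v e.hi ∈ sphereCap τ (v e.lo)} ↔
            z ∈ L ∩ sphereCap τ (v e.lo) := by
          rw [Set.mem_inter_iff, Set.mem_inter_iff, hAz]
          refine and_congr_right fun _ => ?_
          change Function.update v e.hi z e.hi ∈ sphereCap τ (Function.update v e.hi z e.lo) ↔ _
          rw [Function.update_self, Function.update_of_ne e.lo_lt_hi.ne]
        simp only [Set.indicator, this, Pi.one_apply]
      have e2 : ∀ z, A.indicator (fun v => ENNReal.ofReal (edgeProb τ e v))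
          (Function.update v e.hi z) =
          L.indicator (fun _ => ENNReal.ofReal (σ.real (L ∩ sphereCap τ (v e.lo)) / σ.real L)) z := by
        intro z
        by_cases hz : z ∈ L
        · rw [Set.indicator_of_mem hz, Set.indicator_of_mem ((hAz z).2 hz), edgeProb, hcell v z hz,
            Function.update_of_ne e.lo_lt_hi.ne]
        · rw [Set.indicator_of_notMem hz, Set.indicator_of_notMem (mt (hAz z).1 hz)]
      simp_rw [e1, e2]
      rw [lintegral_indicator_one (hLm.inter (measurableSet_sphereCap _ _)),
        lintegral_indicator_const hLm]
      -- On a null cell `edgeProb` takes the default value `0`, and both sides vanish.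
      rcases eq_or_ne (σ L) 0 with h0 | h0
      · rw [h0, mul_zero]
        exact measure_mono_null Set.inter_subset_left h0
      · have h0' : σ.real L ≠ 0 := by
          rw [measureReal_def]; exact (ENNReal.toReal_pos h0 (measure_ne_top _ _)).ne'
        rw [← ofReal_measureReal (μ := σ) (s := L), ← ENNReal.ofReal_mul
          (div_nonneg measureReal_nonneg measureReal_nonneg), div_mul_cancel₀ _ h0',
          ofReal_measureReal]
    · have hAz : ∀ z, Function.update v e.hi z ∉ A := fun z h => hB ((hmem v z).1 h).1
      have e1 : ∀ z, (A ∩ {v : Fin n → UnitSphere d | v e.hi ∈ sphereCap τ (v e.lo)}).indicator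
          (1 : (Fin n → UnitSphere d) → ℝ≥0∞) (Function.update v e.hi z) = 0 := fun z =>
        Set.indicator_of_notMem (fun h => hAz z h.1) _
      have e2 : ∀ z, A.indicator (fun v => ENNReal.ofReal (edgeProb τ e v))
          (Function.update v e.hi z) = 0 := fun z => Set.indicator_of_notMem (hAz z) _
      simp_rw [e1, e2]
  rw [lintegral_indicator_one (hAm.inter hCm), lintegral_indicator hAm] at hmain
  rw [hset, measureReal_def, hmain, integral_eq_lintegral_of_nonneg_ae
    (Filter.Eventually.of_forall fun v => edgeProb_nonneg e v) hE.aestronglyMeasurable]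

end EdgeProbability

/-! ### Cells are rarely small, and conditional edge probabilities concentrate. -/

section EdgeProbabilityBounds

open ProbabilityTheory Metric
open scoped ENNReal RealInnerProductSpace

variable {n d : ℕ} {τ p : ℝ}

theorem measurableSet_prod_capCell (i : Fin n) (c : Fin n → Prop) :
    MeasurableSet {q : (Fin n → UnitSphere d) × UnitSphere d | q.2 ∈ capCell τ q.1 i c} :=
  measurableSet_setOfPred.2 <| Measurable.forall fun _ => Measurable.forall fun _ =>
    Measurable.iff (Measurable.mem_sphereCap (by fun_prop) (by fun_prop) τ) measurable_const

theorem measurable_sphereUniform_capCell (hd : d ≠ 0) (i : Fin n) (c : Fin n → Prop) :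
    Measurable fun v : Fin n → UnitSphere d => sphereUniform d (capCell τ v i c) := by
  have := isProbabilityMeasure_sphereUniform hd
  exact measurable_measure_prodMk_left (measurableSet_prod_capCell i c)

/-- The expected mass of a cell. -/
theorem HasCapMass.lintegral_capCell (h : HasCapMass d τ p) (hd : d ≠ 0) (hp : 0 ≤ p) (i : Fin n)
    {T : Finset (Fin n)} (hT : T ⊆ Finset.Iio i) :
    ∫⁻ v, sphereUniform d (capCell τ v i (· ∈ T)) ∂(Measure.pi fun _ : Fin n => sphereUniform d) =
      ENNReal.ofReal p ^ T.card * ENNReal.ofReal (1 - p) ^ ((Finset.Iio i).card - T.card) := by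
  classical
  have hprob := isProbabilityMeasure_sphereUniform hd
  set μ := Measure.pi fun _ : Fin n => sphereUniform d
  have hs := measurableSet_prod_capCell (d := d) (τ := τ) i (· ∈ T)
  have h1 := Measure.prod_apply (μ := μ) (ν := sphereUniform d) hs
  have h2 := Measure.prod_apply_symm (μ := μ) (ν := sphereUniform d) hs
  refine (h1.symm.trans h2).trans ?_
  -- After Fubini the point `y` is fixed, and its adjacencies to the independent `v a` are
  -- independent events of probability `p`.
  have hin : ∀ y : UnitSphere d,
      μ ((fun v => (v, y)) ⁻¹' {q : (Fin n → UnitSphere d) × UnitSphere d |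
        q.2 ∈ capCell τ q.1 i (· ∈ T)}) =
      ENNReal.ofReal p ^ T.card * ENNReal.ofReal (1 - p) ^ ((Finset.Iio i).card - T.card) := by
    intro y
    have hcap : sphereUniform d (sphereCap τ y) = ENNReal.ofReal p := h y (by simp)
    have hcapc : sphereUniform d (sphereCap τ y)ᶜ = ENNReal.ofReal (1 - p) := by
      rw [prob_compl_eq_one_sub (measurableSet_sphereCap τ y), hcap, ENNReal.ofReal_sub _ hp,
        ENNReal.ofReal_one]
    have hbox : ((fun v => (v, y)) ⁻¹' {q : (Fin n → UnitSphere d) × UnitSphere d |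
        q.2 ∈ capCell τ q.1 i (· ∈ T)}) = Set.pi Set.univ fun a =>
          if a ∈ Finset.Iio i then (if a ∈ T then sphereCap τ y else (sphereCap τ y)ᶜ)
          else Set.univ := by
      ext v
      simp only [Set.mem_preimage, Set.mem_ofPred_eq, capCell, Set.mem_univ_pi, Finset.mem_Iio]
      refine forall_congr' fun a => ?_
      by_cases ha : a < i
      · by_cases hT' : a ∈ T <;> simp [ha, hT', mem_sphereCap_comm (u := v a)]
      · simp [ha]
    rw [hbox, Measure.pi_pi]
    have hterm : ∀ a, sphereUniform d (if a ∈ Finset.Iio i then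
        (if a ∈ T then sphereCap τ y else (sphereCap τ y)ᶜ) else Set.univ) =
        if a ∈ Finset.Iio i then (if a ∈ T then ENNReal.ofReal p else ENNReal.ofReal (1 - p))
        else 1 := by
      intro a
      split_ifs
      · exact hcap
      · exact hcapc
      · exact measure_univ
    simp_rw [hterm]
    rw [Fintype.prod_ite_mem, Finset.prod_ite, Finset.prod_const, Finset.prod_const,
      Finset.filter_mem_eq_inter, Finset.inter_eq_right.2 hT, Finset.filter_notMem_eq_sdiff,
      Finset.card_sdiff_of_subset hT]
  simp_rw [hin]
  simp

/-- Jensen for the concave power, obtained from Hölder's inequality against the constant `1`. -/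
theorem lintegral_rpow_le_rpow_lintegral {Ω : Type*} [MeasurableSpace Ω] {P : Measure Ω}
    [IsProbabilityMeasure P] {f : Ω → ℝ≥0∞} (hf : Measurable f) {r : ℝ} (hr : 0 ≤ r)
    (hr1 : r ≤ 1) : ∫⁻ ω, f ω ^ r ∂P ≤ (∫⁻ ω, f ω ∂P) ^ r := by
  have h := ENNReal.lintegral_mul_norm_pow_le (μ := P) hf.aemeasurable
    (measurable_one (α := ℝ≥0∞) (β := Ω)).aemeasurable hr (sub_nonneg.2 hr1) (by ring)
  simpa using h

/-- The cell containing the new vector is rarely small. -/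
theorem HasCapMass.measure_edgeCell_lt_le (h : HasCapMass d τ p) (hd : d ≠ 0) (hp : 0 ≤ p)
    (e : LexEdge n) (ε : ℝ≥0∞) {s : ℝ} (hs : 0 ≤ s) (hs1 : s ≤ 1) :
    (Measure.pi fun _ : Fin n => sphereUniform d) {v | sphereUniform d (edgeCell τ e v) < ε} ≤
      ε ^ s * (ENNReal.ofReal p ^ (1 - s) + ENNReal.ofReal (1 - p) ^ (1 - s)) ^
        (Finset.Iio e.lo).card := by
  classical
  have hprob := isProbabilityMeasure_sphereUniform hd
  have hbad : MeasurableSet {v : Fin n → UnitSphere d | sphereUniform d (edgeCell τ e v) < ε} :=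
    measurableSet_lt (measurable_sphereUniform_edgeCell hd e) measurable_const
  have hcm : ∀ T : Finset (Fin n), Measurable fun v : Fin n → UnitSphere d =>
      sphereUniform d (capCell τ v e.lo (· ∈ T)) := fun T => measurable_sphereUniform_capCell hd _ _
  have hterm : ∀ T : Finset (Fin n), Measurable fun v : Fin n → UnitSphere d =>
      ε ^ s * sphereUniform d (capCell τ v e.lo (· ∈ T)) ^ (1 - s) := fun T =>
    ((hcm T).pow_const _).const_mul _
  rw [← lintegral_indicator_one hbad]
  calc _ ≤ ∫⁻ v, ∑ T ∈ (Finset.Iio e.lo).powerset,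
        ε ^ s * sphereUniform d (capCell τ v e.lo (· ∈ T)) ^ (1 - s)
          ∂(Measure.pi fun _ : Fin n => sphereUniform d) := by
        refine lintegral_pi_le_of_update e.hi (measurable_one.indicator hbad)
          (Finset.measurable_fun_sum _ fun T _ => hterm T) fun v => ?_
        have hR : ∀ (z : UnitSphere d) (T : Finset (Fin n)),
            capCell τ (Function.update v e.hi z) e.lo (· ∈ T) = capCell τ v e.lo (· ∈ T) :=
          fun z T => capCell_congr
            (fun a ha => Function.update_of_ne (ha.trans e.lo_lt_hi).ne _ _) fun _ _ => Iff.rfl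
        simp_rw [hR]
        rw [lintegral_const, measure_univ, mul_one]
        set P := fun z : UnitSphere d => (Finset.Iio e.lo).filter fun a => z ∈ sphereCap τ (v a)
        have hL : ∀ z, edgeCell τ e (Function.update v e.hi z) = capCell τ v e.lo (· ∈ P z) := by
          intro z
          refine capCell_congr (fun a ha => Function.update_of_ne (ha.trans e.lo_lt_hi).ne _ _)
            fun a ha => ?_
          rw [Function.update_self, Function.update_of_ne (ha.trans e.lo_lt_hi).ne,
            Finset.mem_filter, and_iff_right (Finset.mem_Iio.2 ha)]
        have hzP : ∀ z, z ∈ capCell τ v e.lo (· ∈ P z) := fun z a ha => by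
          change _ ↔ a ∈ Finset.filter _ _
          rw [Finset.mem_filter, and_iff_right (Finset.mem_Iio.2 ha)]
        calc _ ≤ ∫⁻ z, ∑ T ∈ (Finset.Iio e.lo).powerset, (capCell τ v e.lo (· ∈ T)).indicator
              (fun _ => if sphereUniform d (capCell τ v e.lo (· ∈ T)) < ε then (1 : ℝ≥0∞) else 0) z
                ∂(sphereUniform d) := by
              refine lintegral_mono fun z => ?_
              refine le_trans ?_ (Finset.single_le_sum (f := fun T =>
                (capCell τ v e.lo (· ∈ T)).indicator (fun _ => if sphereUniform d
                  (capCell τ v e.lo (· ∈ T)) < ε then (1 : ℝ≥0∞) else 0) z)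
                (fun _ _ => zero_le) (Finset.mem_powerset.2 (Finset.filter_subset _ _)
                  : P z ∈ (Finset.Iio e.lo).powerset))
              simp only
              rw [Set.indicator_of_mem (hzP z)]
              simp only [Set.indicator, Set.mem_ofPred_eq, hL z, Pi.one_apply]
              exact le_rfl
          _ = ∑ T ∈ (Finset.Iio e.lo).powerset,
              (if sphereUniform d (capCell τ v e.lo (· ∈ T)) < ε then (1 : ℝ≥0∞) else 0) *
                sphereUniform d (capCell τ v e.lo (· ∈ T)) := by
              rw [lintegral_finsetSum _ fun T _ =>
                measurable_const.indicator (measurableSet_capCell _ _ _ _)]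
              refine Finset.sum_congr rfl fun T _ => ?_
              rw [lintegral_indicator_const (measurableSet_capCell _ _ _ _)]
          -- A cell of mass `x` is hit with probability `x`, and for `x < ε` this is at most `ε ^ s
          -- * x ^ (1 - s)`. The power `1 - s` then allows Jensen and the binomial theorem over all
          -- adjacency patterns.
          _ ≤ _ := by
              refine Finset.sum_le_sum fun T _ => ?_
              set x := sphereUniform d (capCell τ v e.lo (· ∈ T))
              split_ifs with hx
              · rw [one_mul]
                calc x = x ^ (s + (1 - s)) := by simp
                  _ = x ^ s * x ^ (1 - s) :=
                    ENNReal.rpow_add_of_nonneg _ _ hs (sub_nonneg.2 hs1)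
                  _ ≤ _ := by gcongr
              · simp
    _ = ∑ T ∈ (Finset.Iio e.lo).powerset, ε ^ s *
        ∫⁻ v, sphereUniform d (capCell τ v e.lo (· ∈ T)) ^ (1 - s)
          ∂(Measure.pi fun _ : Fin n => sphereUniform d) := by
        rw [lintegral_finsetSum _ fun T _ => hterm T]
        exact Finset.sum_congr rfl fun T _ => lintegral_const_mul _ ((hcm T).pow_const _)
    _ ≤ ∑ T ∈ (Finset.Iio e.lo).powerset, ε ^ s *
        ((ENNReal.ofReal p ^ (1 - s)) ^ T.card *
          (ENNReal.ofReal (1 - p) ^ (1 - s)) ^ ((Finset.Iio e.lo).card - T.card)) := by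
        refine Finset.sum_le_sum fun T hT => ?_
        gcongr
        refine (lintegral_rpow_le_rpow_lintegral (hcm T) (sub_nonneg.2 hs1)
          (by linarith)).trans (le_of_eq ?_)
        rw [h.lintegral_capCell hd hp _ (Finset.mem_powerset.1 hT),
          ENNReal.mul_rpow_of_nonneg _ _ (sub_nonneg.2 hs1)]
        congr 1
        · rw [← ENNReal.rpow_natCast, ← ENNReal.rpow_mul, mul_comm, ENNReal.rpow_mul,
            ENNReal.rpow_natCast]
        · rw [← ENNReal.rpow_natCast, ← ENNReal.rpow_mul, mul_comm, ENNReal.rpow_mul,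
            ENNReal.rpow_natCast]
    _ = _ := by rw [← Finset.mul_sum, Finset.sum_pow_mul_eq_add_pow]

/-- Quantitative version: cells of mass below `exp (-12 L Z)` have probability at most
`exp (-4 Z)`. -/
theorem HasCapMass.measure_edgeCell_lt_le_exp (h : HasCapMass d τ p) (hd : d ≠ 0)
    {L Z : ℝ} (hL : 1 ≤ L) (hpL : Real.exp (-(2 * L)) ≤ p) (hpZ : n * p ≤ Z) (e : LexEdge n) :
    (Measure.pi fun _ : Fin n => sphereUniform d)
      {v | sphereUniform d (edgeCell τ e v) < ENNReal.ofReal (Real.exp (-(12 * L * Z)))} ≤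
      ENNReal.ofReal (Real.exp (-(4 * Z))) := by
  have hL0 : 0 < L := by linarith
  have hp0 : 0 < p := (Real.exp_pos _).trans_le hpL
  have hs0 : 0 < L⁻¹ := inv_pos.2 hL0
  have hs1 : L⁻¹ ≤ 1 := inv_le_one_of_one_le₀ hL
  -- The exponent `s = 1 / L` balances two effects: `ε ^ s` becomes `exp (-12 Z)`, while `p ^ (1 -
  -- s)` exceeds `p` by a factor of at most `e² ≤ 8`, since `p ≥ exp (-2 L)`. The total exponent is
  -- at most `-12 Z + 8 n p ≤ -4 Z`.
  refine (h.measure_edgeCell_lt_le hd hp0.le e _ hs0.le hs1).trans ?_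
  have h1 : ENNReal.ofReal p ^ (1 - L⁻¹) ≤ ENNReal.ofReal (8 * p) := by
    rw [ENNReal.ofReal_rpow_of_pos hp0]
    apply ENNReal.ofReal_le_ofReal
    rw [sub_eq_add_neg, Real.rpow_add hp0, Real.rpow_one, mul_comm]
    gcongr
    rw [Real.rpow_neg hp0.le]
    have h2 : Real.exp (-2) ≤ p ^ L⁻¹ := by
      calc Real.exp (-2) = Real.exp (-(2 * L)) ^ L⁻¹ := by
            rw [← Real.exp_mul]; congr 1; field_simp
        _ ≤ p ^ L⁻¹ := Real.rpow_le_rpow (Real.exp_pos _).le hpL hs0.le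
    calc (p ^ L⁻¹)⁻¹ ≤ (Real.exp (-2))⁻¹ := inv_anti₀ (Real.exp_pos _) h2
      _ = Real.exp 1 * Real.exp 1 := by rw [← Real.exp_neg, ← Real.exp_add]; norm_num
      _ ≤ 2.8 * 2.8 := by gcongr <;> linarith [Real.exp_one_lt_d9]
      _ ≤ 8 := by norm_num
  have h2 : ENNReal.ofReal (1 - p) ^ (1 - L⁻¹) ≤ ENNReal.ofReal 1 := by
    rw [ENNReal.ofReal_one]
    refine ENNReal.rpow_le_one ?_ (sub_nonneg.2 hs1)
    rw [← ENNReal.ofReal_one]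
    exact ENNReal.ofReal_le_ofReal (by linarith)
  have h3 : ENNReal.ofReal p ^ (1 - L⁻¹) + ENNReal.ofReal (1 - p) ^ (1 - L⁻¹) ≤
      ENNReal.ofReal (Real.exp (8 * p)) := by
    refine (add_le_add h1 h2).trans ?_
    rw [← ENNReal.ofReal_add (by positivity) zero_le_one]
    exact ENNReal.ofReal_le_ofReal (Real.add_one_le_exp _)
  have h4 : ENNReal.ofReal (Real.exp (-(12 * L * Z))) ^ L⁻¹ =
      ENNReal.ofReal (Real.exp (-(12 * Z))) := by
    rw [ENNReal.ofReal_rpow_of_pos (Real.exp_pos _), ← Real.exp_mul]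
    congr 2; field_simp
  have hcard : ((Finset.Iio e.lo).card : ℝ) ≤ n := by
    rw [Fin.card_Iio]; exact_mod_cast e.lo.2.le
  calc _ ≤ ENNReal.ofReal (Real.exp (-(12 * Z))) *
        ENNReal.ofReal (Real.exp (8 * p)) ^ (Finset.Iio e.lo).card := by rw [h4]; gcongr
    _ = ENNReal.ofReal (Real.exp (-(12 * Z) + (Finset.Iio e.lo).card * (8 * p))) := by
        rw [← ENNReal.ofReal_pow (Real.exp_pos _).le, ← Real.exp_nat_mul,
          ← ENNReal.ofReal_mul (Real.exp_pos _).le, ← Real.exp_add]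
    _ ≤ _ := by
        apply ENNReal.ofReal_le_ofReal
        apply Real.exp_le_exp.2
        have : (Finset.Iio e.lo).card * p ≤ n * p := by gcongr
        linarith

/-- The edge probability concentrates: expected excess of `|edgeProb - p|` over `p δ`. -/
theorem HasCapMass.lintegral_edgeProb_excess_le (h : HasCapMass d τ p) {a b L Z δ : ℝ}
    (hL : 10 ^ 17 ≤ L) (haL : 10 ^ 16 ≤ a * L) (hbL : 1000 ≤ b * L) (hZ : L ≤ Z)
    (hZL : Z ≤ Real.exp L) (hd : a * Z * L ^ 4 ≤ d) (hδ : δ = √Z * L ^ 2 / √d)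
    (hp : b * Real.exp (-L) ≤ p) (hp1 : p ≤ 1) (hpZ : n * p ≤ Z) (e : LexEdge n) :
    ∫⁻ v, ENNReal.ofReal (|edgeProb τ e v - p| - p * δ)
      ∂(Measure.pi fun _ : Fin n => sphereUniform d) ≤
        ENNReal.ofReal (21 * Real.exp (-(3 * L))) := by
  classical
  have hL0 : 0 < L := by linarith
  have ha0 : 0 < a := pos_of_mul_pos_left (by linarith) hL0.le
  have hb0 : 0 < b := pos_of_mul_pos_left (by linarith) hL0.le
  have hZ0 : 0 < Z := by linarith
  have hp0 : 0 < p := lt_of_lt_of_le (by positivity) hp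
  have hδ0 : 0 ≤ δ := by rw [hδ]; positivity
  have hd0 : d ≠ 0 := by
    rintro rfl
    have : 0 < a * Z * L ^ 4 := by positivity
    push_cast at hd
    linarith
  have hprob := isProbabilityMeasure_sphereUniform hd0
  have hpL : Real.exp (-(2 * L)) ≤ p := by
    have h1 : L ≤ Real.exp L := by linarith [Real.add_one_le_exp L]
    have h2 : Real.exp (-L) * L ≤ 1 := by
      calc Real.exp (-L) * L ≤ Real.exp (-L) * Real.exp L := by gcongr
        _ = 1 := by rw [← Real.exp_add]; simp
    have h3 : Real.exp (-L) ≤ b := by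
      calc Real.exp (-L) = Real.exp (-L) * 1 := (mul_one _).symm
        _ ≤ Real.exp (-L) * (b * L) := by gcongr; linarith
        _ = b * (Real.exp (-L) * L) := by ring
        _ ≤ b * 1 := by gcongr
        _ = b := mul_one b
    calc Real.exp (-(2 * L)) = Real.exp (-L) * Real.exp (-L) := by
          rw [← Real.exp_add]; congr 1; ring
      _ ≤ b * Real.exp (-L) := by gcongr
      _ ≤ p := hp
  set ε := ENNReal.ofReal (Real.exp (-(12 * L * Z))) with hε
  have hcm := measurable_sphereUniform_edgeCell (τ := τ) hd0 e
  have hbad : MeasurableSet {v : Fin n → UnitSphere d | sphereUniform d (edgeCell τ e v) < ε} :=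
    measurableSet_lt hcm measurable_const
  have hem := measurable_edgeProb (τ := τ) hd0 e
  have hexm : Measurable fun v : Fin n → UnitSphere d =>
    ENNReal.ofReal (|edgeProb τ e v - p| - p * δ) := by fun_prop
  set F := fun v : Fin n → UnitSphere d => ENNReal.ofReal (|edgeProb τ e v - p| - p * δ) with hF
  have hgood : ∫⁻ v, {v : Fin n → UnitSphere d | sphereUniform d (edgeCell τ e v) < ε}ᶜ.indicator F v
      ∂(Measure.pi fun _ : Fin n => sphereUniform d) ≤
        ∫⁻ v, ENNReal.ofReal (20 * Real.exp (-(3 * L)))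
          ∂(Measure.pi fun _ : Fin n => sphereUniform d) := by
    -- Only `v e.lo` is resampled: the cell is determined by `v e.hi` and the vectors before `e.lo`,
    -- so it stays fixed while the cap moves uniformly.
    refine lintegral_pi_le_of_update e.lo (hexm.indicator hbad.compl) measurable_const fun v => ?_
    rw [lintegral_const, measure_univ, mul_one]
    have hcell : ∀ z, edgeCell τ e (Function.update v e.lo z) = edgeCell τ e v := fun z =>
      capCell_congr (fun a ha => Function.update_of_ne ha.ne _ _) fun a ha => by
        rw [Function.update_of_ne e.lo_lt_hi.ne', Function.update_of_ne ha.ne]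
    by_cases hv : sphereUniform d (edgeCell τ e v) < ε
    · refine le_trans (le_of_eq ?_) zero_le
      refine (lintegral_congr fun z => ?_).trans lintegral_zero
      refine Set.indicator_of_notMem ?_ _
      rw [Set.mem_compl_iff, not_not]
      change sphereUniform d (edgeCell τ e (Function.update v e.lo z)) < ε
      rwa [hcell]
    · set C := edgeCell τ e v with hC
      have hε0 : 0 < ε := ENNReal.ofReal_pos.2 (Real.exp_pos _)
      have hC0 : sphereUniform d C ≠ 0 := (hε0.trans_le (not_lt.1 hv)).ne'
      have hCprob : IsProbabilityMeasure ((sphereUniform d)[|C]) := cond_isProbabilityMeasure hC0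
      have hCm : MeasurableSet C := measurableSet_edgeCell _ _ _
      -- The uniform law on a cell has density one over its mass, here at most `exp (12 L Z)`.
      have hle : (sphereUniform d)[|C] ≤
          ENNReal.ofReal (Real.exp (12 * L * Z)) • sphereUniform d := by
        have h1 : (sphereUniform d C)⁻¹ ≤ ENNReal.ofReal (Real.exp (12 * L * Z)) := by
          rw [ENNReal.inv_le_iff_inv_le, ← ENNReal.ofReal_inv_of_pos (Real.exp_pos _),
            ← Real.exp_neg]
          exact not_lt.1 hv
        refine Measure.le_iff.2 fun s _ => ?_
        rw [ProbabilityTheory.cond, Measure.smul_apply, Measure.smul_apply, smul_eq_mul, smul_eq_mul]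
        gcongr
        exact Measure.restrict_le_self
      refine le_trans (lintegral_mono fun z => ?_)
        (lintegral_capMass_excess_le hL haL hbL hZ hZL hd hδ hp hp1 h hle)
      refine (Set.indicator_le_self _ _ _).trans (le_of_eq ?_)
      have hval : edgeProb τ e (Function.update v e.lo z) =
          capMass ((sphereUniform d)[|C]) τ (z : EuclideanSpace ℝ (Fin d)) := by
        rw [edgeProb, hcell, Function.update_self]
        change _ = ((sphereUniform d)[|C]).real (sphereCap τ z)
        rw [measureReal_def ((sphereUniform d)[|C]), cond_apply hCm, ENNReal.toReal_mul,
          ENNReal.toReal_inv, div_eq_inv_mul]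
        rfl
      simp only [hF, hval]
  calc _ ≤ ∫⁻ v, ({v : Fin n → UnitSphere d | sphereUniform d (edgeCell τ e v) < ε}.indicator 1 v +
        {v : Fin n → UnitSphere d | sphereUniform d (edgeCell τ e v) < ε}ᶜ.indicator F v)
          ∂(Measure.pi fun _ : Fin n => sphereUniform d) := by
        refine lintegral_mono fun v => ?_
        by_cases hv : v ∈ {v : Fin n → UnitSphere d | sphereUniform d (edgeCell τ e v) < ε}
        · rw [Set.indicator_of_mem hv, Pi.one_apply, ← ENNReal.ofReal_one]
          refine le_add_right (ENNReal.ofReal_le_ofReal ?_)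
          have h1 := edgeProb_nonneg (τ := τ) e v
          have h2 := edgeProb_le_one (τ := τ) hd0 e v
          have h3 : |edgeProb τ e v - p| ≤ 1 := by rw [abs_le]; constructor <;> linarith
          have h4 : 0 ≤ p * δ := by positivity
          linarith
        · rw [Set.indicator_of_notMem hv, zero_add, Set.indicator_of_mem (by exact hv)]
    _ ≤ ENNReal.ofReal (Real.exp (-(4 * Z))) + ENNReal.ofReal (20 * Real.exp (-(3 * L))) := by
        rw [lintegral_add_left (measurable_one.indicator hbad), lintegral_indicator_one hbad]
        refine add_le_add (h.measure_edgeCell_lt_le_exp hd0 (by linarith) hpL hpZ e)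
          (hgood.trans (le_of_eq ?_))
        rw [lintegral_const, measure_univ, mul_one]
    _ ≤ _ := by
        rw [← ENNReal.ofReal_add (Real.exp_pos _).le (by positivity)]
        apply ENNReal.ofReal_le_ofReal
        have : Real.exp (-(4 * Z)) ≤ Real.exp (-(3 * L)) := Real.exp_le_exp.2 (by linarith)
        linarith

end EdgeProbabilityBounds

/-! ### Thresholds: rotation invariance, absence of atoms and existence. -/

section Threshold

open ProbabilityTheory Metric
open scoped ENNReal RealInnerProductSpace

variable {d : ℕ}

theorem sphereUniform_cap_congr (hd : d ≠ 0) {u v : EuclideanSpace ℝ (Fin d)} (h : ‖u‖ = ‖v‖)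
    (τ : ℝ) : sphereUniform d {x | τ ≤ ⟪(x : EuclideanSpace ℝ (Fin d)), u⟫} =
      sphereUniform d {x | τ ≤ ⟪(x : EuclideanSpace ℝ (Fin d)), v⟫} := by
  have h1 := lintegral_sphereUniform_inner_congr hd h
    (f := (Set.Ici τ).indicator 1) (measurable_one.indicator measurableSet_Ici)
  have e : ∀ w : EuclideanSpace ℝ (Fin d), sphereUniform d
      {x | τ ≤ ⟪(x : EuclideanSpace ℝ (Fin d)), w⟫} =
      ∫⁻ x : sphere (0 : EuclideanSpace ℝ (Fin d)) 1, (Set.Ici τ).indicator 1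
        ⟪(x : EuclideanSpace ℝ (Fin d)), w⟫ ∂(sphereUniform d) := fun w => by
    have hm : MeasurableSet {x : sphere (0 : EuclideanSpace ℝ (Fin d)) 1 |
        τ ≤ ⟪(x : EuclideanSpace ℝ (Fin d)), w⟫} := measurableSet_le measurable_const (by fun_prop)
    rw [← lintegral_indicator_one hm]
    rfl
  rw [e, e, h1]

theorem prod_sphereUniform_eq (hd : d ≠ 0) (τ : ℝ) {u : EuclideanSpace ℝ (Fin d)} (hu : ‖u‖ = 1) :
    ((sphereUniform d).prod (sphereUniform d))
      {x | τ ≤ inner ℝ (x.1 : EuclideanSpace ℝ (Fin d)) (x.2 : EuclideanSpace ℝ (Fin d))} =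
      sphereUniform d {x | τ ≤ ⟪(x : EuclideanSpace ℝ (Fin d)), u⟫} := by
  have := isProbabilityMeasure_sphereUniform hd
  have hs : MeasurableSet {x : sphere (0 : EuclideanSpace ℝ (Fin d)) 1 ×
      sphere (0 : EuclideanSpace ℝ (Fin d)) 1 |
      τ ≤ inner ℝ (x.1 : EuclideanSpace ℝ (Fin d)) (x.2 : EuclideanSpace ℝ (Fin d))} :=
    measurableSet_le measurable_const (by fun_prop)
  rw [Measure.prod_apply_symm hs]
  have h : ∀ y : sphere (0 : EuclideanSpace ℝ (Fin d)) 1, sphereUniform d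
      ((fun x => (x, y)) ⁻¹' {x : sphere (0 : EuclideanSpace ℝ (Fin d)) 1 ×
        sphere (0 : EuclideanSpace ℝ (Fin d)) 1 |
        τ ≤ inner ℝ (x.1 : EuclideanSpace ℝ (Fin d)) (x.2 : EuclideanSpace ℝ (Fin d))}) =
      sphereUniform d {x | τ ≤ ⟪(x : EuclideanSpace ℝ (Fin d)), u⟫} := fun y =>
    sphereUniform_cap_congr hd (u := (y : EuclideanSpace ℝ (Fin d))) (by simp [hu]) τ
  simp_rw [h]
  simp

theorem IsThreshold.hasCapMass {p τ : ℝ} (h : IsThreshold d p τ) (hd : d ≠ 0) :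
    HasCapMass d τ p := fun _ hu => (prod_sphereUniform_eq hd τ hu).symm.trans h

/-- For `s < 1` the set lies in the frontier of a convex cone, and frontiers of convex sets are
null. For `s ≥ 1` it forces equality in Cauchy–Schwarz, hence lies on the line through `u`, a proper
subspace as `d ≥ 2`. -/
theorem volume_inner_eq_mul_norm (hd : 2 ≤ d) {u : EuclideanSpace ℝ (Fin d)} (hu : ‖u‖ = 1)
    {s : ℝ} (hs : 0 ≤ s) :
    (volume : Measure (EuclideanSpace ℝ (Fin d))) {g | ⟪g, u⟫ = s * ‖g‖} = 0 := by
  rcases lt_or_ge s 1 with h1 | h1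
  · have hconv : Convex ℝ {g : EuclideanSpace ℝ (Fin d) | s * ‖g‖ ≤ ⟪g, u⟫} := by
      intro x hx y hy a b ha hb _
      have hx' : s * ‖x‖ ≤ ⟪x, u⟫ := hx
      have hy' : s * ‖y‖ ≤ ⟪y, u⟫ := hy
      change s * ‖a • x + b • y‖ ≤ ⟪a • x + b • y, u⟫
      rw [inner_add_left, real_inner_smul_left, real_inner_smul_left]
      calc s * ‖a • x + b • y‖ ≤ s * (a * ‖x‖ + b * ‖y‖) := by
            gcongr
            refine (norm_add_le _ _).trans ?_
            rw [norm_smul, norm_smul, Real.norm_of_nonneg ha, Real.norm_of_nonneg hb]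
        _ = a * (s * ‖x‖) + b * (s * ‖y‖) := by ring
        _ ≤ _ := by gcongr
    refine measure_mono_null (fun g hg => ?_) (hconv.addHaar_frontier volume)
    have hg' : ⟪g, u⟫ = s * ‖g‖ := hg
    refine ⟨subset_closure hg'.ge, fun hint => ?_⟩
    obtain ⟨r, hr, hball⟩ := Metric.mem_nhds_iff.1 (mem_interior_iff_mem_nhds.1 hint)
    -- Moving from a boundary point against `u` lowers the inner product faster than `s` times the
    -- norm, so the point is not interior.
    have hmem : g - (r / 2) • u ∈ ball g r := by
      rw [mem_ball, dist_eq_norm, sub_sub_cancel_left, norm_neg, norm_smul, hu, mul_one,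
        Real.norm_of_nonneg (by positivity)]
      linarith
    have h2 : s * ‖g - (r / 2) • u‖ ≤ ⟪g - (r / 2) • u, u⟫ := hball hmem
    rw [inner_sub_left, real_inner_smul_left, real_inner_self_eq_norm_sq, hu, hg'] at h2
    have h3 : ‖g‖ - r / 2 ≤ ‖g - (r / 2) • u‖ := by
      have := norm_sub_norm_le g ((r / 2) • u)
      rw [norm_smul, hu, mul_one, Real.norm_of_nonneg (by positivity)] at this
      exact this
    nlinarith
  · have hspan : Submodule.span ℝ {u} ≠ ⊤ := fun h => by
      have h2 := finrank_span_singleton (K := ℝ) (v := u) (by rintro rfl; simp at hu)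
      rw [h, finrank_top, finrank_euclideanSpace_fin] at h2
      omega
    refine measure_mono_null (fun g hg => ?_) (Measure.addHaar_submodule volume _ hspan)
    have hg' : ⟪g, u⟫ = s * ‖g‖ := hg
    have h2 : ⟪g, u⟫ = ‖g‖ * ‖u‖ := by
      refine le_antisymm (real_inner_le_norm g u) ?_
      rw [hg', hu, mul_one]
      exact le_mul_of_one_le_left (norm_nonneg g) h1
    rw [inner_eq_norm_mul_iff_real, hu, one_smul] at h2
    rw [h2]
    exact Submodule.smul_mem _ _ (Submodule.mem_span_singleton_self u)

/-- One-dimensional marginals of the uniform distribution on the sphere have no atoms. -/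
theorem sphereUniform_inner_eq (hd : 2 ≤ d) {u : EuclideanSpace ℝ (Fin d)} (hu : ‖u‖ = 1) (s : ℝ) :
    sphereUniform d {x | ⟪(x : EuclideanSpace ℝ (Fin d)), u⟫ = s} = 0 := by
  have : Nonempty (Fin d) := ⟨⟨0, by omega⟩⟩
  have hm : MeasurableSet {x : EuclideanSpace ℝ (Fin d) | ⟪x, u⟫ = s} :=
    measurableSet_eq_fun (by fun_prop) measurable_const
  refine (sphereUniform_apply_eq (by omega) hm).trans ?_
  have hvol : (volume : Measure (EuclideanSpace ℝ (Fin d))) {g | ⟪g, u⟫ = s * ‖g‖} = 0 := by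
    rcases le_total 0 s with h | h
    · exact volume_inner_eq_mul_norm hd hu h
    · have h1 := volume_inner_eq_mul_norm hd (u := -u) (s := -s) (by simpa using hu) (by linarith)
      have e : {g : EuclideanSpace ℝ (Fin d) | ⟪g, u⟫ = s * ‖g‖} =
          {g | ⟪g, -u⟫ = -s * ‖g‖} := by
        ext g
        change ⟪g, u⟫ = s * ‖g‖ ↔ ⟪g, -u⟫ = -s * ‖g‖
        rw [inner_neg_right, neg_mul, neg_inj]
      rw [e]; exact h1
  have hac : stdGaussian (EuclideanSpace ℝ (Fin d)) ≪ volume := by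
    rw [stdGaussian_eq_withDensity]
    exact withDensity_absolutelyContinuous _ _
  refine measure_mono_null_ae ?_ (hac hvol)
  filter_upwards [stdGaussian_ae_ne_zero (d := d) (by omega)] with g hg0 hg
  have hg' : ⟪‖g‖⁻¹ • g, u⟫ = s := hg
  change ⟪g, u⟫ = s * ‖g‖
  rw [← hg', real_inner_smul_left]
  have := norm_ne_zero_iff.2 hg0
  field_simp

theorem continuous_sphereUniform_cap (hd : 2 ≤ d) {u : EuclideanSpace ℝ (Fin d)} (hu : ‖u‖ = 1) :
    Continuous fun s : ℝ =>
      (sphereUniform d).real {x | s ≤ ⟪(x : EuclideanSpace ℝ (Fin d)), u⟫} := by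
  have := isProbabilityMeasure_sphereUniform (d := d) (by omega)
  have hm : ∀ s : ℝ, MeasurableSet {x : sphere (0 : EuclideanSpace ℝ (Fin d)) 1 |
      s ≤ ⟪(x : EuclideanSpace ℝ (Fin d)), u⟫} := fun s =>
    measurableSet_le measurable_const (by fun_prop)
  have e : (fun s : ℝ => (sphereUniform d).real {x | s ≤ ⟪(x : EuclideanSpace ℝ (Fin d)), u⟫}) =
      fun s => ∫ x : sphere (0 : EuclideanSpace ℝ (Fin d)) 1, (if s ≤
        ⟪(x : EuclideanSpace ℝ (Fin d)), u⟫ then (1 : ℝ) else 0) ∂(sphereUniform d) := by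
    funext s
    rw [← integral_indicator_one (hm s)]
    rfl
  rw [e, continuous_iff_continuousAt]
  intro s
  refine continuousAt_of_dominated (bound := fun _ => 1) ?_ ?_ (integrable_const 1) ?_
  · refine Filter.Eventually.of_forall fun s' => Measurable.aestronglyMeasurable ?_
    exact Measurable.ite (hm s') measurable_const measurable_const
  · refine Filter.Eventually.of_forall fun s' => Filter.Eventually.of_forall fun x => ?_
    split_ifs <;> simp
  · have hne : ∀ᵐ x : sphere (0 : EuclideanSpace ℝ (Fin d)) 1 ∂(sphereUniform d),
        ⟪(x : EuclideanSpace ℝ (Fin d)), u⟫ ≠ s := by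
      have h0 := sphereUniform_inner_eq hd hu s
      exact measure_eq_zero_iff_ae_notMem.1 h0
    filter_upwards [hne] with x hx
    rcases lt_or_gt_of_ne hx with h | h
    · refine continuousAt_const.congr (f := fun _ => (0 : ℝ)) ?_
      filter_upwards [lt_mem_nhds h] with s' hs'
      rw [if_neg (not_le.2 hs')]
    · refine continuousAt_const.congr (f := fun _ => (1 : ℝ)) ?_
      filter_upwards [gt_mem_nhds h] with s' hs'
      rw [if_pos hs'.le]

/-- Intermediate value theorem: without atoms the cap mass depends continuously on the height, and
it runs from `1` at height `-1` to `0` at height `2`. -/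
theorem exists_isThreshold (hd : 2 ≤ d) {p : ℝ} (hp : 0 ≤ p) (hp1 : p ≤ 1) :
    ∃ τ, IsThreshold d p τ := by
  have := isProbabilityMeasure_sphereUniform (d := d) (by omega)
  obtain ⟨u, hu⟩ : ∃ u : EuclideanSpace ℝ (Fin d), ‖u‖ = 1 :=
    ⟨EuclideanSpace.single ⟨0, by omega⟩ 1, by simp⟩
  have hin : ∀ x : sphere (0 : EuclideanSpace ℝ (Fin d)) 1,
      |⟪(x : EuclideanSpace ℝ (Fin d)), u⟫| ≤ 1 := fun x => by
    have := abs_real_inner_le_norm (x : EuclideanSpace ℝ (Fin d)) u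
    rwa [hu, norm_eq_of_mem_sphere, mul_one] at this
  obtain ⟨τ, hτ⟩ := mem_range_of_exists_le_of_exists_ge (c := p)
    (continuous_sphereUniform_cap hd hu)
    ⟨2, by
      have : {x : sphere (0 : EuclideanSpace ℝ (Fin d)) 1 |
          (2 : ℝ) ≤ ⟪(x : EuclideanSpace ℝ (Fin d)), u⟫} = ∅ := by
        ext x
        simp only [Set.mem_ofPred_eq, Set.mem_empty_iff_false, iff_false, not_le]
        linarith [(abs_le.1 (hin x)).2]
      simp only [this, measureReal_empty]; exact hp⟩
    ⟨-1, by
      have : {x : sphere (0 : EuclideanSpace ℝ (Fin d)) 1 |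
          (-1 : ℝ) ≤ ⟪(x : EuclideanSpace ℝ (Fin d)), u⟫} = Set.univ := by
        ext x
        simp only [Set.mem_ofPred_eq, Set.mem_univ, iff_true]
        exact (abs_le.1 (hin x)).1
      simp only [this, probReal_univ]; exact hp1⟩
  refine ⟨τ, ?_⟩
  rw [IsThreshold, prod_sphereUniform_eq (by omega) τ hu, ← ofReal_measureReal]
  exact congrArg _ hτ

end Threshold

/-! ### Assembly of the sandwich from the excess bounds. -/

section Sandwich

variable {n d : ℕ} {τ p : ℝ}

/-- Raising a negative parameter to `0` creates no excess because `π` is nonnegative, and clipping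
at `1` is never active. -/
theorem max_zero_projIcc_sub_le {p t π : ℝ} (hp1 : p ≤ 1) (ht : 0 ≤ t) (hπ : 0 ≤ π) :
    max 0 (((Set.projIcc (0 : ℝ) 1 zero_le_one (p - t)) : ℝ) - π) ≤ max 0 (|π - p| - t) := by
  rw [Set.coe_projIcc]
  refine max_le (le_max_left _ _) ?_
  rw [min_eq_right (by linarith), sub_le_iff_le_add]
  refine max_le (add_nonneg (le_max_left _ _) hπ) ?_
  have h1 := neg_abs_le (π - p)
  have h2 := le_max_right 0 (|π - p| - t)
  linarith

theorem max_zero_sub_projIcc_le {p t π : ℝ} (hπ1 : π ≤ 1) :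
    max 0 (π - ((Set.projIcc (0 : ℝ) 1 zero_le_one (p + t)) : ℝ)) ≤ max 0 (|π - p| - t) := by
  rw [Set.coe_projIcc]
  refine max_le (le_max_left _ _) ?_
  rw [sub_le_iff_le_add]
  have h1 := le_abs_self (π - p)
  have h2 := le_max_right 0 (|π - p| - t)
  have h3 := le_max_left 0 (|π - p| - t)
  have h4 := le_max_right 0 (min 1 (p + t))
  rcases le_total 1 (p + t) with h | h
  · rw [min_eq_left h] at h4 ⊢; linarith
  · rw [min_eq_right h] at h4 ⊢; linarith

/-- The spherical random geometric graph is sandwiched between two binomial random graphs, up to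
an error controlled by the deviations of the conditional edge probabilities. -/
theorem exists_sphericalRGG_sandwich (hd : d ≠ 0) (hp1 : p ≤ 1) {t κ : ℝ} (ht : 0 ≤ t)
    (hκ : 0 ≤ κ)
    (h : ∀ e : LexEdge n, ∫⁻ v, ENNReal.ofReal (|edgeProb τ e v - p| - t)
      ∂(Measure.pi fun _ : Fin n => sphereUniform d) ≤ ENNReal.ofReal κ) :
    ∃ γ : Measure (SimpleGraph (Fin n) × SimpleGraph (Fin n) × SimpleGraph (Fin n)),
      IsTripleCoupling (erdosRenyi n (p - t)) (sphericalRGG n d τ) (erdosRenyi n (p + t)) γ ∧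
      ENNReal.ofReal (1 - 2 * n ^ 2 * κ) ≤ γ {x | x.1 ≤ x.2.1 ∧ x.2.1 ≤ x.2.2} := by
  have hprob := isProbabilityMeasure_sphereUniform hd
  set μ := Measure.pi fun _ : Fin n => sphereUniform d with hμ
  have hem := fun e : LexEdge n => measurable_edgeProb (τ := τ) hd e
  have h0 := fun e : LexEdge n => edgeProb_nonneg (τ := τ) (d := d) e
  have h1 := fun e : LexEdge n => edgeProb_le_one (τ := τ) hd e
  obtain ⟨γ, hγ, hγ'⟩ := exists_binomialRandom_sandwich μ (measurable_sphericalGraph τ)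
    (fun e => edgeProb τ e) hem h0 h1 (fun e y => measureReal_adj_eq_setIntegral_edgeProb hd e y)
    (Set.projIcc (0 : ℝ) 1 zero_le_one (p - t)) (Set.projIcc (0 : ℝ) 1 zero_le_one (p + t))
  refine ⟨γ, hγ, le_trans (ENNReal.ofReal_le_ofReal ?_) hγ'⟩
  have hint : ∀ (f : ℝ → ℝ), Measurable f → (∀ x, 0 ≤ f x) →
      (∀ x, 0 ≤ x → x ≤ 1 → f x ≤ max 0 (|x - p| - t)) → ∀ e : LexEdge n,
      ∫ v, f (edgeProb τ e v) ∂μ ≤ κ := by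
    intro f hfm hf0 hf e
    rw [integral_eq_lintegral_of_nonneg_ae (Filter.Eventually.of_forall fun v => hf0 _)
      (hfm.comp (hem e)).aestronglyMeasurable]
    refine ENNReal.toReal_le_of_le_ofReal hκ (le_trans (lintegral_mono fun v => ?_) (h e))
    refine (ENNReal.ofReal_le_ofReal (hf _ (h0 e v) (h1 e v))).trans ?_
    rcases le_total 0 (|edgeProb τ e v - p| - t) with h2 | h2
    · rw [max_eq_right h2]
    · rw [max_eq_left h2]; simp
  have hsum : ∀ F : LexEdge n → ℝ, (∀ e, F e ≤ κ) → ∑ e, F e ≤ n ^ 2 * κ := fun F hF => by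
    calc ∑ e, F e ≤ ∑ _e : LexEdge n, κ := Finset.sum_le_sum fun e _ => hF e
      _ = (Fintype.card (LexEdge n) : ℝ) * κ := by
          rw [Finset.sum_const, Finset.card_univ, nsmul_eq_mul]
      _ ≤ n ^ 2 * κ := by
          gcongr
          exact_mod_cast LexEdge.card_le
  have s1 := hsum _ (hint (fun x => max 0 (((Set.projIcc (0 : ℝ) 1 zero_le_one (p - t)) : ℝ) - x))
    (by fun_prop) (fun _ => le_max_left _ _) fun x hx _ => max_zero_projIcc_sub_le hp1 ht hx)
  have s2 := hsum _ (hint (fun x => max 0 (x - ((Set.projIcc (0 : ℝ) 1 zero_le_one (p + t)) : ℝ)))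
    (by fun_prop) (fun _ => le_max_left _ _) fun x _ hx => max_zero_sub_projIcc_le hx)
  linarith

end Sandwich

/-! ### Choice of constants and conclusion. -/

theorem corollary1 (a b : ℝ) (ha : 0 < a) (hb : 0 < b) :
    ∃ c : ℝ, 0 < c ∧ ∀ ε : ℝ, 0 < ε → ∃ N : ℕ, ∀ (n d : ℕ) (p : ℝ), N ≤ n →
      a * max (n * p * Real.log n ^ 4) (Real.log n ^ 5) ≤ d → b / n ≤ p → p ≤ 1 →
      (∃ τ : ℝ, IsThreshold d p τ) ∧
      ∀ τ : ℝ, IsThreshold d p τ →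
        ∃ γ : Measure (SimpleGraph (Fin n) × SimpleGraph (Fin n) × SimpleGraph (Fin n)),
          IsTripleCoupling
            (erdosRenyi n (p * (1 - sandwichError c n d p)))
            (sphericalRGG n d τ)
            (erdosRenyi n (p * (1 + sandwichError c n d p))) γ ∧
          ENNReal.ofReal (1 - ε) ≤ γ {x | x.1 ≤ x.2.1 ∧ x.2.1 ≤ x.2.2} := by
  -- The constant `1` serves all `a` and `b`, because the concentration estimate gains a factor of
  -- order `√(log n)` over the stated error; `a`, `b` and `ε` only influence how large `n` must be.
  refine ⟨1, one_pos, fun ε hε => ?_⟩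
  set K : ℝ := max (max (10 ^ 17) (10 ^ 16 / a)) (max (1000 / b) (42 / ε)) with hK
  refine ⟨⌈Real.exp K⌉₊, fun n d p hn hd hp hp1 => ?_⟩
  have hn' : Real.exp K ≤ n := Nat.ceil_le.1 hn
  have hn0 : (0 : ℝ) < n := (Real.exp_pos _).trans_le hn'
  set L := Real.log n with hL
  have hKL : K ≤ L := (Real.le_log_iff_exp_le hn0).2 hn'
  have hexp : Real.exp L = n := Real.exp_log hn0
  have hL17 : 10 ^ 17 ≤ L := ((le_max_left _ _).trans (le_max_left _ _)).trans hKL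
  have haL : 10 ^ 16 ≤ a * L := by
    rw [← div_le_iff₀' ha]
    exact ((le_max_right _ _).trans (le_max_left _ _)).trans hKL
  have hbL : 1000 ≤ b * L := by
    rw [← div_le_iff₀' hb]
    exact ((le_max_left _ _).trans (le_max_right _ _)).trans hKL
  have hεL : 42 ≤ ε * L := by
    rw [← div_le_iff₀' hε]
    exact ((le_max_right _ _).trans (le_max_right _ _)).trans hKL
  have hL0 : 0 < L := by linarith
  have hLn : L ≤ n := by rw [← hexp]; linarith [Real.add_one_le_exp L]
  have hp0 : 0 < p := (div_pos hb hn0).trans_le hp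
  set Z := max (n * p) L with hZ
  have hZL : L ≤ Z := le_max_right _ _
  have hZ0 : 0 < Z := hL0.trans_le hZL
  have hZexp : Z ≤ Real.exp L := by
    rw [hexp]
    exact max_le (mul_le_of_le_one_right hn0.le hp1) hLn
  have hd' : a * Z * L ^ 4 ≤ d := by
    have e : max (n * p * L ^ 4) (L ^ 5) = Z * L ^ 4 := by
      rw [hZ, max_mul_of_nonneg _ _ (by positivity)]
      congr 1; ring
    rw [e, ← mul_assoc] at hd
    exact hd
  have hd2 : 2 ≤ d := by
    have : (2 : ℝ) ≤ d := by
      refine le_trans ?_ hd'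
      calc (2 : ℝ) ≤ 10 ^ 16 * 1 := by norm_num
        _ ≤ (a * L) * L ^ 4 := by gcongr; exact one_le_pow₀ (by linarith)
        _ ≤ _ := by gcongr
    exact_mod_cast this
  refine ⟨exists_isThreshold hd2 hp0.le hp1, fun τ hτ => ?_⟩
  have hcap := hτ.hasCapMass (by omega)
  set δ := sandwichError 1 n d p with hδ
  have hδe : δ = √Z * L ^ 2 / √d := by
    rw [hδ, sandwichError, one_mul, hZ, Real.sqrt_monotone.map_max]
  have hδ0 : 0 ≤ δ := by rw [hδe]; positivity
  have hb' : b * Real.exp (-L) ≤ p := by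
    rw [Real.exp_neg, hexp]; exact hp
  obtain ⟨γ, h1, h2⟩ := exists_sphericalRGG_sandwich (n := n) (τ := τ) (t := p * δ)
    (κ := 21 * Real.exp (-(3 * L))) (show d ≠ 0 by omega) hp1 (by positivity) (by positivity)
    (fun e => hcap.lintegral_edgeProb_excess_le hL17 haL hbL hZL hZexp hd' hδe hb' hp1
      (le_max_left _ _) e)
  refine ⟨γ, ?_, le_trans (ENNReal.ofReal_le_ofReal ?_) h2⟩
  · have e1 : p * (1 - δ) = p - p * δ := by ring
    have e2 : p * (1 + δ) = p + p * δ := by ring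
    rw [e1, e2]; exact h1
  · have e3 : Real.exp (-(3 * L)) = ((n : ℝ) ^ 3)⁻¹ := by
      rw [Real.exp_neg, ← hexp, ← Real.exp_nat_mul]; norm_num
    -- At most `n²` edges, two directions of failure and an excess of `21 n⁻³` each; the entry `42 /
    -- ε` of `K` makes this at most `ε`.
    have e4 : 2 * (n : ℝ) ^ 2 * (21 * Real.exp (-(3 * L))) = 42 / n := by
      rw [e3]; field_simp; norm_num
    rw [e4]
    have : 42 / (n : ℝ) ≤ ε := by
      rw [div_le_iff₀ hn0]
      exact hεL.trans (by gcongr)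
    linarith
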